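/- **Setting.** Let $\mathcal P=\mathcal P_0\oplus\mathcal P_1$ be a small superalgebra: a finite-dimensional, unital, $\mathbb Z_2$-graded commutative real algebra with a unital algebra projection $\#:\mathcal P\to\mathbb R$ whose kernel is nilpotent. Let $\mathcal M=(M,\mathcal C^\infty_{\mathcal M})$ be a $\mathcal P$-supermanifold of super dimension $(m,n)$: $M$ is a (Hausdorff) smooth $m$-dimensional manifold, and $\mathcal C^\infty_{\mathcal M}$ is a sheaf of unital graded $\mathcal P$-algebras on $M$ which is locally isomorphic to $\mathcal P\boxtimes(C^\infty_M\otimes\wedge\mathbb R^n)$. Sections $f$ of $\mathcal C^\infty_{\mathcal M}$ have a body $f^\#$, a smooth function on $M$, given in local trivializations by $\sum_I f_I\xi^I\mapsto (f_\emptyset)^\#$. $\mathcal P$-supermorphisms are morphisms of ringed spaces whose pullbacks are unital, parity preserving and $\mathcal P$-linear. The product $\mathbb R\times\mathcal M$ is the $\mathcal P$-supermanifold with body $\mathbb R\times M$ whose sections over an open set $W$ are the families $(s_t)_{t\in\mathbb R}$ of sections $s_t$ of $\mathcal C^\infty_{\mathcal M}$ over $W_t=\{x\mid(t,x)\in W\}$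 whose coefficients in local trivializations of $\mathcal C^\infty_{\mathcal M}$ are smooth in $(t,x)$; $\partial_t$ denotes differentiation of these coefficients with respect to $t$. Let $X$ be an even $\mathcal P$-super vector field on $\mathcal M$, i.e. an even global section of the sheaf of $\mathcal P$-linear super derivations of $\mathcal C^\infty_{\mathcal M}$. For $\Omega\subset\mathbb R\times M$ open, a $\mathcal P$-supermorphism $J:(\mathbb R\times\mathcal M)|_\Omega\to\mathcal M$ is a solution of $$\dot J=J^*X \qquad (5)$$ if $\partial_t(J^*f)=J^*(Xf)$ for all sections $f$ of $\mathcal C^\infty_{\mathcal M}$ over open subsets of $M$. Let $\Xi_X$ be the set of all open $\Omega\subset\mathbb R\times M$ such that * $\{t\in\mathbb R\mid(t,x)\in\Omega\}$ is an interval containing $0$ for every $x\in M$, and * there exists a solution $J:(\mathbb R\times\mathcal M)|_\Omega\to\mathcal M$ of (5) with $J|_{\{0\}\times\mathcal M}=\mathrm{Id}_{\mathcal M}$. **Theorem 3.4 (Global solution of (5)).** (i) For every $\Omega\in\Xi_X$ there exists exactly one solution $J_\Omega:(\mathbb R\times\mathcal M)|_\Omega\to\mathcal M$ of (5) with $J_\Omega|_{\{0\}\times\mathcal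 M}=\mathrm{Id}_{\mathcal M}$. (ii) There is exactly one smooth vector field $X^\#$ on $M$ with $X^\#(f^\#)=(Xf)^\#$ for all local sections $f$ of $\mathcal C^\infty_{\mathcal M}$ (the body of $X$). For every $x\in M$ there is a largest open interval $I_{x,X^\#}\ni 0$ on which there exists an integral curve $\gamma$ of $X^\#$ with $\gamma(0)=x$. The set $$\Omega_X:=\{(t,x)\in\mathbb R\times M\mid t\in I_{x,X^\#}\}$$ is open and is the largest element of $\Xi_X$. The solution $J_X:=J_{\Omega_X}$ is called the integral flow of $X$. -/

import Mathlib

open TopologicalSpace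
open scoped Manifold ContDiff TensorProduct DirectSum

universe u v w w'

noncomputable section

namespace PSuper

/-! ### Small superalgebras -/

/-- `P = P₀ ⊕ P₁` (with parts `𝒜 0`, `𝒜 1`) is a *small* superalgebra with body projection
`aug = # : P → ℝ`: besides being finite dimensional, it is graded commutative and the ideal `ker #`
is nilpotent (the power is that of subspaces of the algebra `P`; being nilpotent and of
codimension one, `ker #` is automatically the largest ideal). -/
structure IsSmall {P : Type u} [Ring P] [Algebra ℝ P] (𝒜 : ZMod 2 → Submodule ℝ P)
    [FiniteDimensional ℝ P] [GradedAlgebra 𝒜] (aug : P →ₐ[ℝ] ℝ) : Prop where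
  supercomm : ∀ (i j : ZMod 2) (a b : P), a ∈ 𝒜 i → b ∈ 𝒜 j →
    a * b = ((-1 : ℤˣ) ^ (i * j)) • (b * a)
  nilpotent : ∃ N : ℕ, (LinearMap.ker aug.toLinearMap) ^ N = ⊥

/-! ### Super ringed spaces over `P` -/

/-- A sheaf of unital `ℤ/2`-graded `P`-algebras on the topological space `X`: real algebras
`obj U` of sections with even and odd parts `gr U 0`, `gr U 1`, an even unital algebra
homomorphism `scalar U : P → obj U` giving the `P`-linear structure `a • f = scalar a * f`,
restriction maps, and the sheaf axiom. (That `scalar a` graded-commutes with all sections is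
automatic for the locally trivial sheaves considered below.) -/
structure SuperSheaf {P : Type u} [Ring P] [Algebra ℝ P] (𝒜 : ZMod 2 → Submodule ℝ P)
    (X : Type v) [TopologicalSpace X] where
  obj : Opens X → Type w
  [ring : ∀ U, Ring (obj U)]
  [alg : ∀ U, Algebra ℝ (obj U)]
  gr : ∀ U, ZMod 2 → Submodule ℝ (obj U)
  one_mem : ∀ U, (1 : obj U) ∈ gr U 0
  mul_mem : ∀ (U) (i j : ZMod 2) (f g : obj U), f ∈ gr U i → g ∈ gr U j → f * g ∈ gr U (i + j)
  isCompl : ∀ U, IsCompl (gr U 0) (gr U 1)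
  scalar : ∀ U, P →ₐ[ℝ] obj U
  scalar_mem : ∀ (U) (i : ZMod 2) (a : P), a ∈ 𝒜 i → scalar U a ∈ gr U i
  res : ∀ {U V : Opens X}, U ≤ V → (obj V →ₐ[ℝ] obj U)
  res_mem : ∀ {U V : Opens X} (h : U ≤ V) (i : ZMod 2) (f : obj V), f ∈ gr V i →
    res h f ∈ gr U i
  res_scalar : ∀ {U V : Opens X} (h : U ≤ V) (a : P), res h (scalar V a) = scalar U a
  res_refl : ∀ (U : Opens X) (f : obj U), res (le_refl U) f = f
  res_res : ∀ {U V W : Opens X} (h : U ≤ V) (h' : V ≤ W) (f : obj W),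
    res h (res h' f) = res (h.trans h') f
  glue : ∀ {J : Type v} (U : Opens X) (V : J → Opens X) (hV : ∀ j, V j ≤ U)
    (_ : U ≤ ⨆ j, V j) (s : ∀ j, obj (V j)),
    (∀ i j, res (inf_le_left : V i ⊓ V j ≤ V i) (s i) =
      res (inf_le_right : V i ⊓ V j ≤ V j) (s j)) →
    ∃! f : obj U, ∀ j, res (hV j) f = s j

attribute [instance] SuperSheaf.ring SuperSheaf.alg

section Sheaves

variable {P : Type u} [Ring P] [Algebra ℝ P] {𝒜 : ZMod 2 → Submodule ℝ P}
variable {X Y : Type v} [TopologicalSpace X] [TopologicalSpace Y]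

/-- An open subset of the open subspace `Ω`, regarded as an open subset of `X`. -/
def imageOpen (Ω : Opens X) (U : Opens Ω) : Opens X :=
  ⟨Subtype.val '' (U : Set Ω), Ω.isOpen.isOpenMap_subtype_val _ U.isOpen⟩

theorem imageOpen_mono (Ω : Opens X) {U V : Opens Ω} (h : U ≤ V) :
    imageOpen Ω U ≤ imageOpen Ω V := Set.image_mono h

theorem imageOpen_inf (Ω : Opens X) (U V : Opens Ω) :
    imageOpen Ω U ⊓ imageOpen Ω V ≤ imageOpen Ω (U ⊓ V) := by
  rintro x ⟨⟨a, ha, rfl⟩, ⟨b, hb, hab⟩⟩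
  obtain rfl : b = a := Subtype.ext hab
  exact ⟨b, ⟨ha, hb⟩, rfl⟩

/-- The restriction `𝒳|_Ω` of a super ringed space to an open subset. -/
def SuperSheaf.restrict (O : SuperSheaf.{u, v, w} 𝒜 X) (Ω : Opens X) :
    SuperSheaf.{u, v, w} 𝒜 Ω where
  obj U := O.obj (imageOpen Ω U)
  gr U := O.gr (imageOpen Ω U)
  one_mem U := O.one_mem _
  mul_mem U := O.mul_mem _
  isCompl U := O.isCompl _
  scalar U := O.scalar _
  scalar_mem U := O.scalar_mem _
  res h := O.res (imageOpen_mono Ω h)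
  res_mem h := O.res_mem _
  res_scalar h := O.res_scalar _
  res_refl U := O.res_refl _
  res_res h h' := O.res_res _ _
  glue := by
    intro J U V hV hU s hs
    refine O.glue (imageOpen Ω U) (fun j => imageOpen Ω (V j))
      (fun j => imageOpen_mono Ω (hV j)) ?_ s ?_
    · rintro x ⟨a, ha, rfl⟩
      obtain ⟨j, hj⟩ := Opens.mem_iSup.1 (hU ha)
      exact Opens.mem_iSup.2 ⟨j, a, hj, rfl⟩
    · intro i j
      have h := congrArg (O.res (imageOpen_inf Ω (V i) (V j))) (hs i j)
      rw [O.res_res, O.res_res] at h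
      exact h

/-- A `P`-supermorphism `Φ : 𝒳 → 𝒴`: a continuous body map together with unital, parity
preserving, `P`-linear algebra homomorphisms `Φ^* : 𝒪_Y(V) → 𝒪_X(Φ^{#-1} V)` compatible with
restrictions. -/
structure Hom (O : SuperSheaf.{u, v, w} 𝒜 X) (O' : SuperSheaf.{u, v, w'} 𝒜 Y) where
  body : C(X, Y)
  pullback : ∀ V : Opens Y, O'.obj V →ₐ[ℝ] O.obj (Opens.comap body V)
  pullback_mem : ∀ (V : Opens Y) (i : ZMod 2) (f : O'.obj V), f ∈ O'.gr V i →
    pullback V f ∈ O.gr _ i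
  pullback_scalar : ∀ (V : Opens Y) (a : P), pullback V (O'.scalar V a) = O.scalar _ a
  pullback_res : ∀ {V W : Opens Y} (h : V ≤ W) (f : O'.obj W),
    pullback V (O'.res h f) = O.res (Opens.comap_mono body h) (pullback W f)

/-- An isomorphism `𝒪|_U ≅ 𝒪'|_U` of sheaves of graded `P`-algebras over the open set `U`.
(Since `gr 0` and `gr 1` are complementary on both sides, an isomorphism mapping
`gr i` into `gr i` maps it onto `gr i`.) -/
structure LocalIso (O : SuperSheaf.{u, v, w} 𝒜 X) (O' : SuperSheaf.{u, v, w'} 𝒜 X)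
    (U : Opens X) where
  equiv : ∀ W : Opens X, W ≤ U → (O.obj W ≃ₐ[ℝ] O'.obj W)
  equiv_mem : ∀ (W : Opens X) (h : W ≤ U) (i : ZMod 2) (f : O.obj W), f ∈ O.gr W i →
    equiv W h f ∈ O'.gr W i
  equiv_scalar : ∀ (W : Opens X) (h : W ≤ U) (a : P), equiv W h (O.scalar W a) = O'.scalar W a
  equiv_res : ∀ {W W' : Opens X} (h : W ≤ W') (h' : W' ≤ U) (f : O.obj W'),
    equiv W (h.trans h') (O.res h f) = O'.res h (equiv W' h' f)

/-- An even `P`-super vector field: a global even section of the sheaf of `P`-linear super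
derivations of `𝒪`. (For an even derivation the graded Leibniz rule carries no sign.) -/
structure EvenVectorField (O : SuperSheaf.{u, v, w} 𝒜 X) where
  app : ∀ U : Opens X, O.obj U →ₗ[ℝ] O.obj U
  app_mem : ∀ (U : Opens X) (i : ZMod 2) (f : O.obj U), f ∈ O.gr U i → app U f ∈ O.gr U i
  app_scalar_mul : ∀ (U : Opens X) (a : P) (f : O.obj U),
    app U (O.scalar U a * f) = O.scalar U a * app U f
  leibniz : ∀ (U : Opens X) (f g : O.obj U), app U (f * g) = app U f * g + f * app U g
  app_res : ∀ {U V : Opens X} (h : U ≤ V) (f : O.obj V), app U (O.res h f) = O.res h (app V f)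

end Sheaves

/-! ### The coefficient algebra `P ⊠ Λℝⁿ` -/

section Coefficients

variable {P : Type u} [Ring P] [Algebra ℝ P] (𝒜 : ZMod 2 → Submodule ℝ P) [GradedAlgebra 𝒜]

/-- Even and odd part of the exterior algebra `Λℝⁿ` (the Clifford algebra of the zero form). -/
abbrev extParity (n : ℕ) : ZMod 2 → Submodule ℝ (ExteriorAlgebra ℝ (Fin n → ℝ)) :=
  CliffordAlgebra.evenOdd (0 : QuadraticForm ℝ (Fin n → ℝ))

instance extGraded (n : ℕ) : GradedAlgebra (extParity n) :=
  CliffordAlgebra.gradedAlgebra (0 : QuadraticForm ℝ (Fin n → ℝ))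

/-- The graded tensor product `P ⊠ Λℝⁿ`. -/
abbrev Coeff (n : ℕ) : Type u := 𝒜 ᵍ⊗[ℝ] (extParity n)

/-- Total parity on `P ⊠ Λℝⁿ`: `a ⊗ b` has parity `|a| + |b|`. -/
def coeffGr (n : ℕ) (i : ZMod 2) : Submodule ℝ (Coeff 𝒜 n) :=
  Submodule.span ℝ {x | ∃ (j k : ZMod 2) (a : 𝒜 j) (b : extParity n k), j + k = i ∧
    x = (a : P) ᵍ⊗ₜ[ℝ] (b : ExteriorAlgebra ℝ (Fin n → ℝ))}

/-- The body map `# : P ⊠ Λℝⁿ → ℝ`, `Σ a_I ξ^I ↦ (a_∅)^#`. -/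
def coeffBody (aug : P →ₐ[ℝ] ℝ) (n : ℕ) : Coeff 𝒜 n →ₗ[ℝ] ℝ :=
  LinearMap.mul' ℝ ℝ ∘ₗ
    TensorProduct.map aug.toLinearMap
      (ExteriorAlgebra.algebraMapInv (R := ℝ) (M := Fin n → ℝ)).toLinearMap ∘ₗ
    (GradedTensorProduct.of ℝ 𝒜 (extParity n)).symm.toLinearMap

theorem coeffGr_one (n : ℕ) : (1 : Coeff 𝒜 n) ∈ coeffGr 𝒜 n 0 :=
  Submodule.subset_span ⟨0, 0, ⟨1, SetLike.one_mem_graded 𝒜⟩,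
    ⟨1, SetLike.one_mem_graded (extParity n)⟩, by simp, rfl⟩

theorem coeffGr_includeLeft (n : ℕ) (i : ZMod 2) (a : P) (ha : a ∈ 𝒜 i) :
    GradedTensorProduct.includeLeft 𝒜 (extParity n) a ∈ coeffGr 𝒜 n i :=
  Submodule.subset_span ⟨i, 0, ⟨a, ha⟩, ⟨1, SetLike.one_mem_graded (extParity n)⟩, by simp, rfl⟩

theorem coeffGr_mul (n : ℕ) (i j : ZMod 2) (x y : Coeff 𝒜 n) (hx : x ∈ coeffGr 𝒜 n i)
    (hy : y ∈ coeffGr 𝒜 n j) : x * y ∈ coeffGr 𝒜 n (i + j) := by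
  have hle : coeffGr 𝒜 n i * coeffGr 𝒜 n j ≤ coeffGr 𝒜 n (i + j) := by
    unfold coeffGr
    rw [Submodule.span_mul_span, Submodule.span_le]
    rintro _ ⟨_, ⟨j₁, k₁, a₁, b₁, rfl, rfl⟩, _, ⟨j₂, k₂, a₂, b₂, rfl, rfl⟩, rfl⟩
    dsimp only
    rw [GradedTensorProduct.tmul_coe_mul_coe_tmul]
    have : ((a₁ : P) * a₂) ᵍ⊗ₜ[ℝ] ((b₁ : ExteriorAlgebra ℝ (Fin n → ℝ)) * b₂) ∈
        coeffGr 𝒜 n (j₁ + k₁ + (j₂ + k₂)) :=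
      Submodule.subset_span ⟨j₁ + j₂, k₁ + k₂, ⟨_, SetLike.mul_mem_graded a₁.2 a₂.2⟩,
        ⟨_, SetLike.mul_mem_graded b₁.2 b₂.2⟩, by ring, rfl⟩
    rcases Int.units_eq_one_or ((-1 : ℤˣ) ^ (k₁ * j₂)) with h | h
    · rw [h, one_smul]; exact this
    · rw [h, Units.neg_smul, one_smul]; exact neg_mem this
  exact hle (Submodule.mul_mem_mul hx hy)

/-- The parity involution of a `ℤ/2`-graded algebra. -/
def parityInvolution {A : Type*} [Ring A] [Algebra ℝ A] (ℬ : ZMod 2 → Submodule ℝ A)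
    [GradedAlgebra ℬ] : A →ₗ[ℝ] A :=
  GradedAlgebra.proj ℬ 0 - GradedAlgebra.proj ℬ 1

theorem parityInvolution_apply {A : Type*} [Ring A] [Algebra ℝ A] (ℬ : ZMod 2 → Submodule ℝ A)
    [GradedAlgebra ℬ] (i : ZMod 2) (a : ℬ i) :
    parityInvolution ℬ (a : A) = (if i = 0 then (1 : ℝ) else -1) • (a : A) := by
  rw [parityInvolution, LinearMap.sub_apply, GradedAlgebra.proj_apply, GradedAlgebra.proj_apply]
  obtain rfl | rfl : i = 0 ∨ i = 1 := 
    (by decide : ∀ i : ZMod 2, i = 0 ∨ i = 1) i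
  · rw [DirectSum.decompose_of_mem_same ℬ a.2, DirectSum.decompose_of_mem_ne ℬ a.2 zero_ne_one]
    simp
  · rw [DirectSum.decompose_of_mem_same ℬ a.2, DirectSum.decompose_of_mem_ne ℬ a.2 one_ne_zero]
    simp

theorem coeffGr_isCompl (n : ℕ) : IsCompl (coeffGr 𝒜 n 0) (coeffGr 𝒜 n 1) := by
  constructor
  · let σ : Coeff 𝒜 n →ₗ[ℝ] Coeff 𝒜 n :=
      (GradedTensorProduct.of ℝ 𝒜 (extParity n)).toLinearMap ∘ₗ
        TensorProduct.map (parityInvolution 𝒜) (parityInvolution (extParity n)) ∘ₗ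
        (GradedTensorProduct.of ℝ 𝒜 (extParity n)).symm.toLinearMap
    have hσ : ∀ (i : ZMod 2) (x : Coeff 𝒜 n), x ∈ coeffGr 𝒜 n i →
        σ x = (if i = 0 then (1 : ℝ) else -1) • x := by
      intro i x hx
      induction hx using Submodule.span_induction with
      | mem x hx =>
        obtain ⟨j, k, a, b, rfl, rfl⟩ := hx
        have : σ ((a : P) ᵍ⊗ₜ[ℝ] (b : ExteriorAlgebra ℝ (Fin n → ℝ))) =
          (parityInvolution 𝒜 (a : P)) ᵍ⊗ₜ[ℝ] (parityInvolution (extParity n)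
            (b : ExteriorAlgebra ℝ (Fin n → ℝ))) := rfl
        rw [this, parityInvolution_apply, parityInvolution_apply, GradedTensorProduct.tmul,
          TensorProduct.smul_tmul_smul, map_smul]
        congr 1
        have h11 : (1 : ZMod 2) + 1 = 0 := by decide
        have hd : ∀ i : ZMod 2, i = 0 ∨ i = 1 := by decide
        rcases hd j with rfl | rfl <;> rcases hd k with rfl | rfl <;> simp [h11]
      | zero => simp
      | add x y _ _ hx hy => rw [map_add, hx, hy, smul_add]
      | smul c x _ hx => rw [map_smul, hx, smul_comm]
    rw [Submodule.disjoint_def]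
    intro x h0 h1
    have e0 := hσ 0 x h0
    have e1 := hσ 1 x h1
    rw [e0, if_pos rfl, if_neg one_ne_zero, neg_smul, one_smul] at e1
    have h2 : (2 : ℝ) • x = 0 := by rw [two_smul]; nth_rewrite 1 [e1]; exact neg_add_cancel x
    exact (smul_eq_zero.1 h2).resolve_left two_ne_zero
  · rw [codisjoint_iff, eq_top_iff]
    rintro x -
    have key : ∀ (a : P) (b : ExteriorAlgebra ℝ (Fin n → ℝ)),
        a ᵍ⊗ₜ[ℝ] b ∈ coeffGr 𝒜 n 0 ⊔ coeffGr 𝒜 n 1 := by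
      classical
      intro a b
      rw [← DirectSum.sum_support_decompose 𝒜 a,
        ← DirectSum.sum_support_decompose (extParity n) b, GradedTensorProduct.tmul,
        TensorProduct.sum_tmul, map_sum]
      refine Submodule.sum_mem _ fun j _ => ?_
      rw [TensorProduct.tmul_sum, map_sum]
      refine Submodule.sum_mem _ fun k _ => ?_
      have hle : coeffGr 𝒜 n (j + k) ≤ coeffGr 𝒜 n 0 ⊔ coeffGr 𝒜 n 1 := by
        generalize j + k = i
        fin_cases i
        · exact le_sup_left
        · exact le_sup_right
      exact hle (Submodule.subset_span ⟨j, k, _, _, rfl, rfl⟩)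
    obtain ⟨y, rfl⟩ := (GradedTensorProduct.of ℝ 𝒜 (extParity n)).surjective x
    induction y using TensorProduct.induction_on with
    | zero => simp
    | tmul a b => exact key a b
    | add x y hx hy => rw [map_add]; exact add_mem hx hy

theorem coeff_finite [FiniteDimensional ℝ P] (n : ℕ) : FiniteDimensional ℝ (Coeff 𝒜 n) := by
  have : FiniteDimensional ℝ (ExteriorAlgebra ℝ (Fin n → ℝ)) :=
    ((Pi.basisFun ℝ (Fin n)).ExteriorAlgebra).finiteDimensional_of_finite
  exact inferInstanceAs (Module.Finite ℝ (P ⊗[ℝ] ExteriorAlgebra ℝ (Fin n → ℝ)))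

end Coefficients

/-! ### Smooth functions with values in a finite dimensional algebra -/

section Smooth

variable {E : Type*} [Ring E] [Algebra ℝ E] [FiniteDimensional ℝ E]
variable {F H N : Type*} [NormedAddCommGroup F] [NormedSpace ℝ F] [TopologicalSpace H]
  {I : ModelWithCorners ℝ F H} [TopologicalSpace N] [ChartedSpace H N]

theorem smoothOn_mul {f g : N → E} {s : Set N}
    (hf : ∀ l : E →ₗ[ℝ] ℝ, ContMDiffOn I 𝓘(ℝ, ℝ) ∞ (fun x => l (f x)) s)
    (hg : ∀ l : E →ₗ[ℝ] ℝ, ContMDiffOn I 𝓘(ℝ, ℝ) ∞ (fun x => l (g x)) s) (l : E →ₗ[ℝ] ℝ) :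
    ContMDiffOn I 𝓘(ℝ, ℝ) ∞ (fun x => l (f x * g x)) s := by
  let b := Module.finBasis ℝ E
  have h : ∀ x, l (f x * g x) =
      ∑ i, ∑ j, (b.coord i (f x) * b.coord j (g x)) * l (b i * b j) := by
    intro x
    conv_lhs => rw [← b.sum_repr (f x), ← b.sum_repr (g x)]
    rw [Finset.sum_mul, map_sum]
    refine Finset.sum_congr rfl fun i _ => ?_
    rw [Finset.mul_sum, map_sum]
    refine Finset.sum_congr rfl fun j _ => ?_
    rw [smul_mul_smul_comm, map_smul]
    rfl
  simp_rw [h]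
  refine contMDiffOn_finsetSum fun i _ => contMDiffOn_finsetSum fun j _ => ?_
  exact ((hf _).mul (hg _)).mul contMDiffOn_const

end Smooth

/-! ### The local model `P ⊠ (C^∞_M ⊗ Λℝⁿ)` -/

section Model

variable {P : Type u} [Ring P] [Algebra ℝ P] [FiniteDimensional ℝ P]
  (𝒜 : ZMod 2 → Submodule ℝ P) [GradedAlgebra 𝒜] (m n : ℕ)
variable {M : Type v} [TopologicalSpace M] [ChartedSpace (EuclideanSpace ℝ (Fin m)) M]

/-- Smooth functions on the open set `W` with values in the finite dimensional algebra
`P ⊠ Λℝⁿ` (smoothness is tested with all linear functionals), i.e. the sections of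
`P ⊠ (C^∞_M ⊗ Λℝⁿ)` over `W`. -/
def modelSections (W : Opens M) : Subalgebra ℝ (W → Coeff 𝒜 n) where
  carrier := {f | ∀ l : Coeff 𝒜 n →ₗ[ℝ] ℝ, ContMDiff (𝓡 m) 𝓘(ℝ, ℝ) ∞ (fun x => l (f x))}
  mul_mem' {f g} hf hg l := by
    have := coeff_finite 𝒜 n
    rw [← contMDiffOn_univ]
    exact smoothOn_mul (fun l => (hf l).contMDiffOn) (fun l => (hg l).contMDiffOn) l
  add_mem' {f g} hf hg l := by
    simp only [Pi.add_apply, map_add]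
    exact (hf l).add (hg l)
  algebraMap_mem' r l := by
    change ContMDiff (𝓡 m) 𝓘(ℝ, ℝ) ∞ (fun _ => l (algebraMap ℝ (Coeff 𝒜 n) r))
    exact contMDiff_const

/-- The sheaf `P ⊠ (C^∞_M ⊗ Λℝⁿ)` of graded `P`-algebras on the manifold `M`. -/
def model : SuperSheaf.{u, v, max u v} 𝒜 M where
  obj W := modelSections 𝒜 m n W
  gr W i :=
    { carrier := {f | ∀ x, f.1 x ∈ coeffGr 𝒜 n i}
      add_mem' := fun hf hg x => add_mem (hf x) (hg x)
      zero_mem' := fun x => zero_mem _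
      smul_mem' := fun c f hf x => Submodule.smul_mem _ c (hf x) }
  one_mem W x := coeffGr_one 𝒜 n
  mul_mem W i j f g hf hg x := coeffGr_mul 𝒜 n i j _ _ (hf x) (hg x)
  isCompl W := by
    constructor
    · rw [Submodule.disjoint_def]
      intro f h0 h1
      refine Subtype.ext (funext fun x => ?_)
      exact Submodule.disjoint_def.1 (coeffGr_isCompl 𝒜 n).disjoint _ (h0 x) (h1 x)
    · rw [codisjoint_iff, eq_top_iff]
      rintro f -
      have hc := coeffGr_isCompl 𝒜 n
      let p := (coeffGr 𝒜 n 0).subtype ∘ₗ Submodule.projectionOnto _ _ hc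
      have hp : ∀ y, y - p y ∈ coeffGr 𝒜 n 1 := by
        intro y
        rw [← Submodule.ker_projectionOnto hc, LinearMap.mem_ker, map_sub, sub_eq_zero]
        exact (Submodule.projectionOnto_apply_left hc _).symm
      let f0 : modelSections 𝒜 m n W := ⟨fun x => p (f.1 x), fun l => f.2 (l ∘ₗ p)⟩
      have : f = f0 + (f - f0) := by abel
      rw [this]
      exact Submodule.add_mem_sup (fun x => (Submodule.projectionOnto _ _ hc (f.1 x)).2)
        (fun x => hp (f.1 x))
  scalar W :=
    { toFun := fun a => ⟨fun _ => GradedTensorProduct.includeLeft 𝒜 (extParity n) a,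
        fun l => contMDiff_const⟩
      map_one' := Subtype.ext (funext fun _ => map_one _)
      map_mul' := fun a b => Subtype.ext (funext fun _ => map_mul _ a b)
      map_zero' := Subtype.ext (funext fun _ => map_zero _)
      map_add' := fun a b => Subtype.ext (funext fun _ => map_add _ a b)
      commutes' := fun r => Subtype.ext (funext fun _ => AlgHom.commutes _ r) }
  scalar_mem W i a ha x := coeffGr_includeLeft 𝒜 n i a ha
  res h :=
    { toFun := fun f => ⟨fun x => f.1 ⟨x.1, h x.2⟩,
        fun l => (f.2 l).comp (contMDiff_inclusion h)⟩
      map_one' := rfl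
      map_mul' := fun f g => rfl
      map_zero' := rfl
      map_add' := fun f g => rfl
      commutes' := fun r => rfl }
  res_mem h i f hf x := hf _
  res_scalar h a := rfl
  res_refl U f := rfl
  res_res h h' f := rfl
  glue := by
    intro J U V hV hU s hs
    have hx : ∀ x : U, ∃ j, x.1 ∈ V j := fun x => Opens.mem_iSup.1 (hU x.2)
    choose c hc using hx
    have hval : ∀ (i j : J) (x : M) (hi : x ∈ V i) (hj : x ∈ V j),
        (s i).1 ⟨x, hi⟩ = (s j).1 ⟨x, hj⟩ := fun i j x hi hj =>
      congrFun (congrArg Subtype.val (hs i j)) ⟨x, hi, hj⟩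
    refine ⟨⟨fun x => (s (c x)).1 ⟨x.1, hc x⟩, fun l x => ?_⟩, ?_, ?_⟩
    · classical
      let j := c x
      let F : M → ℝ := fun y => if hy : y ∈ V j then l ((s j).1 ⟨y, hy⟩) else 0
      have h1 : ContMDiffAt (𝓡 m) 𝓘(ℝ, ℝ) ∞ F x.1 := by
        have h2 : ContMDiffAt (𝓡 m) 𝓘(ℝ, ℝ) ∞ (fun y : V j => F y) ⟨x.1, hc x⟩ := by
          have : (fun y : V j => F y) = fun y => l ((s j).1 y) := by
            funext y; exact dif_pos y.2
          rw [this]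
          exact (s j).2 l _
        exact (contMDiffAt_subtype_iff (U := V j) (x := ⟨x.1, hc x⟩)).1 h2
      have h3 : ContMDiffAt (𝓡 m) 𝓘(ℝ, ℝ) ∞ (fun y : U => F y) x :=
        contMDiffAt_subtype_iff.2 h1
      refine h3.congr_of_eventuallyEq ?_
      have : ∀ᶠ y : U in nhds x, y.1 ∈ V j :=
        continuous_subtype_val.continuousAt.eventually ((V j).isOpen.mem_nhds (hc x))
      filter_upwards [this] with y hy
      simp only [F, dif_pos hy]
      rw [hval (c y) j y.1 (hc y) hy]
    · intro j
      exact Subtype.ext (funext fun x => hval _ _ _ _ _)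
    · intro g hg
      refine Subtype.ext (funext fun x => ?_)
      exact congrFun (congrArg Subtype.val (hg (c x))) ⟨x.1, hc x⟩

end Model

/-! ### `P`-supermanifolds -/

section Supermanifold

variable {P : Type u} [Ring P] [Algebra ℝ P] [FiniteDimensional ℝ P]
  {𝒜 : ZMod 2 → Submodule ℝ P} [GradedAlgebra 𝒜] (m n : ℕ)
variable {M : Type v} [TopologicalSpace M] [ChartedSpace (EuclideanSpace ℝ (Fin m)) M]

/-- A local trivialization over `U`: an isomorphism `𝒪|_U ≅ P ⊠ (C^∞_U ⊗ Λℝⁿ)` of sheaves of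
graded `P`-algebras. -/
abbrev Trivialization (O : SuperSheaf.{u, v, w} 𝒜 M) (U : Opens M) :=
  LocalIso O (model 𝒜 m n (M := M)) U

/-- `(M, 𝒪)` is a `P`-supermanifold of super dimension `(m, n)` with body the smooth
`m`-dimensional manifold `M`. -/
def IsSupermanifold (O : SuperSheaf.{u, v, w} 𝒜 M) : Prop :=
  ∀ x : M, ∃ U : Opens M, x ∈ U ∧ Nonempty (Trivialization m n O U)

variable {m n}
variable {O : SuperSheaf.{u, v, w} 𝒜 M} {U : Opens M}

/-- The value `φ(f)(x) ∈ P ⊠ Λℝⁿ` at `x ∈ U ∩ W` of a section `f` over `W` in the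
trivialization `φ` over `U`. -/
def evalAt (φ : Trivialization m n O U) {W : Opens M} {x : M} (hU : x ∈ U) (hW : x ∈ W) :
    O.obj W →ₐ[ℝ] Coeff 𝒜 n :=
  (Pi.evalAlgHom ℝ (fun _ : (U ⊓ W : Opens M) => Coeff 𝒜 n) ⟨x, hU, hW⟩).comp
    ((modelSections 𝒜 m n (U ⊓ W)).val.comp
      ((φ.equiv (U ⊓ W) inf_le_left).toAlgHom.comp (O.res inf_le_right)))

open Classical in
/-- The value `φ(f)(x) ∈ P ⊠ Λℝⁿ` as a total function of `x ∈ M`; only the values at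
`x ∈ U ∩ W` are meaningful, and it is `0` elsewhere. -/
def coord (φ : Trivialization m n O U) {W : Opens M} (f : O.obj W) (x : M) : Coeff 𝒜 n :=
  if h : x ∈ U ∧ x ∈ W then evalAt φ h.1 h.2 f else 0

theorem coord_of_mem (φ : Trivialization m n O U) {W : Opens M} (f : O.obj W) {x : M}
    (hU : x ∈ U) (hW : x ∈ W) : coord φ f x = evalAt φ hU hW f := dif_pos ⟨hU, hW⟩

theorem coord_res (φ : Trivialization m n O U) {W W' : Opens M} (h : W ≤ W') (f : O.obj W')
    {x : M} (hW : x ∈ W) : coord φ (O.res h f) x = coord φ f x := by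
  by_cases hU : x ∈ U
  · rw [coord_of_mem φ _ hU hW, coord_of_mem φ _ hU (h hW)]
    have e : O.res (inf_le_right : U ⊓ W ≤ W) (O.res h f) =
        O.res (inf_le_inf_left U h : U ⊓ W ≤ U ⊓ W') (O.res inf_le_right f) := by
      rw [O.res_res, O.res_res]
    have e' := φ.equiv_res (inf_le_inf_left U h) inf_le_left (O.res inf_le_right f)
    have := congrFun (congrArg Subtype.val ((congrArg (φ.equiv (U ⊓ W) inf_le_left) e).trans e'))
      ⟨x, hU, hW⟩
    exact this
  · rw [coord, coord, dif_neg (fun h => hU h.1), dif_neg (fun h => hU h.1)]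

theorem coord_gr (φ : Trivialization m n O U) {W : Opens M} (i : ZMod 2) {f : O.obj W}
    (hf : f ∈ O.gr W i) (x : M) : coord φ f x ∈ coeffGr 𝒜 n i := by
  by_cases h : x ∈ U ∧ x ∈ W
  · rw [coord_of_mem φ _ h.1 h.2]
    exact φ.equiv_mem _ _ i _ (O.res_mem _ i f hf) ⟨x, h⟩
  · rw [coord, dif_neg h]; exact zero_mem _

theorem coord_scalar (φ : Trivialization m n O U) {W : Opens M} (a : P) {x : M}
    (hU : x ∈ U) (hW : x ∈ W) :
    coord φ (O.scalar W a) x = GradedTensorProduct.includeLeft 𝒜 (extParity n) a := by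
  rw [coord_of_mem φ _ hU hW]
  have e := φ.equiv_scalar (U ⊓ W) inf_le_left a
  rw [← O.res_scalar (inf_le_right : U ⊓ W ≤ W) a] at e
  exact congrFun (congrArg Subtype.val e) ⟨x, hU, hW⟩

/-! ### The product `ℝ × 𝓜` -/

/-- The slice `W_t = {x | (t, x) ∈ W}` of an open set `W ⊂ ℝ × M`. -/
def slice (W : Opens (ℝ × M)) (t : ℝ) : Opens M :=
  Opens.comap ⟨fun x => (t, x), by fun_prop⟩ W

theorem slice_mono {W W' : Opens (ℝ × M)} (h : W ≤ W') (t : ℝ) : slice W t ≤ slice W' t :=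
  fun _ hx => h hx

variable (m n O) in
/-- Sections of `ℝ × 𝓜` over the open set `W ⊂ ℝ × M`: families `(s_t)` of sections
`s_t ∈ 𝒪(W_t)` which depend smoothly on `t`, in the sense that in every local trivialization
`φ` of `𝒪` over some `U` the coefficients `φ(s_t)(x)` are smooth functions of `(t, x)`. In a
trivialization these are exactly the elements of `P ⊠ (C^∞(W) ⊗ Λℝⁿ)`. -/
def timeSections (W : Opens (ℝ × M)) : Subalgebra ℝ (∀ t : ℝ, O.obj (slice W t)) where
  carrier := {s | ∀ (U : Opens M) (φ : Trivialization m n O U) (l : Coeff 𝒜 n →ₗ[ℝ] ℝ),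
    ContMDiffOn (𝓘(ℝ, ℝ).prod (𝓡 m)) 𝓘(ℝ, ℝ) ∞ (fun p : ℝ × M => l (coord φ (s p.1) p.2))
      {p | p ∈ W ∧ p.2 ∈ U}}
  mul_mem' {s s'} hs hs' U φ l := by
    have := coeff_finite 𝒜 n
    refine (smoothOn_mul (hs U φ) (hs' U φ) l).congr fun p hp => ?_
    have hW : p.2 ∈ slice W p.1 := hp.1
    rw [coord_of_mem φ _ hp.2 hW, coord_of_mem φ _ hp.2 hW, coord_of_mem φ _ hp.2 hW,
      Pi.mul_apply, map_mul]
  add_mem' {s s'} hs hs' U φ l := by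
    refine ((hs U φ l).add (hs' U φ l)).congr fun p hp => ?_
    have hW : p.2 ∈ slice W p.1 := hp.1
    simp only [Pi.add_apply]
    rw [coord_of_mem φ _ hp.2 hW, coord_of_mem φ _ hp.2 hW, coord_of_mem φ _ hp.2 hW,
      map_add, map_add]
  algebraMap_mem' r U φ l := by
    refine (contMDiffOn_const (c := l (algebraMap ℝ _ r))).congr fun p hp => ?_
    have hW : p.2 ∈ slice W p.1 := hp.1
    rw [coord_of_mem φ _ hp.2 hW, Pi.algebraMap_apply, AlgHom.commutes]

variable (m n O) in
/-- The `P`-supermanifold `ℝ × 𝓜` with body `ℝ × M`. -/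
def timeProduct : SuperSheaf.{u, v, w} 𝒜 (ℝ × M) where
  obj W := timeSections m n O W
  gr W i :=
    { carrier := {s | ∀ t, s.1 t ∈ O.gr (slice W t) i}
      add_mem' := fun hs hs' t => add_mem (hs t) (hs' t)
      zero_mem' := fun t => zero_mem _
      smul_mem' := fun c s hs t => Submodule.smul_mem _ c (hs t) }
  one_mem W t := O.one_mem _
  mul_mem W i j s s' hs hs' t := O.mul_mem _ i j _ _ (hs t) (hs' t)
  isCompl W := by
    constructor
    · rw [Submodule.disjoint_def]
      intro s h0 h1
      refine Subtype.ext (funext fun t => ?_)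
      exact Submodule.disjoint_def.1 (O.isCompl _).disjoint _ (h0 t) (h1 t)
    · rw [codisjoint_iff, eq_top_iff]
      rintro s -
      have hex : ∀ t, ∃ a ∈ O.gr (slice W t) 0, ∃ b ∈ O.gr (slice W t) 1, a + b = s.1 t :=
        fun t => Submodule.mem_sup.1 ((O.isCompl (slice W t)).sup_eq_top ▸ Submodule.mem_top)
      choose a ha b hb hab using hex
      have hc := coeffGr_isCompl 𝒜 n
      let q := (coeffGr 𝒜 n 0).subtype ∘ₗ Submodule.projectionOnto _ _ hc
      have hsm : a ∈ timeSections m n O W := by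
        intro U φ l
        refine (s.2 U φ (l ∘ₗ q)).congr fun p hp => ?_
        have hW : p.2 ∈ slice W p.1 := hp.1
        have h0 := coord_gr φ 0 (ha p.1) p.2
        have h1 := coord_gr φ 1 (hb p.1) p.2
        have e : coord φ (s.1 p.1) p.2 = coord φ (a p.1) p.2 + coord φ (b p.1) p.2 := by
          rw [← hab p.1, coord_of_mem φ _ hp.2 hW, coord_of_mem φ _ hp.2 hW,
            coord_of_mem φ _ hp.2 hW, map_add]
        have e0 : q (coord φ (a p.1) p.2) = coord φ (a p.1) p.2 :=
          congrArg Subtype.val (Submodule.projectionOnto_apply_left hc ⟨_, h0⟩)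
        have e1 : q (coord φ (b p.1) p.2) = 0 := by
          have : Submodule.projectionOnto _ _ hc (coord φ (b p.1) p.2) = 0 := by
            rw [← LinearMap.mem_ker, Submodule.ker_projectionOnto hc]; exact h1
          exact congrArg Subtype.val this
        rw [LinearMap.comp_apply, e, map_add, e0, e1, add_zero]
      have : s = ⟨a, hsm⟩ + (s - ⟨a, hsm⟩) := by abel
      rw [this]
      refine Submodule.add_mem_sup (fun t => ha t) (fun t => ?_)
      have : (s - ⟨a, hsm⟩ : timeSections m n O W).1 t = b t := by
        change s.1 t - a t = b t
        rw [← hab t, add_sub_cancel_left]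
      rw [this]
      exact hb t
  scalar W :=
    { toFun := fun a => ⟨fun t => O.scalar (slice W t) a, fun U φ l =>
        (contMDiffOn_const (c := l (GradedTensorProduct.includeLeft 𝒜 (extParity n) a))).congr
          fun p hp => by rw [coord_scalar φ a hp.2 (show p.2 ∈ slice W p.1 from hp.1)]⟩
      map_one' := Subtype.ext (funext fun _ => map_one _)
      map_mul' := fun a b => Subtype.ext (funext fun _ => map_mul _ a b)
      map_zero' := Subtype.ext (funext fun _ => map_zero _)
      map_add' := fun a b => Subtype.ext (funext fun _ => map_add _ a b)
      commutes' := fun r => Subtype.ext (funext fun _ => AlgHom.commutes _ r) }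
  scalar_mem W i a ha t := O.scalar_mem _ i a ha
  res {W W'} h :=
    { toFun := fun s => ⟨fun t => O.res (slice_mono h t) (s.1 t), fun U φ l =>
        ((s.2 U φ l).mono fun _ hp => ⟨h hp.1, hp.2⟩).congr fun p hp => by
          rw [coord_res φ _ _ (show p.2 ∈ slice W p.1 from hp.1)]⟩
      map_one' := Subtype.ext (funext fun _ => map_one _)
      map_mul' := fun a b => Subtype.ext (funext fun _ => map_mul _ _ _)
      map_zero' := Subtype.ext (funext fun _ => map_zero _)
      map_add' := fun a b => Subtype.ext (funext fun _ => map_add _ _ _)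
      commutes' := fun r => Subtype.ext (funext fun _ => AlgHom.commutes _ r) }
  res_mem h i s hs t := O.res_mem _ i _ (hs t)
  res_scalar h a := Subtype.ext (funext fun _ => O.res_scalar _ a)
  res_refl W s := Subtype.ext (funext fun _ => O.res_refl _ _)
  res_res h h' s := Subtype.ext (funext fun _ => O.res_res _ _ _)
  glue := by
    intro J W V hV hW s hs
    have hcov : ∀ t, slice W t ≤ ⨆ j, slice (V j) t := by
      intro t x hx
      obtain ⟨j, hj⟩ := Opens.mem_iSup.1 (hW hx)
      exact Opens.mem_iSup.2 ⟨j, hj⟩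
    have hglue := fun t => O.glue (slice W t) (fun j => slice (V j) t)
      (fun j => slice_mono (hV j) t) (hcov t) (fun j => (s j).1 t)
      (fun i j => congrFun (congrArg Subtype.val (hs i j)) t)
    choose f hf huniq using hglue
    refine ⟨⟨f, fun U φ l p hp => ?_⟩, ?_, ?_⟩
    · obtain ⟨j, hj⟩ := Opens.mem_iSup.1 (hW hp.1)
      have h1 := (s j).2 U φ l p ⟨hj, hp.2⟩
      have e : ∀ p' : ℝ × M, p' ∈ V j →
          l (coord φ (f p'.1) p'.2) = l (coord φ ((s j).1 p'.1) p'.2) := by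
        intro p' hp'
        rw [← hf p'.1 j, coord_res φ _ _ (show p'.2 ∈ slice (V j) p'.1 from hp')]
      refine ContMDiffWithinAt.mono_of_mem_nhdsWithin
        (h1.congr (fun p' hp' => e p' hp'.1) (e p hj)) ?_
      refine Filter.mem_of_superset (inter_mem_nhdsWithin _ ((V j).isOpen.mem_nhds hj)) ?_
      exact fun p' hp' => ⟨hp'.2, hp'.1.2⟩
    · intro j
      exact Subtype.ext (funext fun t => hf t j)
    · intro g hg
      refine Subtype.ext (funext fun t => huniq t _ fun j => ?_)
      exact congrFun (congrArg Subtype.val (hg j)) t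

/-- `s' = ∂_t s` for sections of `ℝ × 𝓜` over `W`: in every local trivialization the
coefficients of `s'` are the time derivatives of the coefficients of `s`. -/
def IsTimeDeriv {W : Opens (ℝ × M)} (s s' : (timeProduct m n O).obj W) : Prop :=
  ∀ (U : Opens M) (φ : Trivialization m n O U) (l : Coeff 𝒜 n →ₗ[ℝ] ℝ) (t : ℝ) (x : M),
    (t, x) ∈ W → x ∈ U →
      HasDerivAt (fun τ : ℝ => l (coord φ (s.1 τ) x)) (l (coord φ (s'.1 t) x)) t

/-- `Ω ⊂ ℝ × M` is an interval bundle: all `Ω ∩ (ℝ × {x})` are intervals containing `0`. -/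
def IsIntervalBundle (Ω : Opens (ℝ × M)) : Prop :=
  ∀ x : M, (0, x) ∈ Ω ∧ {t : ℝ | (t, x) ∈ Ω}.OrdConnected

/-- The flow equation `∂_t J = J^* X` together with `J|_{t=0} = Id`, for a supermorphism
`J : (ℝ × 𝓜)|_Ω → 𝓜`. The derivative `∂_t J` is the derivation `f ↦ ∂_t (J^* f)` along `J` and
`J^* X` is the derivation `f ↦ J^* (X f)`; the pullback of a section of `(ℝ × 𝓜)|_Ω` to
`{0} × 𝓜 = 𝓜` is the value of the family at `t = 0`. -/
structure IsFlow (X : EvenVectorField O) (Ω : Opens (ℝ × M))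
    (J : Hom ((timeProduct m n O).restrict Ω) O) : Prop where
  deriv : ∀ (V : Opens M) (f : O.obj V),
    IsTimeDeriv (W := imageOpen Ω (Opens.comap J.body V)) (J.pullback V f)
      (J.pullback V (X.app V f))
  body_zero : ∀ (x : M) (h : (0, x) ∈ Ω), J.body ⟨(0, x), h⟩ = x
  pullback_zero : ∀ (V : Opens M) (h : V ≤ slice (imageOpen Ω (Opens.comap J.body V)) 0)
    (f : O.obj V), O.res h ((J.pullback V f).1 0) = f

variable (m n) in
/-- The set `Ξ_X` of all open interval bundles `Ω` on which the flow equation with initial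
value `Id` has a solution. -/
def flowBundles (X : EvenVectorField O) : Set (Opens (ℝ × M)) :=
  {Ω | IsIntervalBundle Ω ∧ ∃ J : Hom ((timeProduct m n O).restrict Ω) O, IsFlow X Ω J}

/-! ### The body vector field and its maximal integral curves -/

variable (m n) in
/-- `v` is the body vector field `X^#`: the smooth vector field on `M` with
`X^# (f^#) = (X f)^#` for all local sections `f`, where `f^#` is the body of `f`, computed in
local trivializations. -/
structure IsBodyField [IsManifold (𝓡 m) ∞ M] (aug : P →ₐ[ℝ] ℝ) (X : EvenVectorField O)
    (v : (x : M) → TangentSpace (𝓡 m) x) : Prop where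
  smooth : ContMDiff (𝓡 m) (𝓡 m).tangent ∞ (fun x => (⟨x, v x⟩ : TangentBundle (𝓡 m) M))
  apply_body : ∀ (U : Opens M) (φ : Trivialization m n O U) (W : Opens M) (f : O.obj W) (x : M),
    x ∈ U → x ∈ W →
      mfderiv (𝓡 m) 𝓘(ℝ, ℝ) (fun y => coeffBody 𝒜 aug n (coord φ f y)) x (v x) =
        coeffBody 𝒜 aug n (coord φ (X.app W f) x)

end Supermanifold

/-- The open intervals `I ∋ 0` on which there is an integral curve `γ` of `v` with
`γ(0) = x`. -/
def integralIntervals {m : ℕ} {M : Type v} [TopologicalSpace M]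
    [ChartedSpace (EuclideanSpace ℝ (Fin m)) M] (v : (x : M) → TangentSpace (𝓡 m) x) (x : M) :
    Set (Set ℝ) :=
  {I | IsOpen I ∧ I.OrdConnected ∧ 0 ∈ I ∧
    ∃ γ : ℝ → M, IsMIntegralCurveOn (I := 𝓡 m) γ v I ∧ γ 0 = x}

end PSuper

end

/-! The flow equation is reduced to an ordinary differential equation in a finite-dimensional real
vector space. Let A = P ⊠ Λℝⁿ. Evaluating sections at x in a trivialization is a parity preserving
P-linear homomorphism from germs of sections to A, and all such homomorphisms are called points over
x (`IsPoint`). A point is determined by its values on the m even and n odd coordinate sections: it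
is Taylor expansion around its body (`nilEval`), a finite sum because the even elements of body 0
form a nilpotent space. The proof iterates Hadamard's lemma, each round gaining one nilpotent factor
(`germ_map_eq_zero`, `IsGermHom.eq_nilEval`, `IsPoint.eq_nilEval`). Hence the points over a
superchart form an open subset of A₀^m × A₁^n (`Pt`), X induces a smooth vector field on it
(`flowField`), and curves of points satisfy the flow equation exactly when their coordinates solve
the resulting ordinary equation (`IsFlowCurve.hasDerivAt_ptOf`, `hasDerivAt_nilEval`).

Uniqueness: evaluating a flow J at x gives a curve of points, and two such curves with the same
start coincide by uniqueness for ordinary equations and an open-closed argument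
(`IsFlowCurve.eqOn`). Since sections are determined by their coefficients, the two flows agree.

Existence: the ordinary equation has a smooth local flow, obtained from the implicit function
theorem on the Banach space of curves on [0, 1]. Taylor evaluation in the initial position extends
it from real initial points to arbitrary ones, with an existence time that depends only on the body.
So nilpotent directions never shorten the flow: along an integral curve of X^# it can be continued
as long as the curve exists, on a neighbourhood of the initial position (`IsFlowBox.extend`,
`exists_isFlowBox`). These boxes show that Ω_X is open. Uniqueness makes them compatible across
supercharts, and they glue to a supermorphism (`exists_isGlobalFlow`, `IsGlobalFlow.hom`).

Maximality: the base of the coordinate equation is the equation of X^#, so the body of every flow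
consists of integral curves of X^#, and no time interval exceeds the maximal one
(`IsFlow.mem_integralIntervals`). -/

noncomputable section

namespace PSuper

open Filter Topology

/-! ### Smooth superposition operators -/

section Superposition

open Filter Topology

variable {K : Type*} [TopologicalSpace K] [CompactSpace K]

/-- Pointwise application of a continuous family of continuous linear maps. -/
def pointwiseApply (K : Type*) [TopologicalSpace K] [CompactSpace K] (E : Type u) (F : Type v)
    [NormedAddCommGroup E] [NormedSpace ℝ E]
    [NormedAddCommGroup F] [NormedSpace ℝ F] :
    C(K, E →L[ℝ] F) →L[ℝ] C(K, E) →L[ℝ] C(K, F) :=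
  LinearMap.mkContinuous₂
    (LinearMap.mk₂ ℝ (fun (L : C(K, E →L[ℝ] F)) (h : C(K, E)) =>
        (⟨fun s => L s (h s), by fun_prop⟩ : C(K, F)))
      (fun _ _ _ => by ext; simp) (fun _ _ _ => by ext; simp)
      (fun _ _ _ => by ext; simp) (fun _ _ _ => by ext; simp)) 1 (by
    intro L h
    refine (ContinuousMap.norm_le _ (by positivity)).2 fun s => ?_
    rw [one_mul]
    exact ((L s).le_opNorm _).trans (mul_le_mul (L.norm_coe_le_norm s) (h.norm_coe_le_norm s)
      (norm_nonneg _) (norm_nonneg L)))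

/-- The mean value inequality, applied at each point of K, bounds the error by the oscillation of G'
between u and u + τη. That oscillation is uniformly small because postcomposition with G' is
continuous for the sup norm. -/
theorem hasFDerivAt_postcomp {E : Type u} {F : Type v}
    [NormedAddCommGroup E] [NormedSpace ℝ E]
    [NormedAddCommGroup F] [NormedSpace ℝ F]
    (G : C(E, F)) (G' : C(E, E →L[ℝ] F)) (hG : ∀ x, HasFDerivAt G (G' x) x) (u : C(K, E)) :
    HasFDerivAt (fun u : C(K, E) => G.comp u) (pointwiseApply K E F (G'.comp u)) u := by
  rw [hasFDerivAt_iff_isLittleO_nhds_zero, Asymptotics.isLittleO_iff]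
  intro ε hε
  have hc : ContinuousAt (fun v : C(K, E) => G'.comp v) u :=
    (ContinuousMap.continuous_postcomp G').continuousAt
  obtain ⟨δ, hδ, h⟩ := Metric.continuousAt_iff (f := fun v : C(K, E) => G'.comp v).1 hc ε hε
  filter_upwards [Metric.ball_mem_nhds (0 : C(K, E)) hδ] with η hη
  rw [mem_ball_zero_iff] at hη
  refine (ContinuousMap.norm_le _ (by positivity)).2 fun s => ?_
  -- A point of the segment is the value at s of the curve u + τη, which lies within δ of u, so one
  -- δ serves all s.
  have key : ∀ y ∈ segment ℝ (u s) (u s + η s), ‖G' y - G' (u s)‖ ≤ ε := by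
    intro y hy
    rw [segment_eq_image'] at hy
    obtain ⟨τ, hτ, rfl⟩ := hy
    have h1 : dist (u + τ • η) u < δ := by
      rw [dist_eq_norm, add_sub_cancel_left, norm_smul, Real.norm_of_nonneg hτ.1]
      exact (mul_le_of_le_one_left (norm_nonneg _) hτ.2).trans_lt hη
    have h2 := h h1
    have h3 := (ContinuousMap.dist_apply_le_dist (f := G'.comp (u + τ • η)) (g := G'.comp u)
      s).trans h2.le
    simpa [dist_eq_norm] using h3
  have := (convex_segment (𝕜 := ℝ) (u s) (u s + η s)).norm_image_sub_le_of_norm_hasFDerivWithin_le'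
    (fun y _ => (hG y).hasFDerivWithinAt) key (left_mem_segment ℝ _ _) (right_mem_segment ℝ _ _)
  rw [add_sub_cancel_left] at this
  exact this.trans (mul_le_mul_of_nonneg_left (η.norm_coe_le_norm s) hε.le)

/-- Induction on k: the derivative of postcomposition with G is postcomposition with G' followed by
the continuous linear `pointwiseApply`. The target space changes during the induction; F lives in
universe `max u v` so that E →L F lives there too. -/
theorem contDiff_postcomp_nat (k : ℕ) : ∀ {E : Type u} {F : Type (max u v)}
    [NormedAddCommGroup E] [NormedSpace ℝ E]
    [NormedAddCommGroup F] [NormedSpace ℝ F]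
    (G : C(E, F)), ContDiff ℝ k G → ContDiff ℝ k (fun u : C(K, E) => G.comp u) := by
  induction k with
  | zero =>
    intro E F _ _ _ _ G _
    exact contDiff_zero.2 (ContinuousMap.continuous_postcomp G)
  | succ k ih =>
    intro E F _ _ _ _ G hG
    push_cast at hG ⊢
    obtain ⟨G', hG', h⟩ := contDiff_succ_iff_hasFDerivAt.1 hG
    refine contDiff_succ_iff_hasFDerivAt.2 ⟨_, ?_, hasFDerivAt_postcomp G ⟨G', hG'.continuous⟩ h⟩
    exact (pointwiseApply K E F).contDiff.comp (ih ⟨G', hG'.continuous⟩ hG')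

theorem contDiff_postcomp {E : Type u} {F : Type (max u v)}
    [NormedAddCommGroup E] [NormedSpace ℝ E]
    [NormedAddCommGroup F] [NormedSpace ℝ F] (G : C(E, F)) (hG : ContDiff ℝ ∞ G) :
    ContDiff ℝ ∞ (fun u : C(K, E) => G.comp u) :=
  contDiff_infty.2 fun k => contDiff_postcomp_nat.{u, v} k G (contDiff_infty.1 hG k)

end Superposition

/-! ### Integration of continuous functions on the unit interval -/

section Integration

open MeasureTheory

variable {E : Type u} [NormedAddCommGroup E] [NormedSpace ℝ E]

/-- The primitive `s ↦ ∫₀ˢ u` of a continuous function on `[0, 1]`. -/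
def unitPrimitive (E : Type u) [NormedAddCommGroup E] [NormedSpace ℝ E] :
    C(unitInterval, E) →L[ℝ] C(unitInterval, E) :=
  LinearMap.mkContinuous
    { toFun := fun u => ⟨fun s => ∫ r in (0 : ℝ)..s, Set.IccExtend zero_le_one u r, by
        have h : Continuous (Set.IccExtend (zero_le_one (α := ℝ)) u) := u.continuous.Icc_extend'
        exact (intervalIntegral.continuous_primitive
          (fun a b => h.intervalIntegrable a b) 0).comp continuous_subtype_val⟩
      map_add' := fun u u' => by
        ext s
        have h : Continuous (Set.IccExtend (zero_le_one (α := ℝ)) u) := u.continuous.Icc_extend'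
        have h' : Continuous (Set.IccExtend (zero_le_one (α := ℝ)) u') := u'.continuous.Icc_extend'
        exact intervalIntegral.integral_add (h.intervalIntegrable _ _) (h'.intervalIntegrable _ _)
      map_smul' := fun c u => by
        ext s
        exact intervalIntegral.integral_smul c _ } 1 (by
    intro u
    rw [one_mul]
    refine (ContinuousMap.norm_le _ (norm_nonneg _)).2 fun s => ?_
    refine (intervalIntegral.norm_integral_le_of_norm_le_const (C := ‖u‖)
      fun r _ => u.norm_coe_le_norm _).trans ?_
    rw [sub_zero, abs_of_nonneg s.2.1]
    exact mul_le_of_le_one_right (norm_nonneg _) s.2.2)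

theorem unitPrimitive_apply (u : C(unitInterval, E)) (s : unitInterval) :
    unitPrimitive E u s = ∫ r in (0 : ℝ)..s, Set.IccExtend zero_le_one u r := rfl

end Integration

/-! ### Hadamard's lemma -/

section Hadamard

open Filter Topology

variable {E : Type u} [NormedAddCommGroup E] [NormedSpace ℝ E]
  {A : Type v} [NormedAddCommGroup A] [NormedSpace ℝ A]

/-- The continuous curve `s ↦ y + s (x - y)` on `[0, 1]`. -/
def unitSegment (y x : E) : C(unitInterval, E) := ⟨fun s => y + (s : ℝ) • (x - y), by fun_prop⟩

/-- Affine in x: a constant curve plus the continuous linear map x ↦ (s ↦ s x) applied to x - y. -/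
theorem contDiff_unitSegment (y : E) : ContDiff ℝ ∞ (unitSegment y) := by
  let c : E →L[ℝ] C(unitInterval, E) :=
    LinearMap.mkContinuous
      { toFun := fun x => ⟨fun s => (s : ℝ) • x, by fun_prop⟩
        map_add' := fun _ _ => by ext; simp
        map_smul' := fun _ _ => by ext s; exact smul_comm _ _ _ } 1 (by
      intro x
      rw [one_mul]
      refine (ContinuousMap.norm_le _ (norm_nonneg _)).2 fun s => ?_
      change ‖(s : ℝ) • x‖ ≤ _
      rw [norm_smul, Real.norm_of_nonneg s.2.1]
      exact mul_le_of_le_one_left (norm_nonneg _) s.2.2)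
  have : unitSegment y = fun x => ContinuousMap.const _ y + c (x - y) := by
    ext x s; rfl
  rw [this]
  exact contDiff_const.add (c.contDiff.comp (contDiff_id.sub contDiff_const))

/-- Hadamard's lemma for globally smooth functions. -/
theorem exists_hadamard_of_contDiff [CompleteSpace A] {F : E → A} (hF : ContDiff ℝ ∞ F) (y : E) :
    ∃ G : E → E →L[ℝ] A, ContDiff ℝ ∞ G ∧ ∀ x, F x = F y + G x (x - y) := by
  have hF' : ContDiff ℝ ∞ (fderiv ℝ F) := hF.fderiv_right (m := ∞) le_rfl
  let D : C(E, E →L[ℝ] A) := ⟨fderiv ℝ F, hF'.continuous⟩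
  let J : C(unitInterval, E →L[ℝ] A) → E →L[ℝ] A := fun u => unitPrimitive _ u 1
  have hJ : ContDiff ℝ ∞ J :=
    (ContinuousMap.evalCLM (M := E →L[ℝ] A) ℝ (1 : unitInterval)).contDiff.comp
      (unitPrimitive (E →L[ℝ] A)).contDiff
  -- G is the average of DF over the segment from y to x, written as the segment map, then
  -- postcomposition with DF, then integration. Each factor is smooth, so nothing has to be
  -- differentiated under the integral sign.
  refine ⟨fun x => J (D.comp (unitSegment y x)), ?_, fun x => ?_⟩
  · exact hJ.comp ((contDiff_postcomp.{u, v} D hF').comp (contDiff_unitSegment y))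
  · have hcont : Continuous fun s : ℝ => fderiv ℝ F (y + s • (x - y)) :=
      hF'.continuous.comp (by fun_prop)
    have h1 : J (D.comp (unitSegment y x)) =
        ∫ s in (0 : ℝ)..1, fderiv ℝ F (y + s • (x - y)) := by
      change ∫ r in (0 : ℝ)..1, _ = _
      refine intervalIntegral.integral_congr fun r hr => ?_
      rw [Set.uIcc_of_le zero_le_one] at hr
      simp only [Set.IccExtend_of_mem _ _ hr]
      rfl
    have h2 : ∫ s in (0 : ℝ)..1, fderiv ℝ F (y + s • (x - y)) (x - y) = F x - F y := by
      have hd : ∀ s ∈ Set.uIcc (0 : ℝ) 1, HasDerivAt (fun s : ℝ => F (y + s • (x - y)))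
          (fderiv ℝ F (y + s • (x - y)) (x - y)) s := by
        intro s _
        have ha : HasDerivAt (fun s : ℝ => y + s • (x - y)) (x - y) s := by
          simpa using ((hasDerivAt_id s).smul_const (x - y)).const_add y
        exact ((hF.differentiable (by simp)).differentiableAt.hasFDerivAt).comp_hasDerivAt s ha
      rw [intervalIntegral.integral_eq_sub_of_hasDerivAt hd
        ((hcont.clm_apply continuous_const).intervalIntegrable _ _)]
      simp
    change _ = F y + J (D.comp (unitSegment y x)) (x - y)
    rw [h1, ContinuousLinearMap.intervalIntegral_apply (hcont.intervalIntegrable _ _), h2]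
    abel

/-- A function which is smooth in a neighbourhood of `y`. -/
def SmoothNear (F : E → A) (y : E) : Prop := ∀ᶠ x in 𝓝 y, ContDiffAt ℝ ∞ F x

/-- Smooth functions near a point agree there with globally smooth functions. -/
theorem SmoothNear.exists_contDiff [FiniteDimensional ℝ E] {F : E → A} {y : E}
    (hF : SmoothNear F y) : ∃ F' : E → A, ContDiff ℝ ∞ F' ∧ F' =ᶠ[𝓝 y] F := by
  obtain ⟨r, hr, h⟩ := Metric.eventually_nhds_iff_ball.1 hF
  -- The outer radius r / 2 keeps the support of the bump inside the ball where F is smooth.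
  let b : ContDiffBump y := ⟨r / 3, r / 2, by positivity, by linarith⟩
  refine ⟨fun x => b x • F x, contDiff_iff_contDiffAt.2 fun x => ?_, ?_⟩
  · by_cases hx : x ∈ Metric.ball y r
    · exact b.contDiff.contDiffAt.smul (h x hx)
    · have : (fun x => b x • F x) =ᶠ[𝓝 x] fun _ => 0 := by
        have : x ∈ (Metric.closedBall y (r / 2))ᶜ := fun hx' =>
          hx (Metric.closedBall_subset_ball (by linarith) hx')
        filter_upwards [Metric.isClosed_closedBall.isOpen_compl.mem_nhds this] with z hz
        have : b z = 0 := b.zero_of_le_dist (by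
          simp only [Set.mem_compl_iff, Metric.mem_closedBall, not_le] at hz; exact hz.le)
        simp [this]
      exact contDiffAt_const.congr_of_eventuallyEq this
  · filter_upwards [b.eventuallyEq_one] with x hx
    simp [hx]

/-- The coefficient G is smooth on all of E although F is smooth only near y, so the expansion can
be repeated for the components of G. -/
theorem SmoothNear.exists_hadamard [FiniteDimensional ℝ E] [CompleteSpace A] {F : E → A} {y : E}
    (hF : SmoothNear F y) : ∃ G : E → E →L[ℝ] A, ContDiff ℝ ∞ G ∧
      ∀ᶠ x in 𝓝 y, F x = F y + G x (x - y) := by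
  obtain ⟨F', hF', h⟩ := hF.exists_contDiff
  obtain ⟨G, hG, h'⟩ := exists_hadamard_of_contDiff hF' y
  refine ⟨G, hG, ?_⟩
  filter_upwards [h] with x hx
  rw [← hx, h', h.self_of_nhds]

end Hadamard

/-! ### Smooth local flows -/

section Flow

open Filter Topology

/-- The implicit function of a smooth equation is smooth near the base point. -/
theorem eventually_contDiffAt_implicitFunction {E₁ E₂ F : Type*}
    [NormedAddCommGroup E₁] [NormedSpace ℝ E₁] [CompleteSpace E₁]
    [NormedAddCommGroup E₂] [NormedSpace ℝ E₂] [CompleteSpace E₂]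
    [NormedAddCommGroup F] [NormedSpace ℝ F] [CompleteSpace F]
    {f : E₁ × E₂ → F} (hf : ContDiff ℝ ∞ f) {u : E₁ × E₂}
    (hi : (fderiv ℝ f u ∘L .inr ℝ E₁ E₂).IsInvertible) :
    ∀ᶠ x in 𝓝 u.1,
      ContDiffAt ℝ ∞ (hf.contDiffAt.implicitFunction (by simp) hi) x := by
  set φ := hf.contDiffAt.implicitFunction (by simp) hi with hφ
  have hφu : φ u.1 = u.2 := hf.contDiffAt.implicitFunction_apply_self (by simp) hi
  have h0 : ContDiffAt ℝ ∞ φ u.1 := hf.contDiffAt.contDiffAt_implicitFunction (by simp) hi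
  have hcont : ∀ᶠ x in 𝓝 u.1, ContinuousAt φ x :=
    ((h0.of_le (m := 1) (by simp)).eventually (by simp)).mono fun x hx => hx.continuousAt
  have hgraph : Tendsto (fun x => (x, φ x)) (𝓝 u.1) (𝓝 u) := by
    have := (continuousAt_id (x := u.1)).prodMk h0.continuousAt
    rw [ContinuousAt, hφu] at this
    exact this
  have hinv : ∀ᶠ v in 𝓝 u, (fderiv ℝ f v ∘L .inr ℝ E₁ E₂).IsInvertible := by
    have hc : Continuous fun v => fderiv ℝ f v ∘L .inr ℝ E₁ E₂ :=
      (hf.continuous_fderiv (by simp)).clm_comp continuous_const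
    exact hc.continuousAt.eventually (ContinuousLinearEquiv.isOpen.mem_nhds hi)
  have heq : ∀ᶠ x in 𝓝 u.1, f (x, φ x) = f u :=
    hf.contDiffAt.eventually_apply_implicitFunction (by simp) hi
  filter_upwards [hcont, hgraph.eventually hinv, heq.eventually_nhds] with x hx hxi hxe
  -- Smoothness of order ∞ at u.1 alone gives neighbourhoods that may shrink with the order. The
  -- implicit function theorem is therefore applied again at each nearby graph point (x, φ x), and
  -- local uniqueness identifies the function it yields with φ near x.
  have hloc := hf.contDiffAt.eventually_apply_eq_iff_implicitFunction (n := ∞) (by simp) hxi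
  have hg : Tendsto (fun z => (z, φ z)) (𝓝 x) (𝓝 (x, φ x)) :=
    (continuousAt_id (x := x)).prodMk hx
  refine (hf.contDiffAt.contDiffAt_implicitFunction (n := ∞) (by simp) hxi).congr_of_eventuallyEq ?_
  filter_upwards [hg.eventually hloc, hxe] with z hz hze
  exact (hz.1 (hze.trans hxe.self_of_nhds.symm)).symm

/-- Constant curves, as a continuous linear map. -/
def constCurve (E : Type u) [NormedAddCommGroup E] [NormedSpace ℝ E] :
    E →L[ℝ] C(unitInterval, E) :=
  LinearMap.mkContinuous
    { toFun := ContinuousMap.const _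
      map_add' := fun _ _ => rfl
      map_smul' := fun _ _ => rfl } 1 (by
    intro x
    rw [one_mul]
    exact (ContinuousMap.norm_le _ (norm_nonneg _)).2 fun s => le_rfl)

variable {E : Type u} [NormedAddCommGroup E] [NormedSpace ℝ E]

/-- The operator whose zeros are the integral curves of `λ G` on `[0, 1]` starting at `p`. -/
def picardDefect (G : C(E, E)) (q : (ℝ × E) × C(unitInterval, E)) : C(unitInterval, E) :=
  q.2 - constCurve E q.1.2 - q.1.1 • unitPrimitive E (G.comp q.2)

/-- Postcomposition with G is smooth, and all other ingredients are linear or bilinear. -/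
theorem contDiff_picardDefect {G : C(E, E)} (hG : ContDiff ℝ ∞ G) :
    ContDiff ℝ ∞ (picardDefect G) := by
  unfold picardDefect
  have h1 : ContDiff ℝ ∞ fun q : (ℝ × E) × C(unitInterval, E) => G.comp q.2 :=
    (contDiff_postcomp.{u, u} G hG).comp contDiff_snd
  have h2 : ContDiff ℝ ∞ fun q : (ℝ × E) × C(unitInterval, E) => constCurve E q.1.2 :=
    (constCurve E).contDiff.comp (contDiff_snd.comp contDiff_fst)
  exact (contDiff_snd.sub h2).sub
    ((contDiff_fst.comp contDiff_fst).smul ((unitPrimitive E).contDiff.comp h1))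

/-- At λ = 0 the integral term drops out, so in the curve variable the defect is a translation. This
makes the implicit function theorem applicable at constant curves. -/
theorem fderiv_picardDefect_inr {G : C(E, E)} (hG : ContDiff ℝ ∞ G) (p : E)
    (u : C(unitInterval, E)) :
    fderiv ℝ (picardDefect G) ((0, p), u) ∘L .inr ℝ (ℝ × E) C(unitInterval, E) = .id ℝ _ := by
  have h1 := ((contDiff_picardDefect hG).differentiable (by simp)).differentiableAt
    (x := ((0, p), u))
  have h2 := h1.hasFDerivAt.comp u (hasFDerivAt_prodMk_right (𝕜 := ℝ) ((0 : ℝ), p) u)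
  have h3 : HasFDerivAt (picardDefect G ∘ fun w => ((0, p), w))
      (.id ℝ C(unitInterval, E)) u := by
    have : (picardDefect G ∘ fun w => ((0, p), w)) = fun w => w - constCurve E p := by
      funext w; simp [picardDefect]
    rw [this]
    exact (hasFDerivAt_id u).sub_const _
  exact h2.unique h3

/-- Time is traded for the factor λ. If α is the family of Picard–Lindelöf solutions, then s ↦ α(p,
λ s) solves w' = λ G(w) on [0, 1], so it is a zero of `picardDefect`. Near the constant curve p₀
these zeros form the graph of a smooth implicit function φ, and α(p, λ) is the value of φ(λ, p) at
1. -/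
theorem exists_smooth_flow_of_contDiff [CompleteSpace E] {G : E → E} (hG : ContDiff ℝ ∞ G)
    (p₀ : E) :
    ∃ Φ : ℝ × E → E, ∀ᶠ q in 𝓝 ((0 : ℝ), p₀), ContDiffAt ℝ ∞ Φ q ∧
      HasDerivAt (fun t => Φ (t, q.2)) (G (Φ q)) q.1 ∧ Φ (0, q.2) = q.2 := by
  obtain ⟨ε, hε, a, r, L, K, hr, hpl⟩ :=
    IsPicardLindelof.of_contDiffAt_one (hG.contDiffAt.of_le (by simp) : ContDiffAt ℝ 1 G p₀)
  obtain ⟨α, hα, hαc⟩ :=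
    (hpl 0).exists_forall_mem_closedBall_eq_hasDerivWithinAt_continuousOn
  simp only [zero_sub, zero_add] at hα hαc
  let G' : C(E, E) := ⟨G, hG.continuous⟩
  have hG' : ContDiff ℝ ∞ G' := hG
  let u₀ : (ℝ × E) × C(unitInterval, E) := ((0, p₀), constCurve E p₀)
  have hinv : (fderiv ℝ (picardDefect G') u₀ ∘L .inr ℝ _ _).IsInvertible := by
    rw [fderiv_picardDefect_inr hG']
    exact ⟨ContinuousLinearEquiv.refl ℝ _, rfl⟩
  have hsm := contDiff_picardDefect hG'
  set φ := (hsm.contDiffAt (x := u₀)).implicitFunction (by simp) hinv with hφ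
  have hφs := eventually_contDiffAt_implicitFunction hsm hinv
  have hu₀ : picardDefect G' u₀ = 0 := by simp [picardDefect, u₀]
  have hloc := (hsm.contDiffAt (x := u₀)).eventually_apply_eq_iff_implicitFunction
    (n := ∞) (by simp) hinv
  obtain ⟨δ, hδ, hloc⟩ := Metric.eventually_nhds_iff.1 hloc
  have hαc0 : ContinuousAt α (p₀, 0) := by
    refine hαc.continuousAt (prod_mem_nhds (Metric.closedBall_mem_nhds _ (by exact_mod_cast hr)) ?_)
    exact Icc_mem_nhds (by linarith) hε
  have hα0 : α (p₀, 0) = p₀ :=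
    (hα p₀ (Metric.mem_closedBall_self (by exact_mod_cast hr.le))).1
  obtain ⟨η, hη, hclose⟩ := Metric.continuousAt_iff.1 hαc0 (δ / 2) (half_pos hδ)
  have key : ∀ᶠ q in 𝓝 ((0 : ℝ), p₀), α (q.2, q.1) = φ q 1 := by
    -- η keeps the rescaled curve within δ / 2 of p₀, ε keeps its times in the Picard–Lindelöf
    -- interval, r keeps its initial value in the ball, and δ keeps the parameters in the region of
    -- local uniqueness.
    have h1 : ∀ᶠ q in 𝓝 ((0 : ℝ), p₀), dist q (0, p₀) < min (min η ε) (min r δ) := by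
      refine Metric.eventually_nhds_iff.2 ⟨_, ?_, fun q hq => hq⟩
      exact lt_min (lt_min hη hε) (lt_min (by exact_mod_cast hr) hδ)
    filter_upwards [h1] with q hq
    obtain ⟨l, p⟩ := q
    simp only [lt_min_iff] at hq
    obtain ⟨⟨hqη, hqε⟩, hqr, hqδ⟩ := hq
    have hl : ∀ {c : ℝ}, dist (l, p) ((0 : ℝ), p₀) < c → |l| < c := fun h =>
      (le_max_left (dist l 0) (dist p p₀)).trans_lt h |>.trans_eq' (by simp)
    have hp : ∀ {c : ℝ}, dist (l, p) ((0 : ℝ), p₀) < c → dist p p₀ < c := fun h =>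
      (le_max_right (dist l 0) (dist p p₀)).trans_lt h
    have hpr : p ∈ Metric.closedBall p₀ r := (hp hqr).le
    have hls : ∀ s ∈ Set.Icc (0 : ℝ) 1, |l * s| ≤ |l| := fun s hs => by
      rw [abs_mul, abs_of_nonneg hs.1]; exact mul_le_of_le_one_right (abs_nonneg _) hs.2
    have hlsI : ∀ s ∈ Set.Icc (0 : ℝ) 1, l * s ∈ Set.Ioo (-ε) ε := fun s hs =>
      abs_lt.1 ((hls s hs).trans_lt (hl hqε))
    have hd : ∀ s ∈ Set.Icc (0 : ℝ) 1,
        HasDerivAt (fun s => α (p, l * s)) (l • G (α (p, l * s))) s := by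
      intro s hs
      have h2 := ((hα p hpr).2 (l * s) (Set.Ioo_subset_Icc_self (hlsI s hs))).hasDerivAt
        (Icc_mem_nhds (hlsI s hs).1 (hlsI s hs).2)
      have h3 : HasDerivAt (fun s : ℝ => l * s) l s := by
        simpa using (hasDerivAt_id s).const_mul l
      exact h2.scomp s h3
    let w : C(unitInterval, E) := ⟨fun s => α (p, l * s), by
      refine continuous_iff_continuousAt.2 fun s => ?_
      exact (hd s s.2).continuousAt.comp continuous_subtype_val.continuousAt⟩
    have hzero : picardDefect G' ((l, p), w) = 0 := by
      ext s
      have hcont : ContinuousOn (fun s => l • G (α (p, l * s))) (Set.Icc 0 1) := fun s hs =>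
        (continuousAt_const.smul (hG.continuous.continuousAt.comp
          (hd s hs).continuousAt)).continuousWithinAt
      have hsub : Set.uIcc (0 : ℝ) s ⊆ Set.Icc 0 1 := by
        rw [Set.uIcc_of_le s.2.1]; exact Set.Icc_subset_Icc_right s.2.2
      have hint : ∫ r in (0 : ℝ)..s, l • G (α (p, l * r)) = α (p, l * s) - α (p, l * 0) :=
        intervalIntegral.integral_eq_sub_of_hasDerivAt (fun r hr => hd r (hsub hr))
          ((hcont.mono hsub).intervalIntegrable)
      rw [mul_zero, (hα p hpr).1, intervalIntegral.integral_smul] at hint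
      have hint' : unitPrimitive E (G'.comp w) s = ∫ r in (0 : ℝ)..s, G (α (p, l * r)) := by
        rw [unitPrimitive_apply]
        refine intervalIntegral.integral_congr fun r hr => ?_
        simp only [Set.IccExtend_of_mem _ _ (hsub hr)]
        rfl
      change α (p, l * s) - p - l • unitPrimitive E (G'.comp w) s = 0
      rw [hint', hint, sub_self]
    have hdist : dist ((l, p), w) u₀ < δ := by
      refine max_lt hqδ ?_
      refine lt_of_le_of_lt ((ContinuousMap.dist_le (half_pos hδ).le).2 fun s => ?_) (half_lt_self hδ)
      have h4 : dist (p, l * (s : ℝ)) (p₀, 0) < η := by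
        refine max_lt (hp hqη) ?_
        rw [Real.dist_eq, sub_zero]
        exact (hls s s.2).trans_lt (hl hqη)
      have h5 := hclose h4
      rw [hα0] at h5
      exact h5.le
    have h6 := (hloc hdist).1 (hzero.trans hu₀.symm)
    change α (p, l) = φ (l, p) 1
    rw [show φ (l, p) = w from h6]
    change α (p, l) = α (p, l * 1)
    rw [mul_one]
  refine ⟨fun q => α (q.2, q.1), ?_⟩
  have hdom : ∀ᶠ q in 𝓝 ((0 : ℝ), p₀), q.1 ∈ Set.Ioo (-ε) ε ∧ q.2 ∈ Metric.closedBall p₀ r := by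
    exact prod_mem_nhds (Ioo_mem_nhds (neg_lt_zero.2 hε) hε)
      (Metric.closedBall_mem_nhds p₀ (by exact_mod_cast hr))
  filter_upwards [key.eventually_nhds, hφs, hdom] with q hq hqs hqd
  refine ⟨?_, ?_, (hα q.2 hqd.2).1⟩
  · refine ContDiffAt.congr_of_eventuallyEq ?_ hq
    exact (ContinuousMap.evalCLM (M := E) ℝ (1 : unitInterval)).contDiff.contDiffAt.comp q hqs
  · exact ((hα q.2 hqd.2).2 q.1 (Set.Ioo_subset_Icc_self hqd.1)).hasDerivAt
      (Icc_mem_nhds hqd.1.1 hqd.1.2)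

/-- A smooth vector field has a smooth local flow. -/
theorem exists_smooth_flow [FiniteDimensional ℝ E] {G : E → E} {p₀ : E} (hG : SmoothNear G p₀) :
    ∃ Φ : ℝ × E → E, ∀ᶠ q in 𝓝 ((0 : ℝ), p₀), ContDiffAt ℝ ∞ Φ q ∧
      HasDerivAt (fun t => Φ (t, q.2)) (G (Φ q)) q.1 ∧ Φ (0, q.2) = q.2 := by
  have : CompleteSpace E := FiniteDimensional.complete ℝ E
  obtain ⟨G', hG', h⟩ := hG.exists_contDiff
  obtain ⟨Φ, hΦ⟩ := exists_smooth_flow_of_contDiff hG' p₀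
  refine ⟨Φ, ?_⟩
  have h0 := hΦ.self_of_nhds
  -- Φ fixes p₀ at time 0 and is continuous there, so nearby it takes values where G' and G agree.
  have ht : Tendsto Φ (𝓝 (0, p₀)) (𝓝 p₀) := by
    have := h0.1.continuousAt
    rwa [ContinuousAt, h0.2.2] at this
  filter_upwards [hΦ, ht.eventually h] with q hq hq'
  rw [← hq']
  exact hq

end Flow

open Filter Topology

/-! ### Germs of smooth functions with values in an algebra -/

section Germs

theorem SmoothNear.congr {E A : Type*} [NormedAddCommGroup E] [NormedSpace ℝ E]
    [NormedAddCommGroup A] [NormedSpace ℝ A] {F G : E → A} {y : E}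
    (hF : SmoothNear F y) (h : G =ᶠ[𝓝 y] F) : SmoothNear G y := by
  filter_upwards [hF, h.eventually_nhds] with x hx hx'
  exact hx.congr_of_eventuallyEq hx'

theorem SmoothNear.contDiffAt {E A : Type*} [NormedAddCommGroup E] [NormedSpace ℝ E]
    [NormedAddCommGroup A] [NormedSpace ℝ A] {F : E → A} {y : E}
    (hF : SmoothNear F y) : ContDiffAt ℝ ∞ F y := hF.self_of_nhds

theorem SmoothNear.of_contDiff {E A : Type*} [NormedAddCommGroup E] [NormedSpace ℝ E]
    [NormedAddCommGroup A] [NormedSpace ℝ A] {F : E → A} (hF : ContDiff ℝ ∞ F) (y : E) :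
    SmoothNear F y := Eventually.of_forall fun _ => hF.contDiffAt

theorem SmoothNear.add {E A : Type*} [NormedAddCommGroup E] [NormedSpace ℝ E]
    [NormedAddCommGroup A] [NormedSpace ℝ A] {F G : E → A} {y : E} (hF : SmoothNear F y)
    (hG : SmoothNear G y) : SmoothNear (fun x => F x + G x) y := by
  filter_upwards [hF, hG] with x h h' using h.add h'

theorem SmoothNear.sum {E A ι : Type*} [NormedAddCommGroup E] [NormedSpace ℝ E]
    [NormedAddCommGroup A] [NormedSpace ℝ A] {s : Finset ι} {F : ι → E → A} {y : E}
    (hF : ∀ i ∈ s, SmoothNear (F i) y) : SmoothNear (fun x => ∑ i ∈ s, F i x) y := by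
  have : ∀ᶠ x in 𝓝 y, ∀ i ∈ s, ContDiffAt ℝ ∞ (F i) x := (eventually_all_finset s).2 hF
  filter_upwards [this] with x h using ContDiffAt.sum h

theorem SmoothNear.mul {E A : Type*} [NormedAddCommGroup E] [NormedSpace ℝ E]
    [NormedRing A] [NormedAlgebra ℝ A] {F G : E → A} {y : E} (hF : SmoothNear F y)
    (hG : SmoothNear G y) : SmoothNear (fun x => F x * G x) y := by
  filter_upwards [hF, hG] with x h h' using h.mul h'

theorem SmoothNear.smul {E A : Type*} [NormedAddCommGroup E] [NormedSpace ℝ E]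
    [NormedAddCommGroup A] [NormedSpace ℝ A] {c : E → ℝ} {G : E → A} {y : E}
    (hc : SmoothNear c y) (hG : SmoothNear G y) : SmoothNear (fun x => c x • G x) y := by
  filter_upwards [hc, hG] with x h h' using h.smul h'

theorem SmoothNear.const {E A : Type*} [NormedAddCommGroup E] [NormedSpace ℝ E]
    [NormedAddCommGroup A] [NormedSpace ℝ A] (a : A) (y : E) : SmoothNear (fun _ => a) y :=
  .of_contDiff contDiff_const y

theorem SmoothNear.clm_comp {E A B : Type*} [NormedAddCommGroup E] [NormedSpace ℝ E]
    [NormedAddCommGroup A] [NormedSpace ℝ A] [NormedAddCommGroup B] [NormedSpace ℝ B]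
    {F : E → A} {y : E} (hF : SmoothNear F y) (l : A →L[ℝ] B) :
    SmoothNear (fun x => l (F x)) y := by
  filter_upwards [hF] with x h using l.contDiff.contDiffAt.comp x h

theorem SmoothNear.comp {E A B : Type*} [NormedAddCommGroup E] [NormedSpace ℝ E]
    [NormedAddCommGroup A] [NormedSpace ℝ A] [NormedAddCommGroup B] [NormedSpace ℝ B]
    {F : A → B} {g : E → A} {y : E} (hF : SmoothNear F (g y)) (hg : SmoothNear g y) :
    SmoothNear (fun x => F (g x)) y := by
  filter_upwards [hg, hg.contDiffAt.continuousAt.eventually hF] with x h h' using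
    ContDiffAt.comp x h' h

/-- An additive local map on germs of smooth functions which vanishes on constants and which
multiplies by nilpotents upon multiplication by coordinates vanishes. -/
theorem germ_map_eq_zero {E A B ι : Type*} [NormedAddCommGroup E] [NormedSpace ℝ E]
    [FiniteDimensional ℝ E] [NormedAddCommGroup A] [NormedSpace ℝ A] [CompleteSpace A]
    [Ring B] [Algebra ℝ B] [Fintype ι] (l : ι → E →L[ℝ] ℝ) (e : ι → E)
    (hle : ∀ x, ∑ i, l i x • e i = x) (y : E) (d : (E → A) → B)
    (hadd : ∀ F G, SmoothNear F y → SmoothNear G y → d (fun x => F x + G x) = d F + d G)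
    (hloc : ∀ F G, SmoothNear F y → F =ᶠ[𝓝 y] G → d F = d G)
    (hconst : ∀ a, d (fun _ => a) = 0)
    (N : Submodule ℝ B) (c : ℕ) (hN : N ^ c = ⊥) (ν : ι → B) (hν : ∀ i, ν i ∈ N)
    (hmul : ∀ i G, SmoothNear G y → d (fun x => l i (x - y) • G x) = ν i * d G)
    (F : E → A) (hF : SmoothNear F y) : d F = 0 := by
  classical
  have hsum : ∀ (s : Finset ι) (G : ι → E → A), (∀ i, SmoothNear (G i) y) →
      d (fun x => ∑ i ∈ s, G i x) = ∑ i ∈ s, d (G i) := by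
    intro s G hG
    induction s using Finset.induction_on with
    | empty => simpa using hconst 0
    | insert i s hi ih =>
      simp only [Finset.sum_insert hi]
      rw [hadd _ _ (hG i) (.sum fun j _ => hG j), ih]
  -- Hadamard's lemma writes F as a constant plus a sum of terms (xᵢ - yᵢ) Gᵢ, so d F is the sum of
  -- the νᵢ d Gᵢ. Each repetition gains a factor from N, and N ^ c = 0.
  have key : ∀ k : ℕ, ∀ F, SmoothNear F y → d F ∈ N ^ k * (⊤ : Submodule ℝ B) := by
    intro k
    induction k with
    | zero => intro F _; rw [pow_zero, one_mul]; trivial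
    | succ k ih =>
      intro F hF
      obtain ⟨G, hG, h⟩ := hF.exists_hadamard
      have hsm : ∀ i, SmoothNear (fun x => G x (e i)) y := fun i =>
        .of_contDiff (hG.clm_apply contDiff_const) y
      have hsm' : ∀ i, SmoothNear (fun x => l i (x - y) • G x (e i)) y := fun i =>
        (SmoothNear.of_contDiff ((l i).contDiff.comp (contDiff_id.sub contDiff_const)) y).smul
          (hsm i)
      have h1 : F =ᶠ[𝓝 y] fun x => F y + ∑ i, l i (x - y) • G x (e i) := by
        filter_upwards [h] with x hx
        conv_lhs => rw [hx, ← hle (x - y), map_sum]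
        simp only [map_smul]
      rw [hloc _ _ hF h1, hadd _ _ (.const _ y) (.sum fun i _ => hsm' i), hconst, zero_add,
        hsum _ _ hsm']
      refine Submodule.sum_mem _ fun i _ => ?_
      rw [hmul i _ (hsm i), pow_succ', mul_assoc]
      exact Submodule.mul_mem_mul (hν i) (ih _ (hsm i))
  have := key c F hF
  rwa [hN, ← Submodule.zero_eq_bot, zero_mul, Submodule.zero_eq_bot, Submodule.mem_bot] at this

/-- In finite dimensions S is the kernel of a continuous linear projection q, and q ∘ F vanishes
near y. If F is not differentiable at y, `fderiv` is 0 by convention. -/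
theorem fderiv_mem_of_eventually_mem {E A : Type*} [NormedAddCommGroup E] [NormedSpace ℝ E]
    [NormedAddCommGroup A] [NormedSpace ℝ A] [FiniteDimensional ℝ A] (S : Submodule ℝ A)
    {F : E → A} {y : E} (hF : ∀ᶠ x in 𝓝 y, F x ∈ S) (v : E) : fderiv ℝ F y v ∈ S := by
  by_cases hd : DifferentiableAt ℝ F y
  · obtain ⟨S', hS'⟩ := S.exists_isCompl
    let q : A →L[ℝ] A :=
      LinearMap.toContinuousLinearMap (S'.subtype ∘ₗ Submodule.projectionOnto _ _ hS'.symm)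
    have hq : ∀ a, q a = 0 ↔ a ∈ S := by
      intro a
      rw [← Submodule.ker_projectionOnto hS'.symm, LinearMap.mem_ker]
      exact Submodule.coe_eq_zero
    have h1 : fderiv ℝ (fun x => q (F x)) y = 0 := by
      have : (fun x => q (F x)) =ᶠ[𝓝 y] fun _ => 0 := by
        filter_upwards [hF] with x hx using (hq _).2 hx
      rw [this.fderiv_eq]; simp
    have h2 := (q.hasFDerivAt.comp y hd.hasFDerivAt).fderiv
    rw [← hq]
    have h3 := congrArg (fun L => L v) (h2.symm.trans h1)
    simpa using h3
  · rw [fderiv_zero_of_not_differentiableAt hd]; exact S.zero_mem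

end Germs

/-! ### Super Weil algebras -/

/-- The structure of the algebra `P ⊠ Λℝⁿ` used for evaluating smooth functions at points with
nilpotent coordinates. -/
structure SuperWeil (A : Type u) [NormedRing A] [NormedAlgebra ℝ A] (n : ℕ) where
  body : A →ₐ[ℝ] ℝ
  gr : ZMod 2 → Submodule ℝ A
  one_mem : (1 : A) ∈ gr 0
  mul_mem : ∀ (i j : ZMod 2) (x y : A), x ∈ gr i → y ∈ gr j → x * y ∈ gr (i + j)
  isCompl : IsCompl (gr 0) (gr 1)
  central : ∀ x ∈ gr 0, ∀ y, x * y = y * x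
  nil : ∀ x ∈ gr 0, body x = 0 → IsNilpotent x
  body_odd : ∀ x ∈ gr 1, body x = 0
  scal : Subalgebra ℝ A
  ξ : Fin n → gr 1
  adjoin : Algebra.adjoin ℝ ((scal : Set A) ∪ Set.range fun j => (ξ j : A)) = ⊤
  subst : (Fin n → gr 1) → A →ₐ[ℝ] A
  subst_scal : ∀ θ, ∀ a ∈ scal, subst θ a = a
  subst_ξ : ∀ θ j, subst θ (ξ j) = θ j
  subst_mem : ∀ θ i, ∀ a ∈ gr i, subst θ a ∈ gr i

namespace SuperWeil

variable {A : Type u} [NormedRing A] [NormedAlgebra ℝ A] {n : ℕ}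
  (S : SuperWeil A n)

theorem induction {p : A → Prop} (hscal : ∀ a ∈ S.scal, p a) (hξ : ∀ j, p (S.ξ j))
    (hadd : ∀ a b, p a → p b → p (a + b)) (hmul : ∀ a b, p a → p b → p (a * b)) (a : A) : p a := by
  have ha : a ∈ Algebra.adjoin ℝ ((S.scal : Set A) ∪ Set.range fun j => (S.ξ j : A)) := by
    rw [S.adjoin]; trivial
  induction ha using Algebra.adjoin_induction with
  | mem x hx =>
    rcases hx with hx | ⟨j, rfl⟩
    · exact hscal x hx
    · exact hξ j
  | algebraMap r => exact hscal _ (S.scal.algebraMap_mem r)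
  | add a b _ _ ha hb => exact hadd a b ha hb
  | mul a b _ _ ha hb => exact hmul a b ha hb

theorem algHom_ext {B : Type*} [Semiring B] [Algebra ℝ B] {f g : A →ₐ[ℝ] B}
    (hscal : ∀ a ∈ S.scal, f a = g a) (hξ : ∀ j, f (S.ξ j) = g (S.ξ j)) : f = g :=
  AlgHom.ext fun a => S.induction (p := fun a => f a = g a) hscal hξ
    (fun a b ha hb => by rw [map_add, map_add, ha, hb])
    (fun a b ha hb => by rw [map_mul, map_mul, ha, hb]) a

theorem subst_self : S.subst S.ξ = AlgHom.id ℝ A :=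
  S.algHom_ext (fun a ha => S.subst_scal _ a ha) fun j => S.subst_ξ _ j

/-- Odd elements have body 0, so replacing the odd coordinates by other odd elements does not affect
the body. -/
theorem body_subst (θ : Fin n → S.gr 1) (a : A) : S.body (S.subst θ a) = S.body a := by
  have : S.body.comp (S.subst θ) = S.body := S.algHom_ext
    (fun a ha => by rw [AlgHom.comp_apply, S.subst_scal _ a ha])
    fun j => by
      rw [AlgHom.comp_apply, S.subst_ξ, S.body_odd _ (θ j).2, S.body_odd _ (S.ξ j).2]
  exact DFunLike.congr_fun this a

/-- Even elements with vanishing body. -/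
def evenNil : Submodule ℝ A := S.gr 0 ⊓ LinearMap.ker S.body.toLinearMap

theorem mem_evenNil {x : A} : x ∈ S.evenNil ↔ x ∈ S.gr 0 ∧ S.body x = 0 := Iff.rfl

/-- The dependence on θ is polynomial: constant or linear on generators, and sums and products
preserve smoothness. -/
theorem contDiff_subst_apply (a : A) : ContDiff ℝ ∞ fun θ : Fin n → S.gr 1 => S.subst θ a := by
  refine S.induction (p := fun a => ContDiff ℝ ∞ fun θ : Fin n → S.gr 1 => S.subst θ a)
    (fun a ha => ?_) (fun j => ?_) (fun a b ha hb => ?_) (fun a b ha hb => ?_) a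
  · simp_rw [S.subst_scal _ a ha]; exact contDiff_const
  · simp_rw [S.subst_ξ]
    exact (S.gr 1).subtypeL.contDiff.comp (contDiff_apply ℝ _ j)
  · simp_rw [map_add]; exact ha.add hb
  · simp_rw [map_mul]; exact ha.mul hb

variable [FiniteDimensional ℝ A]

/-- The space is a finite sum of lines spanned by commuting nilpotents, hence nilpotent in the
semiring of submodules. Nilpotence of the whole space, rather than of its elements, gives one
truncation order for all Taylor expansions. -/
theorem isNilpotent_evenNil : IsNilpotent S.evenNil := by
  have hfg : S.evenNil.FG := IsNoetherian.noetherian _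
  obtain ⟨s, hs⟩ := hfg
  have hmem : ∀ x ∈ s, x ∈ S.evenNil := fun x hx => hs ▸ Submodule.subset_span hx
  have h1 : S.evenNil = ∑ x ∈ s, Submodule.span ℝ {x} := by
    rw [← hs]
    clear hs hmem
    classical
    induction s using Finset.induction_on with
    | empty => simp
    | insert x s hx ih =>
      rw [Finset.coe_insert, Submodule.span_insert, Finset.sum_insert hx, ih,
        Submodule.add_eq_sup]
  rw [h1]
  refine Commute.isNilpotent_sum (fun x hx => ?_) fun x y hx hy => ?_
  · obtain ⟨k, hk⟩ := S.nil x (hmem x hx).1 (hmem x hx).2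
    exact ⟨k, by rw [Submodule.span_pow, Set.singleton_pow, hk]; simp⟩
  · change Submodule.span ℝ {x} * Submodule.span ℝ {y} = _ * _
    rw [Submodule.span_mul_span, Submodule.span_mul_span, Set.singleton_mul_singleton,
      Set.singleton_mul_singleton, S.central x (hmem x hx).1]

/-- A bound for the length of nonzero products of even nilpotents. -/
def order : ℕ := S.isNilpotent_evenNil.choose

theorem evenNil_pow_order : S.evenNil ^ S.order = ⊥ := S.isNilpotent_evenNil.choose_spec

theorem contDiff_subst : ContDiff ℝ ∞ fun p : (Fin n → S.gr 1) × A => S.subst p.1 p.2 := by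
  let b := Module.finBasis ℝ A
  have : (fun p : (Fin n → S.gr 1) × A => S.subst p.1 p.2) =
      fun p => ∑ i, LinearMap.toContinuousLinearMap (b.coord i) p.2 • S.subst p.1 (b i) := by
    funext p
    conv_lhs => rw [← b.sum_repr p.2]
    rw [map_sum]
    exact Finset.sum_congr rfl fun i _ => map_smul _ _ _
  rw [this]
  refine ContDiff.sum fun i _ => ?_
  exact ((LinearMap.toContinuousLinearMap (b.coord i)).contDiff.comp contDiff_snd).smul
    ((S.contDiff_subst_apply (b i)).comp contDiff_fst)

end SuperWeil

open Filter Topology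

/-! ### Evaluation of smooth functions at nilpotent points -/

/-- The first order operator `∑ νᵢ ∂ᵢ`. -/
def nilDeriv {A : Type u} [NormedRing A] [NormedAlgebra ℝ A] {m : ℕ} (ν : Fin m → A)
    (F : EuclideanSpace ℝ (Fin m) → A) : EuclideanSpace ℝ (Fin m) → A :=
  fun y => ∑ i, ν i * fderiv ℝ F y (EuclideanSpace.single i 1)

/-- The algebra of functions which are smooth on the set `V`. -/
def smoothRing (A : Type u) [NormedRing A] [NormedAlgebra ℝ A] {m : ℕ}
    (V : Set (EuclideanSpace ℝ (Fin m))) : Subalgebra ℝ (EuclideanSpace ℝ (Fin m) → A) where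
  carrier := {F | ContDiffOn ℝ ∞ F V}
  mul_mem' hF hG := ContDiffOn.mul hF hG
  add_mem' hF hG := ContDiffOn.add hF hG
  algebraMap_mem' _ := contDiffOn_const

/-! ### First order operators with nilpotent coefficients and their exponentials. -/

section NilDeriv

variable {A : Type u} [NormedRing A] [NormedAlgebra ℝ A] {m : ℕ}

theorem nilDeriv_congr (ν : Fin m → A) {F G : EuclideanSpace ℝ (Fin m) → A}
    {y : EuclideanSpace ℝ (Fin m)} (h : F =ᶠ[𝓝 y] G) : nilDeriv ν F =ᶠ[𝓝 y] nilDeriv ν G := by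
  filter_upwards [h.eventually_nhds] with x hx
  have : F =ᶠ[𝓝 x] G := hx
  simp only [nilDeriv, this.fderiv_eq]

theorem nilDeriv_iterate_congr (ν : Fin m → A) {F G : EuclideanSpace ℝ (Fin m) → A}
    {y : EuclideanSpace ℝ (Fin m)} (h : F =ᶠ[𝓝 y] G) (k : ℕ) :
    (nilDeriv ν)^[k] F =ᶠ[𝓝 y] (nilDeriv ν)^[k] G := by
  induction k with
  | zero => exact h
  | succ k ih =>
    rw [Function.iterate_succ_apply', Function.iterate_succ_apply']
    exact nilDeriv_congr ν ih

/-- The product rule in a noncommutative algebra; centrality of νᵢ lets it pass F y. -/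
theorem nilDeriv_mul {ν : Fin m → A} (hν : ∀ i a, ν i * a = a * ν i)
    {F G : EuclideanSpace ℝ (Fin m) → A} {y : EuclideanSpace ℝ (Fin m)}
    (hF : DifferentiableAt ℝ F y) (hG : DifferentiableAt ℝ G y) :
    nilDeriv ν (F * G) y = F y * nilDeriv ν G y + nilDeriv ν F y * G y := by
  simp only [nilDeriv, Finset.mul_sum, Finset.sum_mul, ← Finset.sum_add_distrib]
  refine Finset.sum_congr rfl fun i _ => ?_
  have h := (hF.hasFDerivAt.mul' hG.hasFDerivAt).fderiv
  rw [h]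
  simp only [add_apply, smul_apply,
    smul_eq_mul, MulOpposite.smul_eq_mul_unop,
    MulOpposite.unop_op, mul_add]
  rw [← mul_assoc, ← mul_assoc, ← mul_assoc, hν i (F y), mul_assoc]

/-- Coefficients and function may both depend on a parameter, because the point at which a function
is evaluated will itself vary. -/
theorem nilDeriv_smoothNear {Q : Type*} [NormedAddCommGroup Q] [NormedSpace ℝ Q]
    {q₀ : Q} {y₀ : EuclideanSpace ℝ (Fin m)} {ν : Q → Fin m → A} (hν : SmoothNear ν q₀)
    {F : Q × EuclideanSpace ℝ (Fin m) → A} (hF : SmoothNear F (q₀, y₀)) :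
    SmoothNear (fun p => nilDeriv (ν p.1) (fun y => F (p.1, y)) p.2) (q₀, y₀) := by
  have hν' : ∀ᶠ p in 𝓝 (q₀, y₀), ContDiffAt ℝ ∞ ν p.1 :=
    continuous_fst.continuousAt.eventually hν
  filter_upwards [hF, hν'] with p hp hp'
  refine ContDiffAt.sum fun i _ => ContDiffAt.mul ?_ ?_
  · have := hp'.comp p contDiffAt_fst
    exact (contDiffAt_pi.1 this) i
  · have h1 : ContDiffAt ℝ ∞ (Function.uncurry fun (p : Q × EuclideanSpace ℝ (Fin m))
        (y : EuclideanSpace ℝ (Fin m)) => F (p.1, y)) (p, p.2) := by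
      have hg : ContDiffAt ℝ ∞ (fun r : (Q × EuclideanSpace ℝ (Fin m)) ×
        EuclideanSpace ℝ (Fin m) => (r.1.1, r.2)) (p, p.2) := by fun_prop
      exact ContDiffAt.comp (p, p.2) (g := F) hp hg
    exact (ContDiffAt.fderiv (m := ∞) h1 contDiffAt_snd le_rfl).clm_apply contDiffAt_const

theorem nilDeriv_iterate_smoothNear {Q : Type*} [NormedAddCommGroup Q] [NormedSpace ℝ Q]
    {q₀ : Q} {y₀ : EuclideanSpace ℝ (Fin m)} {ν : Q → Fin m → A} (hν : SmoothNear ν q₀) (k : ℕ) :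
    ∀ {F : Q × EuclideanSpace ℝ (Fin m) → A}, SmoothNear F (q₀, y₀) →
    SmoothNear (fun p => (nilDeriv (ν p.1))^[k] (fun y => F (p.1, y)) p.2) (q₀, y₀) := by
  induction k with
  | zero => exact fun hF => hF
  | succ k ih => exact fun hF => ih (nilDeriv_smoothNear hν hF)

open Classical in
/-- `∑ νᵢ ∂ᵢ` as an endomorphism of the algebra of functions which are smooth on an open set. -/
def nilDerivEnd (V : Set (EuclideanSpace ℝ (Fin m))) (hV : IsOpen V) (ν : Fin m → A) :
    Module.End ℝ (smoothRing A V) where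
  -- Elements of `smoothRing A V` are arbitrary outside V, where differentiation need not be
  -- additive. Extension by zero makes the operator linear on all of them.
  toFun F := ⟨V.indicator (nilDeriv ν F), by
    have h1 : ContDiffOn ℝ ∞ (nilDeriv ν F) V := by
      refine ContDiffOn.sum fun i _ => contDiffOn_const.mul ?_
      exact (F.2.fderiv_of_isOpen hV (m := ∞) le_rfl).clm_apply contDiffOn_const
    exact h1.congr fun x hx => Set.indicator_of_mem hx _⟩
  map_add' F G := by
    refine Subtype.ext (funext fun y => ?_)
    by_cases hy : y ∈ V
    · have hF : DifferentiableAt ℝ F.1 y :=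
        (F.2.contDiffAt (hV.mem_nhds hy)).differentiableAt (by simp)
      have hG : DifferentiableAt ℝ G.1 y :=
        (G.2.contDiffAt (hV.mem_nhds hy)).differentiableAt (by simp)
      change V.indicator (nilDeriv ν (F.1 + G.1)) y =
        V.indicator (nilDeriv ν F.1) y + V.indicator (nilDeriv ν G.1) y
      simp only [Set.indicator_of_mem hy, nilDeriv, fderiv_add hF hG,
        add_apply, mul_add, Finset.sum_add_distrib]
    · change V.indicator (nilDeriv ν (F.1 + G.1)) y =
        V.indicator (nilDeriv ν F.1) y + V.indicator (nilDeriv ν G.1) y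
      simp only [Set.indicator_of_notMem hy, add_zero]
  map_smul' c F := by
    refine Subtype.ext (funext fun y => ?_)
    by_cases hy : y ∈ V
    · have hF : DifferentiableAt ℝ F.1 y :=
        (F.2.contDiffAt (hV.mem_nhds hy)).differentiableAt (by simp)
      change V.indicator (nilDeriv ν (c • F.1)) y = c • V.indicator (nilDeriv ν F.1) y
      simp only [Set.indicator_of_mem hy, nilDeriv, fderiv_const_smul hF c,
        smul_apply, mul_smul_comm, Finset.smul_sum]
    · change V.indicator (nilDeriv ν (c • F.1)) y = c • V.indicator (nilDeriv ν F.1) y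
      simp only [Set.indicator_of_notMem hy, smul_zero]

theorem nilDerivEnd_apply {V : Set (EuclideanSpace ℝ (Fin m))} (hV : IsOpen V) (ν : Fin m → A)
    (F : smoothRing A V) {y : EuclideanSpace ℝ (Fin m)} (hy : y ∈ V) :
    (nilDerivEnd V hV ν F).1 y = nilDeriv ν F.1 y := Set.indicator_of_mem hy _

theorem nilDerivEnd_apply_of_notMem {V : Set (EuclideanSpace ℝ (Fin m))} (hV : IsOpen V)
    (ν : Fin m → A) (F : smoothRing A V) {y : EuclideanSpace ℝ (Fin m)} (hy : y ∉ V) :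
    (nilDerivEnd V hV ν F).1 y = 0 := Set.indicator_of_notMem hy _

theorem nilDerivEnd_pow_apply {V : Set (EuclideanSpace ℝ (Fin m))} (hV : IsOpen V) (ν : Fin m → A)
    (F : smoothRing A V) (k : ℕ) {y : EuclideanSpace ℝ (Fin m)} (hy : y ∈ V) :
    ((nilDerivEnd V hV ν ^ k) F).1 y = (nilDeriv ν)^[k] F.1 y := by
  induction k generalizing y with
  | zero => rfl
  | succ k ih =>
    rw [pow_succ', Module.End.mul_apply, nilDerivEnd_apply hV ν _ hy, Function.iterate_succ_apply']
    refine (nilDeriv_congr ν ?_).self_of_nhds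
    filter_upwards [hV.mem_nhds hy] with x hx using ih hx

variable [FiniteDimensional ℝ A]

/-- Differentiation stays in the subspace T, and each νᵢ contributes a factor from N. Iteration
produces the powers of N that make the Taylor series stop. -/
theorem nilDeriv_mem {ν : Fin m → A} {N T : Submodule ℝ A} (hν : ∀ i, ν i ∈ N)
    {F : EuclideanSpace ℝ (Fin m) → A} {y : EuclideanSpace ℝ (Fin m)}
    (hF : ∀ᶠ x in 𝓝 y, F x ∈ T) : nilDeriv ν F y ∈ N * T :=
  Submodule.sum_mem _ fun i _ => Submodule.mul_mem_mul (hν i) (fderiv_mem_of_eventually_mem T hF _)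

theorem nilDeriv_iterate_mem {ν : Fin m → A} {N : Submodule ℝ A} (hν : ∀ i, ν i ∈ N)
    (F : EuclideanSpace ℝ (Fin m) → A) (k : ℕ) (y : EuclideanSpace ℝ (Fin m)) :
    (nilDeriv ν)^[k] F y ∈ N ^ k * (⊤ : Submodule ℝ A) := by
  induction k generalizing y with
  | zero => rw [pow_zero, one_mul]; trivial
  | succ k ih =>
    rw [Function.iterate_succ_apply', pow_succ', mul_assoc]
    exact nilDeriv_mem hν (Eventually.of_forall ih)

/-- On V the values already vanish because of N ^ k = 0. The extra factor in the exponent serves the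
points off V, where every positive power is zero by construction. -/
theorem nilDerivEnd_pow_eq_zero {V : Set (EuclideanSpace ℝ (Fin m))} (hV : IsOpen V)
    {ν : Fin m → A} {N : Submodule ℝ A} (hν : ∀ i, ν i ∈ N) {k : ℕ} (hN : N ^ k = ⊥) :
    nilDerivEnd V hV ν ^ (k + 1) = 0 := by
  refine LinearMap.ext fun F => Subtype.ext (funext fun y => ?_)
  by_cases hy : y ∈ V
  · rw [nilDerivEnd_pow_apply hV ν F _ hy]
    have := nilDeriv_iterate_mem hν F.1 (k + 1) y
    rwa [pow_succ', hN, ← Submodule.zero_eq_bot, mul_zero, zero_mul, Submodule.zero_eq_bot,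
      Submodule.mem_bot] at this
  · rw [pow_succ', Module.End.mul_apply, nilDerivEnd_apply_of_notMem hV ν _ hy]; rfl

/-- The truncated exponential of `∑ νᵢ ∂ᵢ` is multiplicative. -/
theorem sum_nilDeriv_mul {ν : Fin m → A} (hc : ∀ i a, ν i * a = a * ν i) {N : Submodule ℝ A}
    (hν : ∀ i, ν i ∈ N) {c : ℕ} (hN : N ^ c = ⊥) {F G : EuclideanSpace ℝ (Fin m) → A}
    {y : EuclideanSpace ℝ (Fin m)} (hF : SmoothNear F y) (hG : SmoothNear G y) :
    ∑ k ∈ Finset.range (c + 1), (k.factorial : ℝ)⁻¹ • (nilDeriv ν)^[k] (F * G) y =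
      (∑ k ∈ Finset.range (c + 1), (k.factorial : ℝ)⁻¹ • (nilDeriv ν)^[k] F y) *
      ∑ k ∈ Finset.range (c + 1), (k.factorial : ℝ)⁻¹ • (nilDeriv ν)^[k] G y := by
  obtain ⟨V, hVs, hV, hy⟩ := eventually_nhds_iff.1 (hF.and hG)
  let F' : smoothRing A V := ⟨F, fun x hx => (hVs x hx).1.contDiffWithinAt⟩
  let G' : smoothRing A V := ⟨G, fun x hx => (hVs x hx).2.contDiffWithinAt⟩
  -- `IsNilpotent.exp` has rational coefficients; restricting scalars from ℝ makes them agree with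
  -- the real inverse factorials.
  let : Module ℚ (smoothRing A V) := Module.compHom _ (algebraMap ℚ ℝ)
  have hz := nilDerivEnd_pow_eq_zero hV hν hN
  have hexp : ∀ H : smoothRing A V, (IsNilpotent.exp (nilDerivEnd V hV ν) H).1 y =
      ∑ k ∈ Finset.range (c + 1), (k.factorial : ℝ)⁻¹ • (nilDeriv ν)^[k] H.1 y := by
    intro H
    rw [IsNilpotent.exp_eq_sum hz, LinearMap.sum_apply, AddSubmonoidClass.coe_finsetSum,
      Finset.sum_apply]
    refine Finset.sum_congr rfl fun k _ => ?_
    rw [← nilDerivEnd_pow_apply hV ν H k hy, LinearMap.smul_apply]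
    have : ∀ (r : ℚ) (H : smoothRing A V), (r • H).1 y = (r : ℝ) • H.1 y := fun r H => rfl
    rw [this]
    push_cast
    rfl
  -- The exponential of a nilpotent derivation is multiplicative.
  have := Module.End.exp_mul_of_derivation ℝ (smoothRing A V) (nilDerivEnd V hV ν) ?_
    ⟨_, hz⟩ F' G'
  · have h2 := congrFun (congrArg Subtype.val this) y
    change _ = (IsNilpotent.exp (nilDerivEnd V hV ν) F').1 y *
      (IsNilpotent.exp (nilDerivEnd V hV ν) G').1 y at h2
    rw [hexp, hexp, hexp] at h2
    exact h2
  · intro H H'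
    refine Subtype.ext (funext fun x => ?_)
    change _ = H.1 x * (nilDerivEnd V hV ν H').1 x + (nilDerivEnd V hV ν H).1 x * H'.1 x
    by_cases hx : x ∈ V
    · rw [nilDerivEnd_apply hV ν _ hx, nilDerivEnd_apply hV ν _ hx, nilDerivEnd_apply hV ν _ hx]
      exact nilDeriv_mul hc ((H.2.contDiffAt (hV.mem_nhds hx)).differentiableAt (by simp))
        ((H'.2.contDiffAt (hV.mem_nhds hx)).differentiableAt (by simp))
    · rw [nilDerivEnd_apply_of_notMem hV ν _ hx, nilDerivEnd_apply_of_notMem hV ν _ hx,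
        nilDerivEnd_apply_of_notMem hV ν _ hx, mul_zero, zero_mul, add_zero]

end NilDeriv

open Filter Topology

namespace SuperWeil

variable {A : Type u} [NormedRing A] [NormedAlgebra ℝ A] {n : ℕ}
  (S : SuperWeil A n) (m : ℕ)

/-- Points of `ℝ^{m|n}` with values in `A`: `m` even and `n` odd coordinates. -/
def Pt : Type u := (Fin m → S.gr 0) × (Fin n → S.gr 1)

instance : NormedAddCommGroup (S.Pt m) :=
  inferInstanceAs (NormedAddCommGroup ((Fin m → S.gr 0) × (Fin n → S.gr 1)))

instance : NormedSpace ℝ (S.Pt m) :=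
  inferInstanceAs (NormedSpace ℝ ((Fin m → S.gr 0) × (Fin n → S.gr 1)))

instance [FiniteDimensional ℝ A] : FiniteDimensional ℝ (S.Pt m) :=
  inferInstanceAs (FiniteDimensional ℝ ((Fin m → S.gr 0) × (Fin n → S.gr 1)))

variable {S m}

/-- The body of an `A`-valued point. -/
def Pt.base (p : S.Pt m) : EuclideanSpace ℝ (Fin m) :=
  WithLp.toLp 2 fun i => S.body (p.1 i)

/-- The nilpotent parts of the even coordinates. -/
def Pt.nilp (p : S.Pt m) (i : Fin m) : A := (p.1 i : A) - algebraMap ℝ A (S.body (p.1 i))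

theorem Pt.base_apply (p : S.Pt m) (i : Fin m) : p.base i = S.body (p.1 i) := rfl

theorem algebraMap_mem (S : SuperWeil A n) (r : ℝ) : algebraMap ℝ A r ∈ S.gr 0 := by
  rw [Algebra.algebraMap_eq_smul_one]; exact Submodule.smul_mem _ _ S.one_mem

theorem Pt.nilp_mem (p : S.Pt m) (i : Fin m) : p.nilp i ∈ S.evenNil :=
  ⟨Submodule.sub_mem _ (p.1 i).2 (S.algebraMap_mem _), by simp [Pt.nilp]⟩

theorem Pt.nilp_comm (p : S.Pt m) (i : Fin m) (a : A) : p.nilp i * a = a * p.nilp i :=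
  S.central _ (p.nilp_mem i).1 a

/-- The point with real even coordinates `y` and odd coordinates `ξ`. -/
def realPt (S : SuperWeil A n) (y : EuclideanSpace ℝ (Fin m)) : S.Pt m :=
  (fun i => ⟨algebraMap ℝ A (y i), S.algebraMap_mem _⟩, S.ξ)

theorem base_realPt (S : SuperWeil A n) (y : EuclideanSpace ℝ (Fin m)) : (S.realPt y).base = y := by
  ext i; simp [Pt.base, realPt]

theorem nilp_realPt (S : SuperWeil A n) (y : EuclideanSpace ℝ (Fin m)) (i : Fin m) :
    (S.realPt y).nilp i = 0 := by
  simp [Pt.nilp, realPt]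

theorem nilDeriv_zero {m : ℕ} (F : EuclideanSpace ℝ (Fin m) → A) :
    nilDeriv (fun _ => (0 : A)) F = 0 := by
  funext y; simp [nilDeriv]

variable [FiniteDimensional ℝ A]

/-- Evaluation of a smooth function at an `A`-valued point, by its Taylor expansion. -/
def nilEval (p : S.Pt m) (F : EuclideanSpace ℝ (Fin m) → A) : A :=
  ∑ k ∈ Finset.range (S.order + 1),
    (k.factorial : ℝ)⁻¹ • (nilDeriv p.nilp)^[k] (fun y => S.subst p.2 (F y)) p.base

theorem contDiff_base : ContDiff ℝ ∞ (Pt.base : S.Pt m → EuclideanSpace ℝ (Fin m)) := by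
  refine contDiff_euclidean.2 fun i => ?_
  exact ((LinearMap.toContinuousLinearMap S.body.toLinearMap).contDiff.comp
    ((S.gr 0).subtypeL.contDiff)).comp ((contDiff_apply ℝ _ i).comp contDiff_fst)

omit [FiniteDimensional ℝ A] in
theorem contDiff_realPt : ContDiff ℝ ∞ (S.realPt : EuclideanSpace ℝ (Fin m) → S.Pt m) := by
  refine ContDiff.prodMk (contDiff_pi.2 fun i => ?_) contDiff_const
  have : (fun y : EuclideanSpace ℝ (Fin m) => (S.realPt y).1 i) =
      fun y => (y i) • (⟨1, S.one_mem⟩ : S.gr 0) := by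
    funext y; exact Subtype.ext (Algebra.algebraMap_eq_smul_one _)
  change ContDiff ℝ ∞ (fun y : EuclideanSpace ℝ (Fin m) => (S.realPt y).1 i)
  rw [this]
  exact (EuclideanSpace.proj i : EuclideanSpace ℝ (Fin m) →L[ℝ] ℝ).contDiff.smul contDiff_const

theorem contDiff_nilp : ContDiff ℝ ∞ (Pt.nilp : S.Pt m → Fin m → A) := by
  refine contDiff_pi.2 fun i => ?_
  have h1 : ContDiff ℝ ∞ fun p : S.Pt m => (p.1 i : A) :=
    (S.gr 0).subtypeL.contDiff.comp ((contDiff_apply ℝ _ i).comp contDiff_fst)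
  have h2 : ContDiff ℝ ∞ fun a : A => algebraMap ℝ A (S.body a) :=
    ((Algebra.linearMap ℝ A ∘ₗ S.body.toLinearMap).toContinuousLinearMap).contDiff
  exact h1.sub (h2.comp h1)

theorem smoothNear_subst {E : Type*} [NormedAddCommGroup E] [NormedSpace ℝ E]
    (θ : Fin n → S.gr 1) {F : E → A} {y : E} (hF : SmoothNear F y) :
    SmoothNear (fun x => S.subst θ (F x)) y :=
  hF.clm_comp (S.subst θ).toLinearMap.toContinuousLinearMap

theorem nilEval_congr (p : S.Pt m) {F G : EuclideanSpace ℝ (Fin m) → A} (h : F =ᶠ[𝓝 p.base] G) :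
    nilEval p F = nilEval p G := by
  refine Finset.sum_congr rfl fun k _ => ?_
  have : (fun y => S.subst p.2 (F y)) =ᶠ[𝓝 p.base] fun y => S.subst p.2 (G y) :=
    h.mono fun y hy => by simp only [hy]
  rw [(nilDeriv_iterate_congr p.nilp this k).self_of_nhds]

theorem nilEval_mul (p : S.Pt m) {F G : EuclideanSpace ℝ (Fin m) → A} (hF : SmoothNear F p.base)
    (hG : SmoothNear G p.base) :
    nilEval p (fun y => F y * G y) = nilEval p F * nilEval p G := by
  have := sum_nilDeriv_mul (y := p.base) p.nilp_comm p.nilp_mem S.evenNil_pow_order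
    (smoothNear_subst p.2 hF) (smoothNear_subst p.2 hG)
  rw [nilEval, nilEval, nilEval, ← this]
  simp only [map_mul]
  rfl

theorem nilEval_add (p : S.Pt m) {F G : EuclideanSpace ℝ (Fin m) → A} (hF : SmoothNear F p.base)
    (hG : SmoothNear G p.base) :
    nilEval p (fun y => F y + G y) = nilEval p F + nilEval p G := by
  obtain ⟨V, hVs, hV, hy⟩ := eventually_nhds_iff.1
    ((smoothNear_subst p.2 hF).and (smoothNear_subst p.2 hG))
  let F' : smoothRing A V := ⟨_, fun x hx => (hVs x hx).1.contDiffWithinAt⟩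
  let G' : smoothRing A V := ⟨_, fun x hx => (hVs x hx).2.contDiffWithinAt⟩
  rw [nilEval, nilEval, nilEval, ← Finset.sum_add_distrib]
  refine Finset.sum_congr rfl fun k _ => ?_
  rw [← smul_add]
  congr 1
  have h := nilDerivEnd_pow_apply hV p.nilp (F' + G') k hy
  rw [map_add] at h
  change ((nilDerivEnd V hV p.nilp ^ k) F').1 p.base + ((nilDerivEnd V hV p.nilp ^ k) G').1 p.base
    = _ at h
  rw [nilDerivEnd_pow_apply hV _ _ _ hy, nilDerivEnd_pow_apply hV _ _ _ hy] at h
  rw [h]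
  simp only [map_add]
  rfl

theorem nilEval_of_nilDeriv_eq_zero (p : S.Pt m) {F : EuclideanSpace ℝ (Fin m) → A}
    (h : ∀ k, (nilDeriv p.nilp)^[k + 1] (fun y => S.subst p.2 (F y)) p.base = 0) :
    nilEval p F = S.subst p.2 (F p.base) := by
  rw [nilEval, Finset.sum_range_succ', Finset.sum_eq_zero fun k _ => by rw [h k, smul_zero]]
  simp

omit [FiniteDimensional ℝ A] in
theorem nilDeriv_iterate_zero (ν : Fin m → A) (k : ℕ) :
    (nilDeriv ν)^[k] (0 : EuclideanSpace ℝ (Fin m) → A) = 0 := by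
  have h0 : nilDeriv ν (0 : EuclideanSpace ℝ (Fin m) → A) = 0 := by
    funext y; simp [nilDeriv]
  induction k with
  | zero => rfl
  | succ k ih => rw [Function.iterate_succ_apply, h0, ih]

theorem nilEval_const (p : S.Pt m) (a : A) : nilEval p (fun _ => a) = S.subst p.2 a := by
  refine nilEval_of_nilDeriv_eq_zero p fun k => ?_
  have : nilDeriv p.nilp (fun _ => S.subst p.2 a) = 0 := by
    funext y; simp [nilDeriv]
  rw [Function.iterate_succ_apply, this, nilDeriv_iterate_zero]; rfl

/-- Without nilpotent parts all Taylor corrections vanish, and with odd coordinates ξ the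
substitution is the identity. Real points thus represent the identity map, the initial value of the
flow. -/
theorem nilEval_realPt (y : EuclideanSpace ℝ (Fin m)) (F : EuclideanSpace ℝ (Fin m) → A) :
    nilEval (S.realPt y) F = F y := by
  have h0 : (S.realPt y).nilp = fun _ => 0 := funext fun i => S.nilp_realPt y i
  rw [nilEval_of_nilDeriv_eq_zero, base_realPt]
  · exact DFunLike.congr_fun S.subst_self (F y)
  · intro k
    rw [Function.iterate_succ_apply, h0, nilDeriv_zero, nilDeriv_iterate_zero]; rfl

/-- Order 0 would mean 1 = 0 in A, while the body of 1 is 1. Positivity keeps the linear term in the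
truncated Taylor sum. -/
theorem order_pos (S : SuperWeil A n) : 0 < S.order := by
  rcases Nat.eq_zero_or_pos S.order with h | h
  · have h1 := S.evenNil_pow_order
    rw [h, pow_zero] at h1
    have h2 : (1 : A) ∈ (1 : Submodule ℝ A) := Submodule.one_le.1 le_rfl
    rw [h1, Submodule.mem_bot] at h2
    have h3 := map_one S.body
    rw [h2, map_zero] at h3
    exact absurd h3 zero_ne_one
  · exact h

/-- The `i`-th coordinate as an `A`-valued function. -/
def coordFun (A : Type u) [NormedRing A] [NormedAlgebra ℝ A] {m : ℕ} (i : Fin m) :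
    EuclideanSpace ℝ (Fin m) → A := fun y => algebraMap ℝ A (y i)

omit [FiniteDimensional ℝ A] in
theorem contDiff_coordFun (i : Fin m) : ContDiff ℝ ∞ (coordFun A i) := by
  have : coordFun A i = fun y => (y i) • (1 : A) := funext fun y => Algebra.algebraMap_eq_smul_one _
  rw [this]
  exact (EuclideanSpace.proj i : EuclideanSpace ℝ (Fin m) →L[ℝ] ℝ).contDiff.smul contDiff_const

/-- The Taylor series of a linear function stops after the first order, and base plus nilpotent part
is the coordinate. -/
theorem nilEval_coordFun (p : S.Pt m) (i : Fin m) : nilEval p (coordFun A i) = p.1 i := by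
  have h1 : (fun y => S.subst p.2 (coordFun A i y)) = coordFun A i := by
    funext y; exact AlgHom.commutes _ _
  have h2 : nilDeriv p.nilp (coordFun A i) = fun _ => p.nilp i := by
    funext y
    have hd : ∀ j, fderiv ℝ (coordFun A i) y (EuclideanSpace.single j 1) =
        if i = j then 1 else 0 := by
      intro j
      let L : EuclideanSpace ℝ (Fin m) →L[ℝ] A :=
        (Algebra.linearMap ℝ A).toContinuousLinearMap ∘L EuclideanSpace.proj i
      have : coordFun A i = L := rfl
      rw [this, L.fderiv]
      change algebraMap ℝ A (EuclideanSpace.single j (1 : ℝ) i) = _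
      rw [PiLp.single_apply]
      split_ifs <;> simp
    simp [nilDeriv, hd]
  have h3 : nilDeriv p.nilp (fun _ => p.nilp i) = 0 := by
    funext y; simp [nilDeriv]
  rw [nilEval, h1, Finset.sum_range_succ', Finset.sum_eq_single 0]
  · rw [Function.iterate_succ_apply, h2]
    simp [Pt.nilp, coordFun, Pt.base_apply]
  · intro k _ hk
    obtain ⟨k, rfl⟩ := Nat.exists_eq_succ_of_ne_zero hk
    rw [Function.iterate_succ_apply, h2, Function.iterate_succ_apply, h3, nilDeriv_iterate_zero]
    simp
  · intro h
    exact absurd (Finset.mem_range.2 S.order_pos) h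

/-- Substitution preserves parity, derivatives stay in the parity subspace, and the coefficients νᵢ
are even. -/
theorem nilEval_mem (p : S.Pt m) (i : ZMod 2) {F : EuclideanSpace ℝ (Fin m) → A}
    (hF : ∀ᶠ y in 𝓝 p.base, F y ∈ S.gr i) : nilEval p F ∈ S.gr i := by
  have h0 : S.evenNil * S.gr i ≤ S.gr i := Submodule.mul_le.2 fun x hx y hy => by
    have := S.mul_mem 0 i x y hx.1 hy
    rwa [zero_add] at this
  have key : ∀ k, ∀ᶠ y in 𝓝 p.base,
      (nilDeriv p.nilp)^[k] (fun y => S.subst p.2 (F y)) y ∈ S.gr i := by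
    intro k
    induction k with
    | zero => exact hF.mono fun y hy => S.subst_mem _ _ _ hy
    | succ k ih =>
      filter_upwards [ih.eventually_nhds] with y hy
      rw [Function.iterate_succ_apply']
      exact h0 (nilDeriv_mem p.nilp_mem hy)
  exact Submodule.sum_mem _ fun k _ => Submodule.smul_mem _ _ (key k).self_of_nhds

/-- Every term of positive order carries a factor νᵢ of body 0. -/
theorem body_nilEval (p : S.Pt m) (F : EuclideanSpace ℝ (Fin m) → A) :
    S.body (nilEval p F) = S.body (F p.base) := by
  rw [nilEval, map_sum, Finset.sum_range_succ']
  have : ∀ k, S.body ((nilDeriv p.nilp)^[k + 1] (fun y => S.subst p.2 (F y)) p.base) = 0 := by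
    intro k
    rw [Function.iterate_succ_apply', nilDeriv, map_sum]
    refine Finset.sum_eq_zero fun i _ => ?_
    rw [map_mul, (S.mem_evenNil.1 (p.nilp_mem i)).2, zero_mul]
  rw [Finset.sum_eq_zero fun k _ => by rw [map_smul, this, smul_zero]]
  simp [body_subst]

/-- Function and point vary together: each Taylor term is smooth in (parameter, point, y) and is
then restricted to y = base of the point. This joint smoothness is used when flows are composed. -/
theorem nilEval_smoothNear {Q : Type*} [NormedAddCommGroup Q] [NormedSpace ℝ Q]
    {q₀ : Q} {p₀ : S.Pt m} {F : Q × EuclideanSpace ℝ (Fin m) → A}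
    (hF : SmoothNear F (q₀, p₀.base)) :
    SmoothNear (fun r : Q × S.Pt m => nilEval r.2 fun y => F (r.1, y)) (q₀, p₀) := by
  refine .sum fun k _ => ?_
  have hν : SmoothNear (fun r : Q × S.Pt m => r.2.nilp) (q₀, p₀) :=
    .of_contDiff (contDiff_nilp.comp contDiff_snd) _
  have hg : ContDiff ℝ ∞ fun r : (Q × S.Pt m) × EuclideanSpace ℝ (Fin m) => (r.1.1, r.2) := by
    fun_prop
  have hF' : SmoothNear (fun r : (Q × S.Pt m) × EuclideanSpace ℝ (Fin m) =>
      S.subst r.1.2.2 (F (r.1.1, r.2))) ((q₀, p₀), p₀.base) := by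
    have h1 : SmoothNear (fun r : (Q × S.Pt m) × EuclideanSpace ℝ (Fin m) => F (r.1.1, r.2))
        ((q₀, p₀), p₀.base) := SmoothNear.comp
        (g := fun r : (Q × S.Pt m) × EuclideanSpace ℝ (Fin m) => (r.1.1, r.2)) hF (.of_contDiff hg _)
    filter_upwards [h1] with r hr
    exact S.contDiff_subst.contDiffAt.comp r
      (((contDiff_snd.comp contDiff_snd).comp contDiff_fst).contDiffAt.prodMk hr)
  have h2 := nilDeriv_iterate_smoothNear hν k hF'
  have h3 : ContDiff ℝ ∞ fun r : Q × S.Pt m => (r, r.2.base) :=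
    contDiff_id.prodMk (contDiff_base.comp contDiff_snd)
  have h4 := SmoothNear.comp (g := fun r : Q × S.Pt m => (r, r.2.base)) h2 (.of_contDiff h3 _)
  exact (SmoothNear.const _ _).smul h4

/-! ### Uniqueness of homomorphisms and derivations on germs -/

theorem euclidean_sum_single (x : EuclideanSpace ℝ (Fin m)) :
    ∑ i, (EuclideanSpace.proj i : EuclideanSpace ℝ (Fin m) →L[ℝ] ℝ) x •
      EuclideanSpace.single i (1 : ℝ) = x := by
  ext j
  simp [Finset.sum_apply, Pi.single_apply]

/-- A local `P`-linear parity preserving homomorphism on germs of smooth functions at `y`. -/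
structure IsGermHom (S : SuperWeil A n) (y : EuclideanSpace ℝ (Fin m))
    (K : (EuclideanSpace ℝ (Fin m) → A) → A) : Prop where
  add : ∀ F G, SmoothNear F y → SmoothNear G y → K (fun x => F x + G x) = K F + K G
  mul : ∀ F G, SmoothNear F y → SmoothNear G y → K (fun x => F x * G x) = K F * K G
  congr : ∀ F G, SmoothNear F y → F =ᶠ[𝓝 y] G → K F = K G
  scal : ∀ a ∈ S.scal, K (fun _ => a) = a
  mem : ∀ i F, SmoothNear F y → (∀ᶠ x in 𝓝 y, F x ∈ S.gr i) → K F ∈ S.gr i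
  body_coord : ∀ i, S.body (K (coordFun A i)) = y i

theorem isGermHom_nilEval (p : S.Pt m) : S.IsGermHom p.base (nilEval p) where
  add _ _ := nilEval_add p
  mul _ _ := nilEval_mul p
  congr _ _ _ h := nilEval_congr p h
  scal a ha := by rw [nilEval_const, S.subst_scal _ a ha]
  mem i _ _ h := nilEval_mem p i h
  body_coord i := by rw [nilEval_coordFun]; rfl

omit [FiniteDimensional ℝ A] in
theorem smoothNear_coordFun (i : Fin m) (y : EuclideanSpace ℝ (Fin m)) :
    SmoothNear (coordFun A i) y := .of_contDiff (contDiff_coordFun i) y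

/-- The coordinates of a homomorphism on germs. -/
def IsGermHom.pt {y : EuclideanSpace ℝ (Fin m)} {K : (EuclideanSpace ℝ (Fin m) → A) → A}
    (hK : S.IsGermHom y K) : S.Pt m :=
  (fun i => ⟨K (coordFun A i), hK.mem 0 _ (smoothNear_coordFun i y)
    (Eventually.of_forall fun _ => S.algebraMap_mem _)⟩,
   fun j => ⟨K fun _ => S.ξ j, hK.mem 1 _ (.const _ _) (Eventually.of_forall fun _ => (S.ξ j).2)⟩)

omit [FiniteDimensional ℝ A] in
theorem IsGermHom.base_pt {y : EuclideanSpace ℝ (Fin m)}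
    {K : (EuclideanSpace ℝ (Fin m) → A) → A} (hK : S.IsGermHom y K) : hK.pt.base = y := by
  ext i; exact hK.body_coord i

omit [FiniteDimensional ℝ A] in
theorem coord_sub_smul (i : Fin m) (y : EuclideanSpace ℝ (Fin m))
    (G : EuclideanSpace ℝ (Fin m) → A) :
    (fun x => (EuclideanSpace.proj i : EuclideanSpace ℝ (Fin m) →L[ℝ] ℝ) (x - y) • G x) =
      fun x => (coordFun A i x + algebraMap ℝ A (-y i)) * G x := by
  funext x
  rw [coordFun, ← map_add, ← Algebra.smul_def, sub_eq_add_neg]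
  rfl

/-- K and evaluation at `hK.pt` agree on constants, by checking generators, and on coordinates.
Their difference therefore turns multiplication by xᵢ - yᵢ into multiplication by K(xᵢ) - yᵢ, which
is even of body 0, and `germ_map_eq_zero` applies. -/
theorem IsGermHom.eq_nilEval {y : EuclideanSpace ℝ (Fin m)}
    {K : (EuclideanSpace ℝ (Fin m) → A) → A} (hK : S.IsGermHom y K)
    {F : EuclideanSpace ℝ (Fin m) → A} (hF : SmoothNear F y) : K F = nilEval hK.pt F := by
  have hT := isGermHom_nilEval hK.pt
  rw [hK.base_pt] at hT
  have : CompleteSpace A := FiniteDimensional.complete ℝ A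
  have hconst : ∀ a, K (fun _ => a) = nilEval hK.pt fun _ => a := by
    refine S.induction (fun a ha => ?_) (fun j => ?_) (fun a b ha hb => ?_) fun a b ha hb => ?_
    · rw [hK.scal a ha, hT.scal a ha]
    · rw [nilEval_const, S.subst_ξ]; rfl
    · rw [hK.add _ _ (.const a y) (.const b y), hT.add _ _ (.const a y) (.const b y), ha, hb]
    · rw [hK.mul _ _ (.const a y) (.const b y), hT.mul _ _ (.const a y) (.const b y), ha, hb]
  have hc : ∀ i, nilEval hK.pt (coordFun A i) = K (coordFun A i) := fun i => nilEval_coordFun _ i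
  have := germ_map_eq_zero (ι := Fin m) (fun i => EuclideanSpace.proj i)
    (fun i => EuclideanSpace.single i (1 : ℝ)) euclidean_sum_single y
    (fun F => K F - nilEval hK.pt F)
    (fun F G hF hG => by rw [hK.add _ _ hF hG, hT.add _ _ hF hG]; abel)
    (fun F G hF h => by rw [hK.congr _ _ hF h, hT.congr _ _ hF h])
    (fun a => by rw [hconst, sub_self]) S.evenNil S.order S.evenNil_pow_order
    (fun i => K (coordFun A i) + algebraMap ℝ A (-y i))
    (fun i => by
      have := hK.pt.nilp_mem i
      rw [Pt.nilp, sub_eq_add_neg, ← map_neg, ← Pt.base_apply, hK.base_pt] at this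
      exact this)
    (fun i G hG => by
      have h1 : SmoothNear (fun x => coordFun A i x + algebraMap ℝ A (-y i)) y :=
        (smoothNear_coordFun i y).add (.const _ y)
      have h2 : ∀ r : ℝ, K (fun _ => algebraMap ℝ A r) = algebraMap ℝ A r := fun r =>
        hK.scal _ (S.scal.algebraMap_mem r)
      rw [coord_sub_smul, hK.mul _ _ h1 hG, hT.mul _ _ h1 hG,
        hK.add _ _ (smoothNear_coordFun i y) (.const _ y),
        hT.add _ _ (smoothNear_coordFun i y) (.const _ y), hc, ← hconst, h2, mul_sub])
    F hF
  exact sub_eq_zero.1 this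

/-- A derivation on germs at `y` along the homomorphism `K`. -/
structure IsGermDer {B : Type*} [Ring B] (y : EuclideanSpace ℝ (Fin m))
    (K D : (EuclideanSpace ℝ (Fin m) → A) → B) : Prop where
  add : ∀ F G, SmoothNear F y → SmoothNear G y → D (fun x => F x + G x) = D F + D G
  mul : ∀ F G, SmoothNear F y → SmoothNear G y → D (fun x => F x * G x) = D F * K G + K F * D G
  congr : ∀ F G, SmoothNear F y → F =ᶠ[𝓝 y] G → D F = D G

/-- Derivations on germs are determined by their values on coordinates. -/
theorem IsGermDer.eq_of_coord {B : Type*} [Ring B] [Algebra ℝ B] (S : SuperWeil A n)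
    {y : EuclideanSpace ℝ (Fin m)}
    {K D D' : (EuclideanSpace ℝ (Fin m) → A) → B} (hD : IsGermDer y K D) (hD' : IsGermDer y K D')
    (hscal : ∀ a ∈ S.scal, D (fun _ => a) = D' fun _ => a)
    (hξ : ∀ j, D (fun _ => S.ξ j) = D' fun _ => S.ξ j)
    (hcoord : ∀ i, D (coordFun A i) = D' (coordFun A i))
    (N : Submodule ℝ B) (c : ℕ) (hN : N ^ c = ⊥)
    (hKN : ∀ i, K (fun x => coordFun A i x + algebraMap ℝ A (-y i)) ∈ N)
    {F : EuclideanSpace ℝ (Fin m) → A} (hF : SmoothNear F y) : D F = D' F := by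
  have : CompleteSpace A := FiniteDimensional.complete ℝ A
  have hconst : ∀ a, D (fun _ => a) = D' fun _ => a := by
    refine S.induction hscal hξ (fun a b ha hb => ?_) fun a b ha hb => ?_
    · rw [hD.add _ _ (.const a y) (.const b y), hD'.add _ _ (.const a y) (.const b y), ha, hb]
    · rw [hD.mul _ _ (.const a y) (.const b y), hD'.mul _ _ (.const a y) (.const b y), ha, hb]
  -- In the difference of the two Leibniz rules the terms with a derivative of xᵢ - yᵢ cancel. What
  -- remains is multiplication by K(xᵢ - yᵢ), which lies in the nilpotent N.
  have := germ_map_eq_zero (ι := Fin m) (fun i => EuclideanSpace.proj i)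
    (fun i => EuclideanSpace.single i (1 : ℝ)) euclidean_sum_single y
    (fun F => D F - D' F)
    (fun F G hF hG => by rw [hD.add _ _ hF hG, hD'.add _ _ hF hG]; abel)
    (fun F G hF h => by rw [hD.congr _ _ hF h, hD'.congr _ _ hF h])
    (fun a => by rw [hconst, sub_self]) N c hN _ hKN
    (fun i G hG => by
      have h1 : SmoothNear (fun x => coordFun A i x + algebraMap ℝ A (-y i)) y :=
        (smoothNear_coordFun i y).add (.const _ y)
      rw [coord_sub_smul, hD.mul _ _ h1 hG, hD'.mul _ _ h1 hG,
        hD.add _ _ (smoothNear_coordFun i y) (.const _ y),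
        hD'.add _ _ (smoothNear_coordFun i y) (.const _ y), hcoord, hconst, mul_sub]
      abel)
    F hF
  exact sub_eq_zero.1 this

/-! ### Coordinates of points -/

/-- The projection to the even part. -/
def evenProj (S : SuperWeil A n) : A →L[ℝ] S.gr 0 :=
  LinearMap.toContinuousLinearMap (Submodule.projectionOnto _ _ S.isCompl)

/-- The projection to the odd part. -/
def oddProj (S : SuperWeil A n) : A →L[ℝ] S.gr 1 :=
  LinearMap.toContinuousLinearMap (Submodule.projectionOnto _ _ S.isCompl.symm)

theorem evenProj_of_mem {x : A} (hx : x ∈ S.gr 0) : S.evenProj x = ⟨x, hx⟩ :=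
  Submodule.projectionOnto_apply_left S.isCompl ⟨x, hx⟩

theorem oddProj_of_mem {x : A} (hx : x ∈ S.gr 1) : S.oddProj x = ⟨x, hx⟩ :=
  Submodule.projectionOnto_apply_left S.isCompl.symm ⟨x, hx⟩

/-- The point whose coordinates are the even and odd parts of given elements. -/
def mkPt (S : SuperWeil A n) (a : Fin m → A) (b : Fin n → A) : S.Pt m :=
  (fun i => S.evenProj (a i), fun j => S.oddProj (b j))

theorem smoothNear_mkPt {E : Type*} [NormedAddCommGroup E] [NormedSpace ℝ E]
    {a : Fin m → E → A} {b : Fin n → E → A} {x : E} (ha : ∀ i, SmoothNear (a i) x)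
    (hb : ∀ j, SmoothNear (b j) x) :
    SmoothNear (fun y => S.mkPt (fun i => a i y) fun j => b j y) x := by
  filter_upwards [eventually_all.2 ha, eventually_all.2 hb] with y h h'
  exact ContDiffAt.prodMk
    (contDiffAt_pi.2 fun i => S.evenProj.contDiff.contDiffAt.comp y (h i))
    (contDiffAt_pi.2 fun j => S.oddProj.contDiff.contDiffAt.comp y (h' j))

theorem hasDerivAt_mkPt {a : Fin m → ℝ → A} {b : Fin n → ℝ → A} {a' : Fin m → A} {b' : Fin n → A}
    {t : ℝ} (ha : ∀ i, HasDerivAt (a i) (a' i) t) (hb : ∀ j, HasDerivAt (b j) (b' j) t) :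
    HasDerivAt (fun τ => S.mkPt (fun i => a i τ) fun j => b j τ) (S.mkPt a' b') t := by
  let L : ((Fin m → A) × (Fin n → A)) →ₗ[ℝ] S.Pt m :=
    { toFun := fun q => S.mkPt q.1 q.2
      map_add' := fun q r => Prod.ext (funext fun i => map_add S.evenProj _ _)
        (funext fun j => map_add S.oddProj _ _)
      map_smul' := fun c q => Prod.ext (funext fun i => map_smul S.evenProj _ _)
        (funext fun j => map_smul S.oddProj _ _) }
  have h1 : HasDerivAt (fun τ i => a i τ) a' t := hasDerivAt_pi.2 ha
  have h2 : HasDerivAt (fun τ j => b j τ) b' t := hasDerivAt_pi.2 hb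
  exact (LinearMap.toContinuousLinearMap L).hasFDerivAt.comp_hasDerivAt t (h1.prodMk h2)

/-- A dummy real parameter, frozen at 0, reduces this to the parametrised statement. -/
theorem nilEval_smoothNear_const {p₀ : S.Pt m} {F : EuclideanSpace ℝ (Fin m) → A}
    (hF : SmoothNear F p₀.base) : SmoothNear (fun p : S.Pt m => nilEval p F) p₀ := by
  have h1 : SmoothNear (fun q : ℝ × EuclideanSpace ℝ (Fin m) => F q.2) ((0 : ℝ), p₀.base) :=
    SmoothNear.comp (g := fun q : ℝ × EuclideanSpace ℝ (Fin m) => q.2) hF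
      (.of_contDiff contDiff_snd _)
  have h2 := nilEval_smoothNear (p₀ := p₀) h1
  exact SmoothNear.comp (g := fun p : S.Pt m => ((0 : ℝ), p)) h2
    (.of_contDiff (contDiff_const.prodMk contDiff_id) _)

/-! ### Differentiation of evaluations along curves of points. -/

section Curves

variable {p : ℝ → S.Pt m} {p' : S.Pt m} {t : ℝ} (hp : HasDerivAt p p' t)

include hp

theorem continuousAt_base : ContinuousAt (fun τ => (p τ).base) t :=
  (contDiff_base.continuous.continuousAt).comp hp.continuousAt

theorem hasDerivAt_nilEval_deriv {F : EuclideanSpace ℝ (Fin m) → A}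
    (hF : SmoothNear F (p t).base) :
    HasDerivAt (fun τ => nilEval (p τ) F) (deriv (fun τ => nilEval (p τ) F) t) t := by
  have h1 : DifferentiableAt ℝ (fun q : S.Pt m => nilEval q F) (p t) :=
    (nilEval_smoothNear_const hF).contDiffAt.differentiableAt (by simp)
  exact (h1.comp t hp.differentiableAt).hasDerivAt

/-- The Leibniz rule is multiplicativity of evaluation, differentiated in τ. The base moves, so the
germs have to be smooth at the bases for all τ near t. -/
theorem isGermDer_deriv : IsGermDer (p t).base (nilEval (p t))
    fun F => deriv (fun τ => nilEval (p τ) F) t := by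
  have hcont := continuousAt_base hp
  have hsn : ∀ F : EuclideanSpace ℝ (Fin m) → A, SmoothNear F (p t).base →
      ∀ᶠ τ in 𝓝 t, SmoothNear F (p τ).base := fun F hF => hcont.eventually hF.eventually_nhds
  refine ⟨fun F G hF hG => ?_, fun F G hF hG => ?_, fun F G hF h => ?_⟩
  · refine HasDerivAt.deriv (((hasDerivAt_nilEval_deriv hp hF).add
      (hasDerivAt_nilEval_deriv hp hG)).congr_of_eventuallyEq ?_)
    filter_upwards [hsn F hF, hsn G hG] with τ h1 h2 using nilEval_add _ h1 h2
  · refine HasDerivAt.deriv (((hasDerivAt_nilEval_deriv hp hF).mul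
      (hasDerivAt_nilEval_deriv hp hG)).congr_of_eventuallyEq ?_)
    filter_upwards [hsn F hF, hsn G hG] with τ h1 h2 using nilEval_mul _ h1 h2
  · refine Filter.EventuallyEq.deriv_eq ?_
    filter_upwards [hcont.eventually h.eventually_nhds] with τ h1 using nilEval_congr _ h1

omit [FiniteDimensional ℝ A] in
theorem hasDerivAt_even (i : Fin m) : HasDerivAt (fun τ => ((p τ).1 i : A)) (p'.1 i : A) t :=
  (S.gr 0).subtypeL.hasFDerivAt.comp_hasDerivAt t ((hasDerivAt_pi.1 hp.fst) i)

omit [FiniteDimensional ℝ A] in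
theorem hasDerivAt_odd (j : Fin n) : HasDerivAt (fun τ => ((p τ).2 j : A)) (p'.2 j : A) t :=
  (S.gr 1).subtypeL.hasFDerivAt.comp_hasDerivAt t ((hasDerivAt_pi.1 hp.snd) j)

end Curves

end SuperWeil

/-! ### Supercommutativity of the exterior algebra -/

section Exterior

variable {V : Type*} [AddCommGroup V] [Module ℝ V]

/-- Vectors anticommute in the exterior algebra, and moving v past a product changes sign once per
factor, which is the parity involution. -/
theorem ι_mul_eq_involute_mul (v : V) (x : CliffordAlgebra (0 : QuadraticForm ℝ V)) :
    CliffordAlgebra.ι 0 v * x = CliffordAlgebra.involute x * CliffordAlgebra.ι 0 v := by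
  induction x using CliffordAlgebra.induction with
  | algebraMap r => rw [AlgHom.commutes, Algebra.commutes]
  | ι w =>
    rw [CliffordAlgebra.involute_ι, neg_mul, eq_neg_iff_add_eq_zero]
    exact ExteriorAlgebra.ι_add_mul_swap v w
  | mul a b ha hb => rw [map_mul, ← mul_assoc, ha, mul_assoc, hb, mul_assoc]
  | add a b ha hb => rw [map_add, mul_add, add_mul, ha, hb]

theorem ι_mul_ι_comm (v w : V) (x : CliffordAlgebra (0 : QuadraticForm ℝ V)) :
    CliffordAlgebra.ι 0 v * CliffordAlgebra.ι 0 w * x =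
      x * (CliffordAlgebra.ι 0 v * CliffordAlgebra.ι 0 w) := by
  rw [mul_assoc, ι_mul_eq_involute_mul w x, ← mul_assoc, ι_mul_eq_involute_mul v,
    CliffordAlgebra.involute_involute, mul_assoc]

theorem even_mul_comm {y : CliffordAlgebra (0 : QuadraticForm ℝ V)}
    (hy : y ∈ CliffordAlgebra.evenOdd (0 : QuadraticForm ℝ V) 0)
    (x : CliffordAlgebra (0 : QuadraticForm ℝ V)) : y * x = x * y := by
  induction y, hy using CliffordAlgebra.even_induction with
  | algebraMap r => exact Algebra.commutes r x
  | add a b _ _ ha hb => rw [add_mul, mul_add, ha, hb]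
  | ι_mul_ι_mul v w a _ ha =>
    rw [mul_assoc, ha, ← mul_assoc, ι_mul_ι_comm, mul_assoc]

theorem odd_mul_comm {y : CliffordAlgebra (0 : QuadraticForm ℝ V)}
    (hy : y ∈ CliffordAlgebra.evenOdd (0 : QuadraticForm ℝ V) 1)
    (x : CliffordAlgebra (0 : QuadraticForm ℝ V)) : y * x = CliffordAlgebra.involute x * y := by
  induction y, hy using CliffordAlgebra.odd_induction with
  | ι v => exact ι_mul_eq_involute_mul v x
  | add a b _ _ ha hb => rw [add_mul, mul_add, ha, hb]
  | ι_mul_ι_mul v w a _ ha =>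
    rw [mul_assoc, ha, ← mul_assoc, ι_mul_ι_comm, mul_assoc]

theorem zmod_two_cases (i : ZMod 2) : i = 0 ∨ i = 1 :=
  (by decide : ∀ i : ZMod 2, i = 0 ∨ i = 1) i

theorem ext_supercomm {j k : ZMod 2} {x y : CliffordAlgebra (0 : QuadraticForm ℝ V)}
    (hx : x ∈ CliffordAlgebra.evenOdd (0 : QuadraticForm ℝ V) j)
    (hy : y ∈ CliffordAlgebra.evenOdd (0 : QuadraticForm ℝ V) k) :
    x * y = ((-1 : ℤˣ) ^ (j * k)) • (y * x) := by
  rcases zmod_two_cases j with rfl | rfl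
  · rw [even_mul_comm hx]; simp
  · rw [odd_mul_comm hx]
    rcases zmod_two_cases k with rfl | rfl
    · rw [CliffordAlgebra.involute_eq_of_mem_even hy]; simp
    · rw [CliffordAlgebra.involute_eq_of_mem_odd hy]; simp [Units.smul_def]

/-- The sign is -1, so 2 x² = 0. -/
theorem sq_eq_zero_of_anticomm {A : Type*} [Ring A] [Algebra ℝ A] {x : A}
    (h : x * x = ((-1 : ℤˣ) ^ ((1 : ZMod 2) * 1)) • (x * x)) : x * x = 0 := by
  have h1 : (-1 : ℤˣ) ^ ((1 : ZMod 2) * 1) = -1 := by decide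
  rw [h1, Units.neg_smul, one_smul] at h
  have h2 : (2 : ℝ) • (x * x) = 0 := by
    rw [two_smul]; nth_rewrite 1 [h]; exact neg_add_cancel _
  exact (smul_eq_zero.1 h2).resolve_left two_ne_zero

/-- An odd element squares to zero, and ℝ has no nonzero nilpotents. -/
theorem algebraMapInv_odd {x : ExteriorAlgebra ℝ V}
    (hx : x ∈ CliffordAlgebra.evenOdd (0 : QuadraticForm ℝ V) 1) :
    ExteriorAlgebra.algebraMapInv x = 0 := by
  have h : x * x = 0 := sq_eq_zero_of_anticomm (ext_supercomm hx hx)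
  have h2 := congrArg ExteriorAlgebra.algebraMapInv h
  rw [map_mul, map_zero] at h2
  exact mul_self_eq_zero.1 h2

/-- Even elements are sums of scalars and of products v w a with a even. Such a product has body 0
and square 0, since v occurs twice, and commuting nilpotents add. -/
theorem isNilpotent_ext_even {x : ExteriorAlgebra ℝ V}
    (hx : x ∈ CliffordAlgebra.evenOdd (0 : QuadraticForm ℝ V) 0) :
    IsNilpotent (x - algebraMap ℝ (ExteriorAlgebra ℝ V) (ExteriorAlgebra.algebraMapInv x)) := by
  induction x, hx using CliffordAlgebra.even_induction with
  | algebraMap r =>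
    have : ExteriorAlgebra.algebraMapInv (algebraMap ℝ (ExteriorAlgebra ℝ V) r) = r :=
      AlgHom.commutes _ r
    rw [this, sub_self]; exact IsNilpotent.zero
  | add a b ha hb iha ihb =>
    rw [map_add, map_add, add_sub_add_comm]
    refine Commute.isNilpotent_add ?_ iha ihb
    have : ∀ c ∈ CliffordAlgebra.evenOdd (0 : QuadraticForm ℝ V) 0,
        c - algebraMap ℝ (ExteriorAlgebra ℝ V) (ExteriorAlgebra.algebraMapInv c) ∈
          CliffordAlgebra.evenOdd (0 : QuadraticForm ℝ V) 0 := fun c hc =>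
      Submodule.sub_mem _ hc (SetLike.algebraMap_mem_graded _ _)
    exact even_mul_comm (this a ha) _
  | ι_mul_ι_mul v w a ha _ =>
    have h1 : ExteriorAlgebra.algebraMapInv (CliffordAlgebra.ι 0 v) = (0 : ℝ) :=
      algebraMapInv_odd (CliffordAlgebra.ι_mem_evenOdd_one _ v)
    have h3 : ExteriorAlgebra.algebraMapInv (CliffordAlgebra.ι 0 v * CliffordAlgebra.ι 0 w * a) =
        (0 : ℝ) := by rw [map_mul, map_mul, h1, zero_mul, zero_mul]
    rw [h3, map_zero, sub_zero]
    refine ⟨2, ?_⟩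
    have h2 : CliffordAlgebra.ι (0 : QuadraticForm ℝ V) v * CliffordAlgebra.ι 0 v = 0 :=
      ExteriorAlgebra.ι_sq_zero v
    rw [pow_two, mul_assoc, ← mul_assoc a, even_mul_comm ha, mul_assoc,
      ι_mul_eq_involute_mul w]
    simp only [map_mul, CliffordAlgebra.involute_ι]
    calc _ = -(-((CliffordAlgebra.ι (0 : QuadraticForm ℝ V) v * CliffordAlgebra.ι 0 v) *
          CliffordAlgebra.ι 0 w * CliffordAlgebra.involute a * CliffordAlgebra.involute a *
          CliffordAlgebra.ι 0 w)) := by simp only [mul_assoc, neg_mul, mul_neg, neg_neg]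
      _ = 0 := by rw [h2]; simp

end Exterior

/-! ### The coefficient algebra as a super Weil algebra -/

section CoeffAlgebra

variable {P : Type u} [Ring P] [Algebra ℝ P] (𝒜 : ZMod 2 → Submodule ℝ P) [GradedAlgebra 𝒜]

theorem coeff_induction (n : ℕ) {p : Coeff 𝒜 n → Prop}
    (tmul : ∀ (a : P) (b : ExteriorAlgebra ℝ (Fin n → ℝ)), p (a ᵍ⊗ₜ[ℝ] b))
    (add : ∀ x y, p x → p y → p (x + y)) (x : Coeff 𝒜 n) : p x := by
  obtain ⟨y, rfl⟩ := (GradedTensorProduct.of ℝ 𝒜 (extParity n)).surjective x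
  induction y using TensorProduct.induction_on with
  | zero =>
    have := tmul 0 0
    rwa [GradedTensorProduct.tmul, TensorProduct.zero_tmul] at this
  | tmul a b => exact tmul a b
  | add x y hx hy => rw [map_add]; exact add _ _ hx hy

theorem tmul_eq_mul (n : ℕ) (a : P) (b : ExteriorAlgebra ℝ (Fin n → ℝ)) :
    (a ᵍ⊗ₜ[ℝ] b : Coeff 𝒜 n) = GradedTensorProduct.includeLeft 𝒜 (extParity n) a *
      GradedTensorProduct.includeRight 𝒜 (extParity n) b :=
  (GradedTensorProduct.tmul_one_mul_one_tmul _ _ a b).symm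

variable {𝒜}
variable [FiniteDimensional ℝ P] {aug : P →ₐ[ℝ] ℝ} (hP : IsSmall 𝒜 aug)

include hP

omit hP [FiniteDimensional ℝ P] [GradedAlgebra 𝒜] in
-- Koszul signs. On the left, the inner factors are exchanged and then the factors commuted within P
-- and within Λℝⁿ; on the right stand the total parities and the exchange in the reversed product.
theorem sign_identity : ∀ j₁ k₁ j₂ k₂ : ZMod 2,
    (-1 : ℤˣ) ^ (k₁ * j₂) * ((-1) ^ (j₁ * j₂) * (-1) ^ (k₁ * k₂)) =
      (-1) ^ ((j₁ + k₁) * (j₂ + k₂)) * (-1) ^ (k₂ * j₁) := by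
  decide

/-- By bilinearity homogeneous tensors suffice, where supercommutativity of P and of the exterior
algebra combine through `sign_identity`. -/
theorem coeff_supercomm (n : ℕ) (i j : ZMod 2) (x y : Coeff 𝒜 n) (hx : x ∈ coeffGr 𝒜 n i)
    (hy : y ∈ coeffGr 𝒜 n j) : x * y = ((-1 : ℤˣ) ^ (i * j)) • (y * x) := by
  generalize hsgn : (-1 : ℤˣ) ^ (i * j) = s
  induction hx using Submodule.span_induction with
  | zero => simp
  | add x x' _ _ h h' => rw [add_mul, mul_add, h, h', smul_add]
  | smul c x _ h => rw [smul_mul_assoc, h, mul_smul_comm, smul_comm]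
  | mem x hx =>
    obtain ⟨j₁, k₁, a₁, b₁, rfl, rfl⟩ := hx
    induction hy using Submodule.span_induction with
    | zero => simp
    | add x x' _ _ h h' => rw [add_mul, mul_add, h, h', smul_add]
    | smul c x _ h => rw [smul_mul_assoc, mul_smul_comm, h, smul_comm]
    | mem y hy =>
      obtain ⟨j₂, k₂, a₂, b₂, rfl, rfl⟩ := hy
      rw [GradedTensorProduct.tmul_coe_mul_coe_tmul, GradedTensorProduct.tmul_coe_mul_coe_tmul,
        hP.supercomm j₁ j₂ a₁ a₂ a₁.2 a₂.2, ext_supercomm b₁.2 b₂.2]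
      have hs : ∀ (s t : ℤˣ) (a : P) (b : ExteriorAlgebra ℝ (Fin n → ℝ)),
          ((s • a) ᵍ⊗ₜ[ℝ] (t • b) : Coeff 𝒜 n) = (s * t) • (a ᵍ⊗ₜ[ℝ] b) := by
        intro s t a b
        have h0 : ∀ (a : P) (b : ExteriorAlgebra ℝ (Fin n → ℝ)),
            (a ᵍ⊗ₜ[ℝ] (-b) : Coeff 𝒜 n) = -(a ᵍ⊗ₜ[ℝ] b) := fun a b => by
          rw [GradedTensorProduct.tmul, TensorProduct.tmul_neg, map_neg]
        have h1 : ∀ (a : P) (b : ExteriorAlgebra ℝ (Fin n → ℝ)),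
            ((-a) ᵍ⊗ₜ[ℝ] b : Coeff 𝒜 n) = -(a ᵍ⊗ₜ[ℝ] b) := fun a b => by
          rw [GradedTensorProduct.tmul, TensorProduct.neg_tmul, map_neg]
        rcases Int.units_eq_one_or s with rfl | rfl <;>
          rcases Int.units_eq_one_or t with rfl | rfl <;>
          simp [Units.neg_smul, h0, h1]
      rw [hs, smul_smul, smul_smul]
      rw [← hsgn, sign_identity]

theorem coeff_even_comm (n : ℕ) (x : Coeff 𝒜 n) (hx : x ∈ coeffGr 𝒜 n 0) (y : Coeff 𝒜 n) :
    x * y = y * x := by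
  have hy : y ∈ coeffGr 𝒜 n 0 ⊔ coeffGr 𝒜 n 1 := by
    rw [(coeffGr_isCompl 𝒜 n).sup_eq_top]; trivial
  obtain ⟨y₀, h₀, y₁, h₁, rfl⟩ := Submodule.mem_sup.1 hy
  have e0 := coeff_supercomm hP n 0 0 x y₀ hx h₀
  have e1 := coeff_supercomm hP n 0 1 x y₁ hx h₁
  simp only [zero_mul, uzpow_zero, one_smul] at e0 e1
  rw [mul_add, add_mul, e0, e1]

theorem coeff_odd_sq (n : ℕ) (x : Coeff 𝒜 n) (hx : x ∈ coeffGr 𝒜 n 1) : x * x = 0 :=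
  sq_eq_zero_of_anticomm (coeff_supercomm hP n 1 1 x x hx hx)

theorem aug_odd {a : P} (ha : a ∈ 𝒜 1) : aug a = 0 := by
  have h := sq_eq_zero_of_anticomm (hP.supercomm 1 1 a a ha ha)
  have h2 := congrArg aug h
  rw [map_mul, map_zero] at h2
  exact mul_self_eq_zero.1 h2

/-- The body map of `P ⊠ Λℝⁿ` as an algebra homomorphism. -/
def coeffBodyHom (n : ℕ) : Coeff 𝒜 n →ₐ[ℝ] ℝ :=
  GradedTensorProduct.lift 𝒜 (extParity n) aug ExteriorAlgebra.algebraMapInv (by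
    intro i j a b
    rcases zmod_two_cases i with rfl | rfl
    · simp [mul_comm]
    · rw [aug_odd hP a.2]; simp)

theorem coeffBody_odd (n : ℕ) (x : Coeff 𝒜 n) (hx : x ∈ coeffGr 𝒜 n 1) :
    coeffBodyHom hP n x = 0 := by
  have h2 := congrArg (coeffBodyHom hP n) (coeff_odd_sq hP n x hx)
  rw [map_mul, map_zero] at h2
  exact mul_self_eq_zero.1 h2

theorem isNilpotent_of_aug_eq_zero {a : P} (ha : aug a = 0) : IsNilpotent a := by
  obtain ⟨N, hN⟩ := hP.nilpotent
  refine ⟨N, ?_⟩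
  have : a ^ N ∈ (LinearMap.ker aug.toLinearMap) ^ N := Submodule.pow_mem_pow _ ha N
  rwa [hN, Submodule.mem_bot] at this

/-- For even ⊗ even, a b - a^# b^# = (a - a^#) b + a^# (b - b^#) is a sum of commuting nilpotents.
For odd ⊗ odd the body is 0 and the square vanishes because a² = 0. Other even elements are
combinations of these, and even elements commute. -/
theorem coeff_isNilpotent_sub (n : ℕ) (x : Coeff 𝒜 n) (hx : x ∈ coeffGr 𝒜 n 0) :
    IsNilpotent (x - algebraMap ℝ _ (coeffBodyHom hP n x)) := by
  have hsub : ∀ x ∈ coeffGr 𝒜 n 0, x - algebraMap ℝ _ (coeffBodyHom hP n x) ∈ coeffGr 𝒜 n 0 :=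
    fun x hx => Submodule.sub_mem _ hx (by
      rw [Algebra.algebraMap_eq_smul_one]; exact Submodule.smul_mem _ _ (coeffGr_one 𝒜 n))
  induction hx using Submodule.span_induction with
  | zero => simp
  | add x y hx hy h h' =>
    rw [map_add, map_add, add_sub_add_comm]
    exact Commute.isNilpotent_add (coeff_even_comm hP n _ (hsub x hx) _) h h'
  | smul c x _ h =>
    rw [map_smul, smul_eq_mul, map_mul, ← Algebra.smul_def, ← smul_sub]
    exact h.smul c
  | mem x hx =>
    obtain ⟨j, k, a, b, hjk, rfl⟩ := hx
    have hb : coeffBodyHom hP n ((a : P) ᵍ⊗ₜ[ℝ] (b : ExteriorAlgebra ℝ (Fin n → ℝ))) =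
      aug a * ExteriorAlgebra.algebraMapInv (b : ExteriorAlgebra ℝ (Fin n → ℝ)) := rfl
    rcases zmod_two_cases j with rfl | rfl
    · rw [zero_add] at hjk
      subst hjk
      rw [hb, tmul_eq_mul]
      set f := GradedTensorProduct.includeLeft 𝒜 (extParity n) with hf
      set g := GradedTensorProduct.includeRight 𝒜 (extParity n) with hg
      have hfm : ∀ a ∈ 𝒜 0, f a ∈ coeffGr 𝒜 n 0 := fun a ha => coeffGr_includeLeft 𝒜 n 0 a ha
      have hgm : ∀ b ∈ extParity n 0, g b ∈ coeffGr 𝒜 n 0 := fun b hb =>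
        Submodule.subset_span ⟨0, 0, ⟨1, SetLike.one_mem_graded 𝒜⟩, ⟨b, hb⟩, by simp, rfl⟩
      have ha' : (a : P) - algebraMap ℝ P (aug a) ∈ 𝒜 0 :=
        Submodule.sub_mem _ a.2 (SetLike.algebraMap_mem_graded _ _)
      have hb' : (b : ExteriorAlgebra ℝ (Fin n → ℝ)) - algebraMap ℝ _
          (ExteriorAlgebra.algebraMapInv (b : ExteriorAlgebra ℝ (Fin n → ℝ))) ∈ extParity n 0 :=
        Submodule.sub_mem _ b.2 (SetLike.algebraMap_mem_graded _ _)
      have e : f a * g b - algebraMap ℝ _ (aug a * ExteriorAlgebra.algebraMapInv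
          (b : ExteriorAlgebra ℝ (Fin n → ℝ))) =
          f (a - algebraMap ℝ P (aug a)) * g b + aug a • g (b - algebraMap ℝ _
          (ExteriorAlgebra.algebraMapInv (b : ExteriorAlgebra ℝ (Fin n → ℝ)))) := by
        rw [map_sub, map_sub, AlgHom.commutes, AlgHom.commutes, sub_mul, smul_sub, map_mul,
          Algebra.smul_def, Algebra.smul_def]
        abel
      rw [e]
      refine Commute.isNilpotent_add ?_ ?_ ?_
      · exact (Algebra.commute_algebraMap_left (aug a) _).symm.mul_right
          (coeff_even_comm hP n _ (by
            have := coeffGr_mul 𝒜 n 0 0 _ _ (hfm _ ha') (hgm _ b.2)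
            rwa [zero_add] at this) _) |> fun h => by rwa [← Algebra.smul_def] at h
      · have h1 : IsNilpotent (f (a - algebraMap ℝ P (aug a))) :=
          (isNilpotent_of_aug_eq_zero hP (by simp)).map f
        exact Commute.isNilpotent_mul_right (coeff_even_comm hP n _ (hfm _ ha') _) h1
      · exact ((isNilpotent_ext_even b.2).map g).smul _
    · have hk : k = 1 := by
        rcases zmod_two_cases k with rfl | rfl
        · exact absurd hjk (by decide)
        · rfl
      subst hk
      rw [hb, aug_odd hP a.2, zero_mul, map_zero, sub_zero]
      refine ⟨2, ?_⟩
      have h0 : (a : P) * a = 0 := sq_eq_zero_of_anticomm (hP.supercomm 1 1 a a a.2 a.2)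
      rw [pow_two, GradedTensorProduct.tmul_coe_mul_coe_tmul, h0, GradedTensorProduct.tmul,
        TensorProduct.zero_tmul, map_zero, smul_zero]

/-- The `P`-linear algebra homomorphism `P ⊠ Λℝⁿ → P ⊠ Λℝⁿ` with `ξⱼ ↦ θⱼ`: right part. -/
def substRight (n : ℕ) (θ : Fin n → coeffGr 𝒜 n 1) :
    ExteriorAlgebra ℝ (Fin n → ℝ) →ₐ[ℝ] Coeff 𝒜 n :=
  ExteriorAlgebra.lift ℝ ⟨Fintype.linearCombination ℝ fun j => (θ j : Coeff 𝒜 n), fun v =>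
    coeff_odd_sq hP n _ (by
      rw [Fintype.linearCombination_apply]
      exact Submodule.sum_mem _ fun j _ => Submodule.smul_mem _ _ (θ j).2)⟩

theorem substRight_ι (n : ℕ) (θ : Fin n → coeffGr 𝒜 n 1) (v : Fin n → ℝ) :
    substRight hP n θ (ExteriorAlgebra.ι ℝ v) = ∑ j, v j • (θ j : Coeff 𝒜 n) := by
  rw [substRight, ExteriorAlgebra.lift_ι_apply, Fintype.linearCombination_apply]

theorem substRight_mem (n : ℕ) (θ : Fin n → coeffGr 𝒜 n 1) (i : ZMod 2)
    (b : ExteriorAlgebra ℝ (Fin n → ℝ)) (hb : b ∈ extParity n i) :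
    substRight hP n θ b ∈ coeffGr 𝒜 n i := by
  have hι : ∀ v : Fin n → ℝ, substRight hP n θ (CliffordAlgebra.ι 0 v) ∈ coeffGr 𝒜 n 1 := by
    intro v
    change substRight hP n θ (ExteriorAlgebra.ι ℝ v) ∈ _
    rw [substRight_ι]
    exact Submodule.sum_mem _ fun j _ => Submodule.smul_mem _ _ (θ j).2
  have hιι : ∀ v w : Fin n → ℝ, substRight hP n θ (CliffordAlgebra.ι 0 v * CliffordAlgebra.ι 0 w) ∈
      coeffGr 𝒜 n 0 := by
    intro v w
    rw [map_mul]
    exact coeffGr_mul 𝒜 n 1 1 _ _ (hι v) (hι w)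
  rcases zmod_two_cases i with rfl | rfl
  · induction b, hb using CliffordAlgebra.even_induction with
    | algebraMap r =>
      have : substRight hP n θ (algebraMap ℝ _ r) = algebraMap ℝ _ r := AlgHom.commutes _ r
      change substRight hP n θ (algebraMap ℝ (ExteriorAlgebra ℝ (Fin n → ℝ)) r) ∈ _
      rw [this, Algebra.algebraMap_eq_smul_one]
      exact Submodule.smul_mem _ _ (coeffGr_one 𝒜 n)
    | add a b _ _ ha hb => rw [map_add]; exact Submodule.add_mem _ ha hb
    | ι_mul_ι_mul v w a _ ha =>
      rw [map_mul]
      have := coeffGr_mul 𝒜 n 0 0 _ _ (hιι v w) ha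
      rwa [zero_add] at this
  · induction b, hb using CliffordAlgebra.odd_induction with
    | ι v => exact hι v
    | add a b _ _ ha hb => rw [map_add]; exact Submodule.add_mem _ ha hb
    | ι_mul_ι_mul v w a _ ha =>
      rw [map_mul]
      have := coeffGr_mul 𝒜 n 0 1 _ _ (hιι v w) ha
      rwa [zero_add] at this

/-- The `P`-linear algebra homomorphism `P ⊠ Λℝⁿ → P ⊠ Λℝⁿ` with `ξⱼ ↦ θⱼ`. -/
def coeffSubst (n : ℕ) (θ : Fin n → coeffGr 𝒜 n 1) : Coeff 𝒜 n →ₐ[ℝ] Coeff 𝒜 n :=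
  GradedTensorProduct.lift 𝒜 (extParity n) (GradedTensorProduct.includeLeft 𝒜 (extParity n))
    (substRight hP n θ) (by
      intro i j a b
      rw [coeff_supercomm hP n i j _ _ (coeffGr_includeLeft 𝒜 n i a a.2)
        (substRight_mem hP n θ j b b.2), mul_comm i j])

theorem coeffSubst_tmul (n : ℕ) (θ : Fin n → coeffGr 𝒜 n 1) (a : P)
    (b : ExteriorAlgebra ℝ (Fin n → ℝ)) : coeffSubst hP n θ (a ᵍ⊗ₜ[ℝ] b) =
      GradedTensorProduct.includeLeft 𝒜 (extParity n) a * substRight hP n θ b := rfl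

theorem coeffSubst_mem (n : ℕ) (θ : Fin n → coeffGr 𝒜 n 1) (i : ZMod 2) (x : Coeff 𝒜 n)
    (hx : x ∈ coeffGr 𝒜 n i) : coeffSubst hP n θ x ∈ coeffGr 𝒜 n i := by
  induction hx using Submodule.span_induction with
  | zero => rw [map_zero]; exact Submodule.zero_mem _
  | add x y _ _ h h' => rw [map_add]; exact Submodule.add_mem _ h h'
  | smul c x _ h => rw [map_smul]; exact Submodule.smul_mem _ _ h
  | mem x hx =>
    obtain ⟨j, k, a, b, rfl, rfl⟩ := hx
    rw [coeffSubst_tmul]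
    exact coeffGr_mul 𝒜 n j k _ _ (coeffGr_includeLeft 𝒜 n j a a.2) (substRight_mem hP n θ k b b.2)

variable (𝒜) in
omit hP [FiniteDimensional ℝ P] in
/-- The odd coordinates of `P ⊠ Λℝⁿ`. -/
def oddCoord (n : ℕ) (j : Fin n) : coeffGr 𝒜 n 1 :=
  ⟨1 ᵍ⊗ₜ[ℝ] ExteriorAlgebra.ι ℝ (Pi.single j 1), Submodule.subset_span
    ⟨0, 1, ⟨1, SetLike.one_mem_graded 𝒜⟩, ⟨_, CliffordAlgebra.ι_mem_evenOdd_one _ _⟩, by simp, rfl⟩⟩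

theorem coeffSubst_oddCoord (n : ℕ) (θ : Fin n → coeffGr 𝒜 n 1) (j : Fin n) :
    coeffSubst hP n θ (oddCoord 𝒜 n j) = θ j := by
  rw [oddCoord, coeffSubst_tmul, map_one, one_mul, substRight_ι, Finset.sum_eq_single j]
  · simp
  · intro k _ hk; simp [Pi.single_eq_of_ne hk]
  · simp

omit hP [FiniteDimensional ℝ P] in
theorem adjoin_coeff (n : ℕ) : Algebra.adjoin ℝ
    ((((GradedTensorProduct.includeLeft 𝒜 (extParity n)).range : Subalgebra ℝ (Coeff 𝒜 n)) :
      Set (Coeff 𝒜 n)) ∪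
      Set.range fun j => (oddCoord 𝒜 n j : Coeff 𝒜 n)) = ⊤ := by
  rw [eq_top_iff]
  rintro x -
  set T := Algebra.adjoin ℝ
    ((((GradedTensorProduct.includeLeft 𝒜 (extParity n)).range : Subalgebra ℝ (Coeff 𝒜 n)) :
      Set (Coeff 𝒜 n)) ∪
      Set.range fun j => (oddCoord 𝒜 n j : Coeff 𝒜 n)) with hT
  have hr : ∀ b : ExteriorAlgebra ℝ (Fin n → ℝ), GradedTensorProduct.includeRight 𝒜 (extParity n) b ∈ T := by
    intro b
    induction b using ExteriorAlgebra.induction with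
    | algebraMap r =>
      rw [AlgHom.commutes]; exact T.algebraMap_mem r
    | ι v =>
      have : v = ∑ j, v j • (Pi.single j 1 : Fin n → ℝ) := by
        conv_lhs => rw [pi_eq_sum_univ' v]
      rw [this, map_sum]
      rw [map_sum]
      refine Subalgebra.sum_mem _ fun j _ => ?_
      rw [map_smul, map_smul]
      have hj : (oddCoord 𝒜 n j : Coeff 𝒜 n) ∈ T := Algebra.subset_adjoin (Or.inr ⟨j, rfl⟩)
      have e : GradedTensorProduct.includeRight 𝒜 (extParity n)
          (ExteriorAlgebra.ι ℝ (Pi.single j 1 : Fin n → ℝ)) = oddCoord 𝒜 n j := rfl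
      rw [e]
      exact T.smul_mem hj _
    | mul a b ha hb => rw [map_mul]; exact T.mul_mem ha hb
    | add a b ha hb => rw [map_add]; exact T.add_mem ha hb
  refine coeff_induction 𝒜 n (fun a b => ?_) (fun x y => T.add_mem) x
  rw [tmul_eq_mul]
  have ha : GradedTensorProduct.includeLeft 𝒜 (extParity n) a ∈ T :=
    Algebra.subset_adjoin (Or.inl ⟨a, rfl⟩)
  exact T.mul_mem ha (hr b)

/-- A submultiplicative norm on the finite dimensional algebra `P ⊠ Λℝⁿ`, from its regular
representation. -/
instance coeffNormedRing (n : ℕ) : NormedRing (Coeff 𝒜 n) :=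
  letI := coeff_finite 𝒜 n
  letI := Matrix.linftyOpNormedRing (n := Fin (Module.finrank ℝ (Coeff 𝒜 n))) (α := ℝ)
  NormedRing.induced (Coeff 𝒜 n) _ (Algebra.leftMulMatrix (Module.finBasis ℝ (Coeff 𝒜 n)))
    (Algebra.leftMulMatrix_injective _)

instance coeffNormedAlgebra (n : ℕ) : NormedAlgebra ℝ (Coeff 𝒜 n) :=
  letI := coeff_finite 𝒜 n
  letI := Matrix.linftyOpNormedRing (n := Fin (Module.finrank ℝ (Coeff 𝒜 n))) (α := ℝ)
  letI := Matrix.linftyOpNormedAlgebra (n := Fin (Module.finrank ℝ (Coeff 𝒜 n))) (R := ℝ) (α := ℝ)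
  NormedAlgebra.induced ℝ (Coeff 𝒜 n) _ (Algebra.leftMulMatrix (Module.finBasis ℝ (Coeff 𝒜 n)))

instance coeffFinite (n : ℕ) : FiniteDimensional ℝ (Coeff 𝒜 n) := coeff_finite 𝒜 n

/-- `P ⊠ Λℝⁿ` as a super Weil algebra. -/
def coeffWeil (n : ℕ) : SuperWeil (Coeff 𝒜 n) n where
  body := coeffBodyHom hP n
  gr := coeffGr 𝒜 n
  one_mem := coeffGr_one 𝒜 n
  mul_mem := fun i j x y hx hy => coeffGr_mul 𝒜 n i j x y hx hy
  isCompl := coeffGr_isCompl 𝒜 n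
  central := fun x hx y => coeff_even_comm hP n x hx y
  nil := fun x hx h0 => by
    have := coeff_isNilpotent_sub hP n x hx
    rwa [h0, map_zero, sub_zero] at this
  body_odd := fun x hx => coeffBody_odd hP n x hx
  scal := (GradedTensorProduct.includeLeft 𝒜 (extParity n)).range
  ξ := oddCoord 𝒜 n
  adjoin := adjoin_coeff n
  subst := coeffSubst hP n
  subst_scal := by
    rintro θ _ ⟨a, rfl⟩
    exact (coeffSubst_tmul hP n θ a 1).trans (by rw [map_one, mul_one]; rfl)
  subst_ξ := coeffSubst_oddCoord hP n
  subst_mem := fun θ i x hx => coeffSubst_mem hP n θ i x hx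

end CoeffAlgebra

open Filter Topology

/-! ### Smoothness tested by linear functionals -/

section FiniteDimensional

variable {A : Type*} [NormedAddCommGroup A] [NormedSpace ℝ A] [FiniteDimensional ℝ A]
variable {F H N : Type*} [NormedAddCommGroup F] [NormedSpace ℝ F] [TopologicalSpace H]
  {I : ModelWithCorners ℝ F H} [TopologicalSpace N] [ChartedSpace H N]

/-- The sheaves test smoothness against linear functionals, without a norm on the coefficients; a
basis translates this into smoothness in the normed space. -/
theorem contMDiffOn_iff_linear {f : N → A} {s : Set N} :
    (∀ l : A →ₗ[ℝ] ℝ, ContMDiffOn I 𝓘(ℝ, ℝ) ∞ (fun x => l (f x)) s) ↔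
      ContMDiffOn I 𝓘(ℝ, A) ∞ f s := by
  constructor
  · intro h
    let b := Module.finBasis ℝ A
    have h1 : ContMDiffOn I 𝓘(ℝ, Fin (Module.finrank ℝ A) → ℝ) ∞
        (fun x => b.equivFunL (f x)) s := contMDiffOn_pi_space.2 fun i => h (b.coord i)
    refine (b.equivFunL.symm.contDiff.contMDiff.comp_contMDiffOn h1).congr fun x _ => ?_
    exact (b.equivFunL.symm_apply_apply (f x)).symm
  · intro h l
    exact (LinearMap.toContinuousLinearMap l).contDiff.contMDiff.comp_contMDiffOn h

theorem hasDerivAt_iff_linear {f : ℝ → A} {f' : A} {t : ℝ} :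
    (∀ l : A →ₗ[ℝ] ℝ, HasDerivAt (fun τ => l (f τ)) (l f') t) ↔ HasDerivAt f f' t := by
  constructor
  · intro h
    let b := Module.finBasis ℝ A
    have h1 : HasDerivAt (fun τ => b.equivFunL (f τ)) (b.equivFunL f') t :=
      hasDerivAt_pi.2 fun i => h (b.coord i)
    have h2 := (b.equivFunL.symm.hasFDerivAt).comp_hasDerivAt t h1
    simpa [Function.comp_def] using h2
  · intro h l
    exact (LinearMap.toContinuousLinearMap l).hasFDerivAt.comp_hasDerivAt t h

end FiniteDimensional

section Supermanifold

variable {P : Type u} [Ring P] [Algebra ℝ P] [FiniteDimensional ℝ P]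
  {𝒜 : ZMod 2 → Submodule ℝ P} [GradedAlgebra 𝒜] {m n : ℕ}
variable {M : Type v} [TopologicalSpace M] [ChartedSpace (EuclideanSpace ℝ (Fin m)) M]
variable {O : SuperSheaf.{u, v, w} 𝒜 M} {U : Opens M}

/-! ### Coordinates of sections -/

theorem coord_add (φ : Trivialization m n O U) {W : Opens M} (f g : O.obj W) {x : M} (hx : x ∈ W) :
    coord φ (f + g) x = coord φ f x + coord φ g x := by
  by_cases hU : x ∈ U
  · simp only [coord_of_mem φ _ hU hx, map_add]
  · simp [coord, hU]

theorem coord_mul (φ : Trivialization m n O U) {W : Opens M} (f g : O.obj W) {x : M} (hx : x ∈ W) :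
    coord φ (f * g) x = coord φ f x * coord φ g x := by
  by_cases hU : x ∈ U
  · simp only [coord_of_mem φ _ hU hx, map_mul]
  · simp [coord, hU]

theorem coord_eq_equiv (φ : Trivialization m n O U) {W : Opens M} (hW : W ≤ U) (f : O.obj W)
    {x : M} (hx : x ∈ W) : coord φ f x = (φ.equiv W hW f).1 ⟨x, hx⟩ := by
  rw [coord_of_mem φ f (hW hx) hx]
  have e := φ.equiv_res (inf_le_right : U ⊓ W ≤ W) hW f
  exact congrFun (congrArg Subtype.val e) ⟨x, hW hx, hx⟩

theorem contMDiffOn_coord (φ : Trivialization m n O U) {W : Opens M} (f : O.obj W) :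
    ContMDiffOn (𝓡 m) 𝓘(ℝ, Coeff 𝒜 n) ∞ (coord φ f) {x | x ∈ U ∧ x ∈ W} := by
  rw [← contMDiffOn_iff_linear]
  intro l x hx
  refine ContMDiffAt.contMDiffWithinAt ?_
  have h := (φ.equiv (U ⊓ W) inf_le_left (O.res inf_le_right f)).2 l ⟨x, hx⟩
  refine (contMDiffAt_subtype_iff (U := U ⊓ W) (x := ⟨x, hx⟩)
    (f := fun y => l (coord φ f y))).1 (h.congr_of_eventuallyEq (Eventually.of_forall ?_))
  intro y
  change l (coord φ f y.1) = _
  rw [coord_of_mem φ f y.2.1 y.2.2]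
  rfl

theorem eq_of_coord (φ : Trivialization m n O U) {W : Opens M} (hW : W ≤ U) {f g : O.obj W}
    (h : ∀ x ∈ W, coord φ f x = coord φ g x) : f = g := by
  apply (φ.equiv W hW).injective
  refine Subtype.ext (funext fun x => ?_)
  rw [← coord_eq_equiv φ hW f x.2, ← coord_eq_equiv φ hW g x.2, h x.1 x.2]

/-- Sections with equal coordinates in a cover by trivializations agree. -/
theorem section_ext {W : Opens M} {f g : O.obj W}
    (h : ∀ x ∈ W, ∃ (U : Opens M) (φ : Trivialization m n O U), x ∈ U ∧
      ∀ y ∈ W, y ∈ U → coord φ f y = coord φ g y) : f = g := by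
  choose U φ hU hφ using fun x : W => h x.1 x.2
  have hle : ∀ x : W, W ⊓ U x ≤ W := fun x => inf_le_left
  have hcov : W ≤ ⨆ x : W, W ⊓ U x := fun x hx => Opens.mem_iSup.2 ⟨⟨x, hx⟩, hx, hU ⟨x, hx⟩⟩
  obtain ⟨k, _, huniq⟩ := O.glue W (fun x : W => W ⊓ U x) hle hcov (fun x => O.res (hle x) f)
    (fun i j => by rw [O.res_res, O.res_res])
  refine (huniq f fun _ => rfl).trans (huniq g fun x => ?_).symm
  refine eq_of_coord (φ x) inf_le_right fun y hy => ?_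
  rw [coord_res _ _ _ hy, coord_res _ _ _ hy, hφ x y hy.1 hy.2]

/-! ### Supercharts -/

variable (m n O) in
/-- A trivialization over the domain of a chart. -/
structure SuperChart where
  U : Opens M
  triv : Trivialization m n O U
  chart : OpenPartialHomeomorph M (EuclideanSpace ℝ (Fin m))
  mem_atlas : chart ∈ IsManifold.maximalAtlas (𝓡 m) ∞ M
  source_eq : chart.source = U

/-- Restriction of a local isomorphism to a smaller open set. -/
def LocalIso.restrict {X : Type v} [TopologicalSpace X] {O : SuperSheaf.{u, v, w} 𝒜 X}
    {O' : SuperSheaf.{u, v, w'} 𝒜 X} {U V : Opens X} (φ : LocalIso O O' U) (h : V ≤ U) :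
    LocalIso O O' V where
  equiv W hW := φ.equiv W (hW.trans h)
  equiv_mem W hW := φ.equiv_mem W (hW.trans h)
  equiv_scalar W hW := φ.equiv_scalar W (hW.trans h)
  equiv_res hW hW' := φ.equiv_res hW (hW'.trans h)

/-- The chart domain at x is intersected with a trivializing open set; a restricted chart stays in
the maximal atlas. -/
theorem exists_superChart [IsManifold (𝓡 m) ∞ M] (hO : IsSupermanifold m n O) (x : M) :
    ∃ C : SuperChart m n O, x ∈ C.U := by
  obtain ⟨U, hx, ⟨φ⟩⟩ := hO x
  let c := chartAt (EuclideanSpace ℝ (Fin m)) x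
  let V : Opens M := ⟨c.source, c.open_source⟩
  refine ⟨⟨V ⊓ U, φ.restrict inf_le_right, c.restr U, ?_, ?_⟩, mem_chart_source _ x, hx⟩
  · exact restr_mem_maximalAtlas (contDiffGroupoid ∞ (𝓡 m)) (IsManifold.chart_mem_maximalAtlas x)
      U.isOpen
  · rw [c.restr_source, U.isOpen.interior_eq]; rfl

namespace SuperChart

variable (C : SuperChart m n O)

theorem mem_source {x : M} (hx : x ∈ C.U) : x ∈ C.chart.source := C.source_eq ▸ hx

theorem symm_mem {e : EuclideanSpace ℝ (Fin m)} (he : e ∈ C.chart.target) :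
    C.chart.symm e ∈ C.U := by
  have := C.chart.map_target he
  rwa [C.source_eq] at this

theorem map_mem {x : M} (hx : x ∈ C.U) : C.chart x ∈ C.chart.target :=
  C.chart.map_source (C.mem_source hx)

theorem left_inv {x : M} (hx : x ∈ C.U) : C.chart.symm (C.chart x) = x :=
  C.chart.left_inv (C.mem_source hx)

theorem contMDiffOn_chart : ContMDiffOn (𝓡 m) (𝓡 m) ∞ C.chart C.U := by
  have := contMDiffOn_of_mem_maximalAtlas C.mem_atlas
  rwa [C.source_eq] at this

theorem contMDiffAt_chart {x : M} (hx : x ∈ C.U) : ContMDiffAt (𝓡 m) (𝓡 m) ∞ C.chart x :=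
  C.contMDiffOn_chart.contMDiffAt (C.U.isOpen.mem_nhds hx)

theorem contMDiffAt_symm {e : EuclideanSpace ℝ (Fin m)} (he : e ∈ C.chart.target) :
    ContMDiffAt (𝓡 m) (𝓡 m) ∞ C.chart.symm e :=
  (contMDiffOn_symm_of_mem_maximalAtlas C.mem_atlas).contMDiffAt
    (C.chart.open_target.mem_nhds he)

/-- The coordinate expression of a section. -/
def loc {V : Opens M} (f : O.obj V) (e : EuclideanSpace ℝ (Fin m)) : Coeff 𝒜 n :=
  coord C.triv f (C.chart.symm e)

theorem loc_chart {V : Opens M} (f : O.obj V) {x : M} (hx : x ∈ C.U) :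
    C.loc f (C.chart x) = coord C.triv f x := by
  rw [loc, C.left_inv hx]

theorem eventually_symm_mem {e : EuclideanSpace ℝ (Fin m)} (he : e ∈ C.chart.target)
    {V : Opens M} (hV : C.chart.symm e ∈ V) :
    ∀ᶠ e' in 𝓝 e, e' ∈ C.chart.target ∧ C.chart.symm e' ∈ V :=
  (C.chart.open_target.mem_nhds he |> fun h => h : ∀ᶠ e' in 𝓝 e, e' ∈ C.chart.target).and
    ((C.chart.continuousAt_symm he).eventually (V.isOpen.mem_nhds hV))

theorem smoothNear_loc {e : EuclideanSpace ℝ (Fin m)} (he : e ∈ C.chart.target)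
    {V : Opens M} (hV : C.chart.symm e ∈ V) (f : O.obj V) : SmoothNear (C.loc f) e := by
  filter_upwards [C.eventually_symm_mem he hV] with e' he'
  have h1 : ContMDiffAt (𝓡 m) 𝓘(ℝ, Coeff 𝒜 n) ∞ (coord C.triv f) (C.chart.symm e') :=
    (contMDiffOn_coord C.triv f).contMDiffAt
      ((C.U ⊓ V).isOpen.mem_nhds ⟨C.symm_mem he'.1, he'.2⟩)
  exact (h1.comp e' (C.contMDiffAt_symm he'.1)).contDiffAt

variable {C}

/-- The open set on which a given function of the coordinates is smooth. -/
def dom (C : SuperChart m n O) (F : EuclideanSpace ℝ (Fin m) → Coeff 𝒜 n) : Opens M :=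
  ⟨C.chart.source ∩ C.chart ⁻¹' interior {e | ContDiffAt ℝ ∞ F e},
    C.chart.isOpen_inter_preimage isOpen_interior⟩

theorem dom_le (F : EuclideanSpace ℝ (Fin m) → Coeff 𝒜 n) : C.dom F ≤ C.U := fun x hx => by
  have := hx.1
  rwa [C.source_eq] at this

theorem mem_dom {F : EuclideanSpace ℝ (Fin m) → Coeff 𝒜 n} {x : M} (hx : x ∈ C.U) :
    x ∈ C.dom F ↔ SmoothNear F (C.chart x) :=
  ⟨fun h => mem_interior_iff_mem_nhds.1 h.2,
    fun h => ⟨C.mem_source hx, mem_interior_iff_mem_nhds.2 h⟩⟩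

theorem contDiffAt_of_mem_dom {F : EuclideanSpace ℝ (Fin m) → Coeff 𝒜 n} {x : M}
    (hx : x ∈ C.dom F) : ContDiffAt ℝ ∞ F (C.chart x) := interior_subset hx.2

/-- The section with a given coordinate expression. -/
def sec (C : SuperChart m n O) (F : EuclideanSpace ℝ (Fin m) → Coeff 𝒜 n) : O.obj (C.dom F) :=
  (C.triv.equiv (C.dom F) (dom_le F)).symm ⟨fun x => F (C.chart x), fun l x => by
    refine (contMDiffAt_subtype_iff (U := C.dom F) (x := x)
      (f := fun y => l (F (C.chart y)))).2 ?_
    have h1 : ContMDiffAt (𝓡 m) 𝓘(ℝ, Coeff 𝒜 n) ∞ F (C.chart x.1) :=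
      (contDiffAt_of_mem_dom x.2).contMDiffAt
    have h2 := h1.comp x.1 (C.contMDiffAt_chart (dom_le F x.2))
    exact (LinearMap.toContinuousLinearMap l).contDiff.contMDiff.contMDiffAt.comp x.1 h2⟩

theorem coord_sec (F : EuclideanSpace ℝ (Fin m) → Coeff 𝒜 n) {x : M} (hx : x ∈ C.dom F) :
    coord C.triv (C.sec F) x = F (C.chart x) := by
  rw [coord_eq_equiv C.triv (dom_le F) _ hx]
  exact congrFun (congrArg Subtype.val
    (AlgEquiv.apply_symm_apply (C.triv.equiv (C.dom F) (dom_le F)) _)) ⟨x, hx⟩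

theorem loc_sec_eventuallyEq {F : EuclideanSpace ℝ (Fin m) → Coeff 𝒜 n}
    {e : EuclideanSpace ℝ (Fin m)} (he : e ∈ C.chart.target) (hF : SmoothNear F e) :
    C.loc (C.sec F) =ᶠ[𝓝 e] F := by
  have h1 : C.chart.symm e ∈ C.dom F :=
    (mem_dom (C.symm_mem he)).2 (by rwa [C.chart.right_inv he])
  filter_upwards [C.eventually_symm_mem he h1] with e' he'
  rw [loc, coord_sec F he'.2, C.chart.right_inv he'.1]

end SuperChart

/-! ### Points of a supermanifold with values in `P ⊠ Λℝⁿ` -/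

variable (n) in
/-- `k` is a `P`-linear parity preserving local homomorphism from germs of sections at `y` to
the coefficient algebra `P ⊠ Λℝⁿ`. -/
structure IsPoint (y : M) (k : ∀ V : Opens M, O.obj V → Coeff 𝒜 n) : Prop where
  add : ∀ V, y ∈ V → ∀ f g, k V (f + g) = k V f + k V g
  mul : ∀ V, y ∈ V → ∀ f g, k V (f * g) = k V f * k V g
  scalar : ∀ V, y ∈ V → ∀ a, k V (O.scalar V a) =
    GradedTensorProduct.includeLeft 𝒜 (extParity n) a
  mem : ∀ V, y ∈ V → ∀ i, ∀ f ∈ O.gr V i, k V f ∈ coeffGr 𝒜 n i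
  res : ∀ {V W : Opens M} (h : V ≤ W) (f : O.obj W), y ∈ V → k V (O.res h f) = k W f

/-- Values in P ⊠ Λℝⁿ keep the odd coordinates, so this one point carries the full coefficient of a
section at x. Read in a superchart with another trivialization, it encodes the change of
trivialization. -/
theorem isPoint_coord (φ : Trivialization m n O U) {x : M} (hx : x ∈ U) :
    IsPoint n x (fun V (f : O.obj V) => coord φ f x) where
  add _ hV f g := coord_add φ f g hV
  mul _ hV f g := coord_mul φ f g hV
  scalar _ hV a := coord_scalar φ a hx hV
  mem _ _ i _ hf := coord_gr φ i hf x
  res h f hV := coord_res φ h f hV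

variable {y : M} {k : ∀ V : Opens M, O.obj V → Coeff 𝒜 n}

/-- Sections with equal coordinates near y agree on a smaller open set, and k does not see
restriction. -/
theorem IsPoint.congr (hk : IsPoint n y k) (φ : Trivialization m n O U) (hy : y ∈ U)
    {V W : Opens M} (hV : y ∈ V) (hW : y ∈ W) {f : O.obj V} {g : O.obj W}
    (h : coord φ f =ᶠ[𝓝 y] coord φ g) : k V f = k W g := by
  obtain ⟨T, hT, hTo, hyT⟩ := eventually_nhds_iff.1 h
  let T' : Opens M := ⟨T, hTo⟩ ⊓ (U ⊓ (V ⊓ W))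
  have hy' : y ∈ T' := ⟨hyT, hy, hV, hW⟩
  have h1 : T' ≤ V := fun x hx => hx.2.2.1
  have h2 : T' ≤ W := fun x hx => hx.2.2.2
  rw [← hk.res h1 f hy', ← hk.res h2 g hy']
  congr 1
  refine eq_of_coord φ (show T' ≤ U from fun x hx => hx.2.1) fun x hx => ?_
  rw [coord_res _ _ _ hx, coord_res _ _ _ hx, hT x hx.1]

end Supermanifold

open Filter Topology

/-! ### Points over a superchart as Taylor evaluations. -/

section Points

variable {P : Type u} [Ring P] [Algebra ℝ P] [FiniteDimensional ℝ P]
  {𝒜 : ZMod 2 → Submodule ℝ P} [GradedAlgebra 𝒜] {m n : ℕ}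
variable {M : Type v} [TopologicalSpace M] [ChartedSpace (EuclideanSpace ℝ (Fin m)) M]
variable {O : SuperSheaf.{u, v, w} 𝒜 M} {U : Opens M}
variable {aug : P →ₐ[ℝ] ℝ} (hP : IsSmall 𝒜 aug)

open SuperWeil

namespace SuperChart

theorem mem_dom_of_contDiff {C : SuperChart m n O} {F : EuclideanSpace ℝ (Fin m) → Coeff 𝒜 n}
    (hF : ContDiff ℝ ∞ F) {x : M} (hx : x ∈ C.U) : x ∈ C.dom F :=
  (mem_dom hx).2 (.of_contDiff hF _)

/-- The even coordinate sections. -/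
def evenSec (C : SuperChart m n O) (i : Fin m) : O.obj (C.dom (coordFun (Coeff 𝒜 n) i)) :=
  C.sec (coordFun (Coeff 𝒜 n) i)

/-- The odd coordinate sections. -/
def oddSec (C : SuperChart m n O) (j : Fin n) :
    O.obj (C.dom fun _ => (oddCoord 𝒜 n j : Coeff 𝒜 n)) :=
  C.sec fun _ => (oddCoord 𝒜 n j : Coeff 𝒜 n)

theorem mem_dom_even {C : SuperChart m n O} (i : Fin m) {x : M} (hx : x ∈ C.U) :
    x ∈ C.dom (coordFun (Coeff 𝒜 n) i) :=
  mem_dom_of_contDiff (contDiff_coordFun i) hx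

theorem mem_dom_odd {C : SuperChart m n O} (j : Fin n) {x : M} (hx : x ∈ C.U) :
    x ∈ C.dom fun _ => (oddCoord 𝒜 n j : Coeff 𝒜 n) :=
  mem_dom_of_contDiff (contDiff_const (c := (oddCoord 𝒜 n j : Coeff 𝒜 n))) hx

theorem coord_sec_eventuallyEq {C : SuperChart m n O}
    {F : EuclideanSpace ℝ (Fin m) → Coeff 𝒜 n} {x : M} (hx : x ∈ C.U)
    (hF : SmoothNear F (C.chart x)) :
    coord C.triv (C.sec F) =ᶠ[𝓝 x] fun y => F (C.chart y) := by
  filter_upwards [(C.dom F).isOpen.mem_nhds ((mem_dom hx).2 hF)] with y hy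
  exact coord_sec F hy

end SuperChart

variable {y : M} {k : ∀ V : Opens M, O.obj V → Coeff 𝒜 n}

theorem IsPoint.sec_congr (hk : IsPoint n y k) {C : SuperChart m n O} (hy : y ∈ C.U)
    {F : EuclideanSpace ℝ (Fin m) → Coeff 𝒜 n} (hF : SmoothNear F (C.chart y)) {V : Opens M}
    (hV : y ∈ V) (f : O.obj V) (h : ∀ᶠ x in 𝓝 y, coord C.triv f x = F (C.chart x)) :
    k (C.dom F) (C.sec F) = k V f :=
  hk.congr C.triv hy ((SuperChart.mem_dom hy).2 hF) hV
    ((SuperChart.coord_sec_eventuallyEq hy hF).trans (h.mono fun _ hx => hx.symm))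

omit [FiniteDimensional ℝ P] in
theorem IsPoint.map_algebraMap (hk : IsPoint n y k) {V : Opens M} (hV : y ∈ V) (r : ℝ) :
    k V (algebraMap ℝ _ r) = algebraMap ℝ _ r := by
  rw [← AlgHom.commutes (O.scalar V), hk.scalar V hV, AlgHom.commutes]

theorem IsPoint.sec_add (hk : IsPoint n y k) {C : SuperChart m n O} (hy : y ∈ C.U)
    {F G : EuclideanSpace ℝ (Fin m) → Coeff 𝒜 n} (hF : SmoothNear F (C.chart y))
    (hG : SmoothNear G (C.chart y)) :
    k (C.dom fun x => F x + G x) (C.sec fun x => F x + G x) =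
      k (C.dom F) (C.sec F) + k (C.dom G) (C.sec G) := by
  have h1 := (SuperChart.mem_dom hy).2 hF
  have h2 := (SuperChart.mem_dom hy).2 hG
  have h : y ∈ C.dom F ⊓ C.dom G := ⟨h1, h2⟩
  rw [hk.sec_congr hy (hF.add hG) h (O.res inf_le_left (C.sec F) + O.res inf_le_right (C.sec G)),
    hk.add _ h, hk.res _ _ h, hk.res _ _ h]
  filter_upwards [(C.dom F ⊓ C.dom G).isOpen.mem_nhds h] with x hx
  rw [coord_add _ _ _ hx, coord_res _ _ _ hx, coord_res _ _ _ hx, SuperChart.coord_sec _ hx.1,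
    SuperChart.coord_sec _ hx.2]

theorem IsPoint.sec_mul (hk : IsPoint n y k) {C : SuperChart m n O} (hy : y ∈ C.U)
    {F G : EuclideanSpace ℝ (Fin m) → Coeff 𝒜 n} (hF : SmoothNear F (C.chart y))
    (hG : SmoothNear G (C.chart y)) :
    k (C.dom fun x => F x * G x) (C.sec fun x => F x * G x) =
      k (C.dom F) (C.sec F) * k (C.dom G) (C.sec G) := by
  have h1 := (SuperChart.mem_dom hy).2 hF
  have h2 := (SuperChart.mem_dom hy).2 hG
  have h : y ∈ C.dom F ⊓ C.dom G := ⟨h1, h2⟩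
  rw [hk.sec_congr hy (hF.mul hG) h (O.res inf_le_left (C.sec F) * O.res inf_le_right (C.sec G)),
    hk.mul _ h, hk.res _ _ h, hk.res _ _ h]
  filter_upwards [(C.dom F ⊓ C.dom G).isOpen.mem_nhds h] with x hx
  rw [coord_mul _ _ _ hx, coord_res _ _ _ hx, coord_res _ _ _ hx, SuperChart.coord_sec _ hx.1,
    SuperChart.coord_sec _ hx.2]

/-- The component of the opposite parity has coordinates in both parity subspaces, so it vanishes.
-/
theorem SuperChart.sec_mem {C : SuperChart m n O} {i : ZMod 2}
    {F : EuclideanSpace ℝ (Fin m) → Coeff 𝒜 n} {V : Opens M} (hVF : V ≤ C.dom F)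
    (h : ∀ x ∈ V, F (C.chart x) ∈ coeffGr 𝒜 n i) : O.res hVF (C.sec F) ∈ O.gr V i := by
  set f := O.res hVF (C.sec F)
  have hVU : V ≤ C.U := hVF.trans (SuperChart.dom_le F)
  have hf : ∀ x ∈ V, coord C.triv f x ∈ coeffGr 𝒜 n i := fun x hx => by
    rw [coord_res _ _ _ hx, SuperChart.coord_sec _ (hVF hx)]; exact h x hx
  have hsup : f ∈ O.gr V 0 ⊔ O.gr V 1 := by rw [(O.isCompl V).sup_eq_top]; trivial
  obtain ⟨a, ha, b, hb, hab⟩ := Submodule.mem_sup.1 hsup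
  have hd := Submodule.disjoint_def.1 (coeffGr_isCompl 𝒜 n).disjoint
  rcases zmod_two_cases i with rfl | rfl
  · have : b = 0 := eq_of_coord C.triv hVU fun x hx => by
      have h0 : coord C.triv b x ∈ coeffGr 𝒜 n 0 := by
        have e : coord C.triv b x = coord C.triv f x - coord C.triv a x := by
          rw [← hab, coord_add _ _ _ hx, add_sub_cancel_left]
        rw [e]; exact sub_mem (hf x hx) (coord_gr _ _ ha x)
      rw [hd _ h0 (coord_gr _ _ hb x), coord_of_mem _ _ (hVU hx) hx, map_zero]
    rw [this, add_zero] at hab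
    rwa [← hab]
  · have : a = 0 := eq_of_coord C.triv hVU fun x hx => by
      have h0 : coord C.triv a x ∈ coeffGr 𝒜 n 1 := by
        have e : coord C.triv a x = coord C.triv f x - coord C.triv b x := by
          rw [← hab, coord_add _ _ _ hx, add_sub_cancel_right]
        rw [e]; exact sub_mem (hf x hx) (coord_gr _ _ hb x)
      rw [hd _ (coord_gr _ _ ha x) h0, coord_of_mem _ _ (hVU hx) hx, map_zero]
    rw [this, zero_add] at hab
    rwa [← hab]

/-- Over a superchart, sections are functions of the coordinates, and the algebraic properties are
transported. Only the last field needs an argument: the body of the point is its position in the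
chart. -/
theorem IsPoint.isGermHom (hk : IsPoint n y k) {C : SuperChart m n O} (hy : y ∈ C.U) :
    (coeffWeil hP n).IsGermHom (C.chart y) (fun F => k (C.dom F) (C.sec F)) where
  add F G hF hG := hk.sec_add hy hF hG
  mul F G hF hG := hk.sec_mul hy hF hG
  congr F G hF h := by
    have hG : SmoothNear G (C.chart y) := hF.congr h.symm
    refine hk.sec_congr hy hF ((SuperChart.mem_dom hy).2 hG) _ ?_
    filter_upwards [SuperChart.coord_sec_eventuallyEq hy hG,
      (C.contMDiffAt_chart hy).continuousAt.eventually h] with x hx hx'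
    rw [hx, hx']
  scal := by
    rintro _ ⟨a, rfl⟩
    refine (hk.sec_congr hy (.const _ _) hy (O.scalar C.U a) ?_).trans (hk.scalar _ hy a)
    filter_upwards [C.U.isOpen.mem_nhds hy] with x hx
    exact coord_scalar _ _ hx hx
  mem i F hF h := by
    obtain ⟨T, hT, hTo, hyT⟩ :=
      eventually_nhds_iff.1 ((C.contMDiffAt_chart hy).continuousAt.eventually h)
    let V : Opens M := ⟨T, hTo⟩ ⊓ C.dom F
    have hV : y ∈ V := ⟨hyT, (SuperChart.mem_dom hy).2 hF⟩
    have hle : V ≤ C.dom F := inf_le_right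
    rw [← hk.res hle (C.sec F) hV]
    exact hk.mem V hV i _ (SuperChart.sec_mem hle fun x hx => hT x hx.1)
  body_coord i := by
    set B := coeffBodyHom hP n with hB
    change B (k _ (C.sec (coordFun (Coeff 𝒜 n) i))) = _
    set c := B (k _ (C.sec (coordFun (Coeff 𝒜 n) i))) with hc
    -- If the body c of the image of xᵢ differed from the i-th coordinate of y, then xᵢ - c would be
    -- invertible near y, although its image has body 0; this contradicts that 1 is sent to 1.
    by_contra hne
    have hA : ∀ a : ℝ, SmoothNear (fun _ : EuclideanSpace ℝ (Fin m) =>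
        algebraMap ℝ (Coeff 𝒜 n) a) (C.chart y) := fun a => .const _ _
    have hx : SmoothNear (fun x => coordFun (Coeff 𝒜 n) i x + algebraMap ℝ _ (-c)) (C.chart y) :=
      (smoothNear_coordFun i _).add (hA _)
    have hne' : ∀ᶠ x : EuclideanSpace ℝ (Fin m) in 𝓝 (C.chart y), x i - c ≠ 0 := by
      have : Continuous fun x : EuclideanSpace ℝ (Fin m) => x i - c := by fun_prop
      exact this.continuousAt.eventually_ne (sub_ne_zero.2 (Ne.symm hne))
    have hG : SmoothNear (fun x => algebraMap ℝ (Coeff 𝒜 n) ((x i - c)⁻¹)) (C.chart y) := by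
      filter_upwards [hne'] with x hx
      have h1 : ContDiff ℝ ∞ fun x : EuclideanSpace ℝ (Fin m) => x i - c := by fun_prop
      exact (algebraMapCLM ℝ (Coeff 𝒜 n)).contDiff.contDiffAt.comp x (h1.contDiffAt.inv hx)
    have e1 := hk.sec_mul hy hx hG
    have e2 : k _ (C.sec fun x => coordFun (Coeff 𝒜 n) i x + algebraMap ℝ _ (-c)) =
        k _ (C.sec (coordFun (Coeff 𝒜 n) i)) + algebraMap ℝ _ (-c) := by
      rw [hk.sec_add hy (smoothNear_coordFun i _) (hA _)]
      congr 1
      refine (hk.sec_congr hy (hA _) hy (algebraMap ℝ (O.obj C.U) (-c)) ?_).trans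
        (hk.map_algebraMap hy _)
      filter_upwards [C.U.isOpen.mem_nhds hy] with x hx
      rw [coord_of_mem _ _ hx hx, AlgHom.commutes]
    have e3 : k _ (C.sec fun x => (coordFun (Coeff 𝒜 n) i x + algebraMap ℝ _ (-c)) *
        algebraMap ℝ _ ((x i - c)⁻¹)) = 1 := by
      have h1 := hk.map_algebraMap hy 1
      rw [map_one, map_one] at h1
      refine (hk.sec_congr hy (hx.mul hG) hy (1 : O.obj C.U) ?_).trans h1
      filter_upwards [C.U.isOpen.mem_nhds hy,
        (C.contMDiffAt_chart hy).continuousAt.eventually hne'] with x hx hx'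
      rw [coord_of_mem _ _ hx hx, map_one, coordFun, ← map_add, ← map_mul, ← sub_eq_add_neg,
        mul_inv_cancel₀ hx', map_one]
    rw [e2, e3] at e1
    have e4 := congrArg B e1
    rw [map_one, map_mul, map_add, ← hc, AlgHom.commutes] at e4
    simp at e4

namespace SuperChart

variable (C : SuperChart m n O)

/-- The coordinates of a point in a superchart. -/
def ptOf (k : ∀ V : Opens M, O.obj V → Coeff 𝒜 n) : (coeffWeil hP n).Pt m :=
  (coeffWeil hP n).mkPt (fun i => k _ (C.evenSec i)) fun j => k _ (C.oddSec j)

end SuperChart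

variable {C : SuperChart m n O}

theorem IsPoint.ptOf_eq (hk : IsPoint n y k) (hy : y ∈ C.U) :
    C.ptOf hP k = (hk.isGermHom hP hy).pt :=
  Prod.ext (funext fun _ => evenProj_of_mem _) (funext fun _ => oddProj_of_mem _)

theorem IsPoint.base_ptOf (hk : IsPoint n y k) (hy : y ∈ C.U) :
    (C.ptOf hP k).base = C.chart y := by
  rw [hk.ptOf_eq hP hy, IsGermHom.base_pt]

/-- Combines the transfer to germs with `IsGermHom.eq_nilEval`. Homomorphisms on
infinite-dimensional algebras of sections become vectors in a finite-dimensional space, which turns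
the flow equation into an ordinary one. -/
theorem IsPoint.eq_nilEval (hk : IsPoint n y k) (hy : y ∈ C.U) {V : Opens M} (hV : y ∈ V)
    (f : O.obj V) : k V f = nilEval (C.ptOf hP k) (C.loc f) := by
  have hs : SmoothNear (C.loc f) (C.chart y) :=
    C.smoothNear_loc (C.map_mem hy) (by rwa [C.left_inv hy]) f
  rw [hk.ptOf_eq hP hy, ← (hk.isGermHom hP hy).eq_nilEval hs]
  refine (hk.sec_congr hy hs hV f ?_).symm
  filter_upwards [C.U.isOpen.mem_nhds hy] with x hx
  rw [C.loc_chart f hx]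

theorem loc_add {V : Opens M} (f g : O.obj V) {e : EuclideanSpace ℝ (Fin m)}
    (he : C.chart.symm e ∈ V) : C.loc (f + g) e = C.loc f e + C.loc g e := coord_add _ _ _ he

theorem loc_mul {V : Opens M} (f g : O.obj V) {e : EuclideanSpace ℝ (Fin m)}
    (he : C.chart.symm e ∈ V) : C.loc (f * g) e = C.loc f e * C.loc g e := coord_mul _ _ _ he

/-- The converse passage: a germ homomorphism, such as a Taylor evaluation, acts on sections through
their coordinate expressions. -/
theorem isPoint_of_isGermHom {e : EuclideanSpace ℝ (Fin m)} (he : e ∈ C.chart.target)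
    {K : (EuclideanSpace ℝ (Fin m) → Coeff 𝒜 n) → Coeff 𝒜 n}
    (hK : (coeffWeil hP n).IsGermHom e K) :
    IsPoint n (C.chart.symm e) (fun V (f : O.obj V) => K (C.loc f)) where
  add V hV f g := by
    have h1 := C.smoothNear_loc he hV f
    have h2 := C.smoothNear_loc he hV g
    rw [← hK.add _ _ h1 h2]
    refine hK.congr _ _ (C.smoothNear_loc he hV _) ?_
    filter_upwards [C.eventually_symm_mem he hV] with e' he'
    exact loc_add f g he'.2
  mul V hV f g := by
    have h1 := C.smoothNear_loc he hV f
    have h2 := C.smoothNear_loc he hV g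
    rw [← hK.mul _ _ h1 h2]
    refine hK.congr _ _ (C.smoothNear_loc he hV _) ?_
    filter_upwards [C.eventually_symm_mem he hV] with e' he'
    exact loc_mul f g he'.2
  scalar V hV a := by
    refine Eq.trans (hK.congr _ _ (C.smoothNear_loc he hV _) ?_) (hK.scal _ ⟨a, rfl⟩)
    filter_upwards [C.eventually_symm_mem he hV] with e' he'
    exact coord_scalar _ _ (C.symm_mem he'.1) he'.2
  mem V hV i f hf := hK.mem i _ (C.smoothNear_loc he hV _)
    (Eventually.of_forall fun _ => coord_gr _ _ hf _)
  res {V W} h f hV := by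
    refine hK.congr _ _ (C.smoothNear_loc he hV _) ?_
    filter_upwards [C.eventually_symm_mem he hV] with e' he'
    exact coord_res _ _ _ he'.2

theorem isPoint_nilEval {p : (coeffWeil hP n).Pt m} (hp : p.base ∈ C.chart.target) :
    IsPoint n (C.chart.symm p.base) (fun V (f : O.obj V) => nilEval p (C.loc f)) :=
  isPoint_of_isGermHom hP hp (isGermHom_nilEval p)

theorem nilEval_loc_sec {p : (coeffWeil hP n).Pt m} (hp : p.base ∈ C.chart.target)
    {F : EuclideanSpace ℝ (Fin m) → Coeff 𝒜 n} (hF : SmoothNear F p.base) :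
    nilEval p (C.loc (C.sec F)) = nilEval p F :=
  nilEval_congr p (C.loc_sec_eventuallyEq hp hF)

/-- The body of the value of a section at a point is the body of the section. -/
theorem IsPoint.body_eq (hk : IsPoint n y k) (hy : y ∈ C.U) {V : Opens M} (hV : y ∈ V)
    (f : O.obj V) : coeffBodyHom hP n (k V f) = coeffBodyHom hP n (coord C.triv f y) := by
  rw [hk.eq_nilEval hP hy hV f]
  refine (body_nilEval (C.ptOf hP k) (C.loc f)).trans ?_
  rw [hk.base_ptOf hP hy, C.loc_chart f hy]
  rfl

end Points

open Filter Topology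

/-! ### Differentiation in a parameter commutes with evaluation -/

section Parameter

variable {A : Type u} [NormedRing A] [NormedAlgebra ℝ A] {m n : ℕ}

/-- Time and space derivatives commute by symmetry of the second derivative. -/
theorem nilDeriv_hasDerivAt (ν : Fin m → A) {F F' : ℝ × EuclideanSpace ℝ (Fin m) → A}
    {q₀ : ℝ × EuclideanSpace ℝ (Fin m)} (hF : SmoothNear F q₀)
    (hF' : ∀ᶠ q in 𝓝 q₀, HasDerivAt (fun t => F (t, q.2)) (F' q) q.1) :
    ∀ᶠ q in 𝓝 q₀, HasDerivAt (fun t => nilDeriv ν (fun e => F (t, e)) q.2)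
      (nilDeriv ν (fun e => F' (q.1, e)) q.2) q.1 := by
  filter_upwards [hF.eventually_nhds, hF'.eventually_nhds] with q hq hq'
  have hd : ∀ᶠ r in 𝓝 q, DifferentiableAt ℝ F r := by
    filter_upwards [hq] with r hr using hr.differentiableAt (by simp)
  have hslice : ∀ᶠ r in 𝓝 q, ∀ v, fderiv ℝ (fun e => F (r.1, e)) r.2 v = fderiv ℝ F r (0, v) := by
    filter_upwards [hd] with r hr v
    have h1 := hr.hasFDerivAt.comp r.2 (hasFDerivAt_prodMk_right (𝕜 := ℝ) r.1 r.2)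
    have h2 : fderiv ℝ (fun e => F (r.1, e)) r.2 = _ := h1.fderiv
    rw [h2]; simp
  have hF1 : F' =ᶠ[𝓝 q] fun r => fderiv ℝ F r (1, 0) := by
    filter_upwards [hd, hq'] with r hr hr'
    have h1 := hr.hasFDerivAt.comp_hasDerivAt r.1
      ((hasDerivAt_id r.1).prodMk (hasDerivAt_const r.1 r.2))
    exact hr'.unique h1
  have hdd : DifferentiableAt ℝ (fderiv ℝ F) q :=
    (hq.self_of_nhds.fderiv_right (m := 1) (WithTop.coe_le_coe.2 le_top)).differentiableAt (by simp)
  have hsymm : IsSymmSndFDerivAt ℝ F q :=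
    hq.self_of_nhds.isSymmSndFDerivAt (by
      rw [minSmoothness_of_isRCLikeNormedField]; exact WithTop.coe_le_coe.2 le_top)
  have hline : Tendsto (fun t : ℝ => (t, q.2)) (𝓝 q.1) (𝓝 q) :=
    (Continuous.prodMk_left q.2).tendsto' _ _ rfl
  have hfib : Tendsto (fun e => (q.1, e)) (𝓝 q.2) (𝓝 q) :=
    (Continuous.prodMk_right q.1).tendsto' _ _ rfl
  have key : ∀ v, HasDerivAt (fun t => fderiv ℝ (fun e => F (t, e)) q.2 v)
      (fderiv ℝ (fun e => F' (q.1, e)) q.2 v) q.1 := by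
    intro v
    have h1 : HasDerivAt (fun t : ℝ => fderiv ℝ F (t, q.2) (0, v))
        (fderiv ℝ (fderiv ℝ F) q (1, 0) (0, v)) q.1 := by
      have h2 := hdd.hasFDerivAt.comp_hasDerivAt q.1
        ((hasDerivAt_id q.1).prodMk (hasDerivAt_const q.1 q.2))
      exact ((ContinuousLinearMap.apply ℝ A (0, v)).hasFDerivAt.comp_hasDerivAt q.1 h2)
    have h3 : fderiv ℝ (fun e => F' (q.1, e)) q.2 v = fderiv ℝ (fderiv ℝ F) q (0, v) (1, 0) := by
      have h4 : (fun e => F' (q.1, e)) =ᶠ[𝓝 q.2] fun e => fderiv ℝ F (q.1, e) (1, 0) :=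
        hfib.eventually hF1
      have h5 := hdd.hasFDerivAt.comp q.2 (hasFDerivAt_prodMk_right (𝕜 := ℝ) q.1 q.2)
      have h6 : HasFDerivAt (fun e => fderiv ℝ F (q.1, e) (1, 0)) _ q.2 :=
        (ContinuousLinearMap.apply ℝ A ((1 : ℝ), (0 : EuclideanSpace ℝ (Fin m)))).hasFDerivAt.comp
          q.2 h5
      rw [h4.fderiv_eq, h6.fderiv]; simp
    rw [h3, hsymm (0, v) (1, 0)]
    refine h1.congr_of_eventuallyEq ?_
    filter_upwards [hline.eventually hslice] with t ht using ht v
  exact HasDerivAt.fun_sum fun i _ => (key _).const_mul (ν i)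

theorem nilDeriv_iterate_hasDerivAt (ν : Fin m → A) (k : ℕ)
    {q₀ : ℝ × EuclideanSpace ℝ (Fin m)} : ∀ {F F' : ℝ × EuclideanSpace ℝ (Fin m) → A},
    SmoothNear F q₀ → (∀ᶠ q in 𝓝 q₀, HasDerivAt (fun t => F (t, q.2)) (F' q) q.1) →
    ∀ᶠ q in 𝓝 q₀, HasDerivAt (fun t => (nilDeriv ν)^[k] (fun e => F (t, e)) q.2)
      ((nilDeriv ν)^[k] (fun e => F' (q.1, e)) q.2) q.1 := by
  induction k with
  | zero => exact fun _ h => h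
  | succ k ih =>
    intro F F' hF hF'
    have h1 : SmoothNear (fun p : ℝ × EuclideanSpace ℝ (Fin m) =>
        nilDeriv ν (fun e => F (p.1, e)) p.2) q₀ :=
      nilDeriv_smoothNear (ν := fun _ => ν) (.const _ _) (q₀ := q₀.1) (y₀ := q₀.2) hF
    exact ih (F' := fun q => nilDeriv ν (fun e => F' (q.1, e)) q.2) h1
      (nilDeriv_hasDerivAt ν hF hF')

namespace SuperWeil

variable {S : SuperWeil A n} [FiniteDimensional ℝ A]

/-- The time derivative commutes with each Taylor term at the fixed point p. A family solving the
flow equation at real points can thus be evaluated at arbitrary points. -/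
theorem nilEval_hasDerivAt {p : S.Pt m} {t₀ : ℝ} {F F' : ℝ × EuclideanSpace ℝ (Fin m) → A}
    (hF : SmoothNear F (t₀, p.base))
    (hF' : ∀ᶠ q in 𝓝 (t₀, p.base), HasDerivAt (fun t => F (t, q.2)) (F' q) q.1) :
    HasDerivAt (fun t => nilEval p fun e => F (t, e)) (nilEval p fun e => F' (t₀, e)) t₀ := by
  refine HasDerivAt.fun_sum fun k _ => HasDerivAt.fun_const_smul _ ?_
  let L := LinearMap.toContinuousLinearMap (S.subst p.2).toLinearMap
  have h1 : SmoothNear (fun q => S.subst p.2 (F q)) (t₀, p.base) := hF.clm_comp L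
  refine (nilDeriv_iterate_hasDerivAt p.nilp k (F' := fun q => S.subst p.2 (F' q)) h1
    ?_).self_of_nhds
  filter_upwards [hF'] with q hq using L.hasFDerivAt.comp_hasDerivAt q.1 hq

end SuperWeil

end Parameter

section Flow

variable {P : Type u} [Ring P] [Algebra ℝ P] [FiniteDimensional ℝ P]
  {𝒜 : ZMod 2 → Submodule ℝ P} [GradedAlgebra 𝒜] {m n : ℕ}
variable {M : Type v} [TopologicalSpace M] [ChartedSpace (EuclideanSpace ℝ (Fin m)) M]
variable {O : SuperSheaf.{u, v, w} 𝒜 M} {U : Opens M}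
variable {aug : P →ₐ[ℝ] ℝ} (hP : IsSmall 𝒜 aug)
variable (X : EvenVectorField O)

open SuperWeil

/-! ### Even vector fields in coordinates -/

omit [FiniteDimensional ℝ P] [GradedAlgebra 𝒜] in
-- The Leibniz rule for 1 · 1 forces X 1 = 0, and P-linearity does the rest.
theorem EvenVectorField.app_scalar {V : Opens M} (a : P) : X.app V (O.scalar V a) = 0 := by
  have h1 := X.leibniz V 1 1
  rw [one_mul, mul_one, one_mul] at h1
  have h0 : X.app V 1 = 0 := by simpa using h1
  have := X.app_scalar_mul V a 1
  rwa [mul_one, h0, mul_zero] at this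

theorem EvenVectorField.coord_congr (φ : Trivialization m n O U) {V W : Opens M} {y : M}
    (hy : y ∈ U) (hV : y ∈ V) (hW : y ∈ W) {f : O.obj V} {g : O.obj W}
    (h : coord φ f =ᶠ[𝓝 y] coord φ g) :
    coord φ (X.app V f) =ᶠ[𝓝 y] coord φ (X.app W g) := by
  obtain ⟨T, hT, hTo, hyT⟩ := eventually_nhds_iff.1 h
  let T' : Opens M := ⟨T, hTo⟩ ⊓ (U ⊓ (V ⊓ W))
  have hy' : y ∈ T' := ⟨hyT, hy, hV, hW⟩
  have h1 : T' ≤ V := fun x hx => hx.2.2.1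
  have h2 : T' ≤ W := fun x hx => hx.2.2.2
  have e : O.res h1 f = O.res h2 g := by
    refine eq_of_coord φ (show T' ≤ U from fun x hx => hx.2.1) fun x hx => ?_
    rw [coord_res _ _ _ hx, coord_res _ _ _ hx, hT x hx.1]
  filter_upwards [T'.isOpen.mem_nhds hy'] with x hx
  rw [← coord_res φ h1 _ hx, ← coord_res φ h2 _ hx, ← X.app_res, ← X.app_res, e]

variable (C : SuperChart m n O)

/-- The vector field on coordinates induced by an even super vector field. -/
def flowField (p : (coeffWeil hP n).Pt m) : (coeffWeil hP n).Pt m :=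
  C.ptOf hP fun V f => nilEval p (C.loc (X.app V f))

variable {C}

theorem SuperChart.smoothNear_ptOf {E : Type*} [NormedAddCommGroup E] [NormedSpace ℝ E]
    {k : E → ∀ V : Opens M, O.obj V → Coeff 𝒜 n} {x : E}
    (he : ∀ i, SmoothNear (fun y => k y _ (C.evenSec i)) x)
    (ho : ∀ j, SmoothNear (fun y => k y _ (C.oddSec j)) x) :
    SmoothNear (fun y => C.ptOf hP (k y)) x :=
  smoothNear_mkPt he ho

theorem smoothNear_flowField {p : (coeffWeil hP n).Pt m} (hp : p.base ∈ C.chart.target) :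
    SmoothNear (flowField hP X C) p := by
  have hp' := C.symm_mem hp
  exact C.smoothNear_ptOf hP
    (fun i => nilEval_smoothNear_const (C.smoothNear_loc hp (SuperChart.mem_dom_even i hp') _))
    (fun j => nilEval_smoothNear_const (C.smoothNear_loc hp (SuperChart.mem_dom_odd j hp') _))

theorem SuperChart.hasDerivAt_ptOf {k : ℝ → ∀ V : Opens M, O.obj V → Coeff 𝒜 n}
    {k' : ∀ V : Opens M, O.obj V → Coeff 𝒜 n} {t : ℝ}
    (he : ∀ i, HasDerivAt (fun τ => k τ _ (C.evenSec i)) (k' _ (C.evenSec i)) t)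
    (ho : ∀ j, HasDerivAt (fun τ => k τ _ (C.oddSec j)) (k' _ (C.oddSec j)) t) :
    HasDerivAt (fun τ => C.ptOf hP (k τ)) (C.ptOf hP k') t :=
  hasDerivAt_mkPt he ho

/-- Solutions of the coordinate equation satisfy the flow equation. -/
theorem hasDerivAt_nilEval {p : ℝ → (coeffWeil hP n).Pt m} {t : ℝ}
    (hp : HasDerivAt p (flowField hP X C (p t)) t) (ht : (p t).base ∈ C.chart.target)
    {V : Opens M} (hV : C.chart.symm (p t).base ∈ V) (f : O.obj V) :
    HasDerivAt (fun τ => nilEval (p τ) (C.loc f)) (nilEval (p t) (C.loc (X.app V f))) t := by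
  set p₀ := p t with hp₀
  have hy := C.symm_mem ht
  have hk := isPoint_nilEval hP (C := C) ht
  let y₀ := p₀.base
  have hD := isGermDer_deriv hp
  have hmem : ∀ {F}, SmoothNear F y₀ → C.chart.symm y₀ ∈ C.dom F := fun hF =>
    (SuperChart.mem_dom hy).2 (by rwa [C.chart.right_inv ht])
  have hE : ∀ {V W : Opens M} (_ : C.chart.symm y₀ ∈ V) (_ : C.chart.symm y₀ ∈ W) {f : O.obj V}
      {g : O.obj W}, coord C.triv f =ᶠ[𝓝 (C.chart.symm y₀)] coord C.triv g →
      nilEval p₀ (C.loc (X.app V f)) = nilEval p₀ (C.loc (X.app W g)) :=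
    @fun V W hV hW f g h => hk.congr C.triv hy hV hW (X.coord_congr C.triv hy hV hW h)
  have hsec : ∀ {F}, SmoothNear F y₀ → ∀ᶠ x in 𝓝 (C.chart.symm y₀),
      coord C.triv (C.sec F) x = F (C.chart x) := fun hF =>
    SuperChart.coord_sec_eventuallyEq hy (by rwa [C.chart.right_inv ht])
  -- X followed by evaluation at p₀ is a second derivation along evaluation at p₀, to be compared
  -- with differentiation along the curve, `hD`. The hypothesis `hp` says that they agree on
  -- coordinates.
  have hD' : IsGermDer y₀ (nilEval p₀) fun F => nilEval p₀ (C.loc (X.app _ (C.sec F))) := by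
    refine ⟨fun F G hF hG => ?_, fun F G hF hG => ?_, fun F G hF h => ?_⟩
    · have h : C.chart.symm y₀ ∈ C.dom F ⊓ C.dom G := ⟨hmem hF, hmem hG⟩
      rw [hE (hmem (hF.add hG)) h
        (g := O.res inf_le_left (C.sec F) + O.res inf_le_right (C.sec G)), map_add, X.app_res,
        X.app_res, hk.add _ h, hk.res _ _ h, hk.res _ _ h]
      filter_upwards [hsec hF, hsec hG, hsec (hF.add hG), (C.dom F ⊓ C.dom G).isOpen.mem_nhds h]
        with x h1 h2 h3 h4
      rw [coord_add _ _ _ h4, coord_res _ _ _ h4, coord_res _ _ _ h4, h1, h2, h3]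
    · have h : C.chart.symm y₀ ∈ C.dom F ⊓ C.dom G := ⟨hmem hF, hmem hG⟩
      rw [hE (hmem (hF.mul hG)) h
        (g := O.res inf_le_left (C.sec F) * O.res inf_le_right (C.sec G)), X.leibniz, X.app_res,
        X.app_res, hk.add _ h, hk.mul _ h, hk.mul _ h, hk.res _ _ h, hk.res _ _ h, hk.res _ _ h,
        hk.res _ _ h, nilEval_loc_sec hP ht hF, nilEval_loc_sec hP ht hG]
      filter_upwards [hsec hF, hsec hG, hsec (hF.mul hG), (C.dom F ⊓ C.dom G).isOpen.mem_nhds h]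
        with x h1 h2 h3 h4
      rw [coord_mul _ _ _ h4, coord_res _ _ _ h4, coord_res _ _ _ h4, h1, h2, h3]
    · have hG := hF.congr h.symm
      refine hE (hmem hF) (hmem hG) ?_
      have h5 : ∀ᶠ x in 𝓝 (C.chart.symm y₀), F (C.chart x) = G (C.chart x) := by
        have := (C.contMDiffAt_chart hy).continuousAt
        rw [ContinuousAt, C.chart.right_inv ht] at this
        exact this.eventually h
      filter_upwards [hsec hF, hsec hG, h5] with x h1 h2 h3
      rw [h1, h2, h3]
  have hcoordE : ∀ i, HasDerivAt (fun τ => nilEval (p τ) (coordFun (Coeff 𝒜 n) i))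
      (nilEval p₀ (C.loc (X.app _ (C.evenSec i)))) t := by
    intro i
    have h2 := hasDerivAt_even hp i
    have hd := SuperChart.mem_dom_even (C := C) i hy
    have h3 : nilEval p₀ (C.loc (X.app _ (C.evenSec i))) ∈ coeffGr 𝒜 n 0 :=
      hk.mem _ hd 0 _ (X.app_mem _ 0 _ (by
        have := SuperChart.sec_mem (C := C) (i := 0) (F := coordFun (Coeff 𝒜 n) i) le_rfl
          fun x _ => (coeffWeil hP n).algebraMap_mem _
        rwa [O.res_refl] at this))
    have h4 : ((flowField hP X C p₀).1 i : Coeff 𝒜 n) =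
        nilEval p₀ (C.loc (X.app _ (C.evenSec i))) :=
      congrArg Subtype.val (evenProj_of_mem (S := coeffWeil hP n) h3)
    rw [h4] at h2
    refine h2.congr_of_eventuallyEq (Eventually.of_forall fun τ => ?_)
    exact nilEval_coordFun _ _
  have hcoordO : ∀ j, HasDerivAt (fun τ => nilEval (p τ) fun _ => (oddCoord 𝒜 n j : Coeff 𝒜 n))
      (nilEval p₀ (C.loc (X.app _ (C.oddSec j)))) t := by
    intro j
    have h2 := hasDerivAt_odd hp j
    have hd := SuperChart.mem_dom_odd (C := C) j hy
    have h3 : nilEval p₀ (C.loc (X.app _ (C.oddSec j))) ∈ coeffGr 𝒜 n 1 :=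
      hk.mem _ hd 1 _ (X.app_mem _ 1 _ (by
        have := SuperChart.sec_mem (C := C) (i := 1) (F := fun _ => (oddCoord 𝒜 n j : Coeff 𝒜 n))
          le_rfl fun x _ => (oddCoord 𝒜 n j).2
        rwa [O.res_refl] at this))
    have h4 : ((flowField hP X C p₀).2 j : Coeff 𝒜 n) =
        nilEval p₀ (C.loc (X.app _ (C.oddSec j))) :=
      congrArg Subtype.val (oddProj_of_mem (S := coeffWeil hP n) h3)
    rw [h4] at h2
    refine h2.congr_of_eventuallyEq (Eventually.of_forall fun τ => ?_)
    exact (nilEval_const _ _).trans ((coeffWeil hP n).subst_ξ _ _)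
  have hf : SmoothNear (C.loc f) y₀ := C.smoothNear_loc ht hV f
  -- Both derivations kill scalars, and the image of xᵢ - yᵢ is the nilpotent part of p₀, so
  -- agreement on coordinates is enough.
  have main := hD.eq_of_coord (coeffWeil hP n) hD' (by
      rintro _ ⟨a, rfl⟩
      have e1 : nilEval p₀ (C.loc (X.app _ (C.sec fun _ =>
          GradedTensorProduct.includeLeft 𝒜 (extParity n) a))) = 0 := by
        rw [hE (hmem (.const _ _)) hV (g := O.scalar V a), X.app_scalar,
          ← map_zero (O.scalar V), hk.scalar V hV, map_zero]
        filter_upwards [hsec (.const _ _), V.isOpen.mem_nhds hV, C.U.isOpen.mem_nhds hy]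
          with x h1 h2 h3
        rw [h1, coord_scalar _ _ h3 h2]
      refine Eq.trans ?_ e1.symm
      refine HasDerivAt.deriv ((hasDerivAt_const t
        (GradedTensorProduct.includeLeft 𝒜 (extParity n) a)).congr_of_eventuallyEq
          (Eventually.of_forall fun τ => ?_))
      exact (nilEval_const _ _).trans ((coeffWeil hP n).subst_scal _ _ ⟨a, rfl⟩))
    (fun j => (hcoordO j).deriv) (fun i => (hcoordE i).deriv) (coeffWeil hP n).evenNil
    (coeffWeil hP n).order (coeffWeil hP n).evenNil_pow_order (fun i => by
      have h1 : nilEval p₀ (fun x => coordFun (Coeff 𝒜 n) i x + algebraMap ℝ _ (-y₀ i)) =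
          p₀.nilp i := by
        rw [nilEval_add _ (smoothNear_coordFun i _) (.const _ _), nilEval_coordFun, nilEval_const,
          AlgHom.commutes, Pt.nilp, sub_eq_add_neg, ← map_neg]
        rfl
      rw [h1]; exact p₀.nilp_mem i) hf
  have h6 := hasDerivAt_nilEval_deriv hp hf
  have h7 : nilEval p₀ (C.loc (X.app _ (C.sec (C.loc f)))) = nilEval p₀ (C.loc (X.app V f)) := by
    refine hE (hmem hf) hV ?_
    filter_upwards [hsec hf, C.U.isOpen.mem_nhds hy] with x h1 h2
    rw [h1, C.loc_chart f h2]
  have h8 : deriv (fun τ => nilEval (p τ) (C.loc f)) t = nilEval p₀ (C.loc (X.app V f)) :=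
    main.trans h7
  rwa [h8] at h6

end Flow

open Filter Topology

section FlowCurves

variable {P : Type u} [Ring P] [Algebra ℝ P] [FiniteDimensional ℝ P]
  {𝒜 : ZMod 2 → Submodule ℝ P} [GradedAlgebra 𝒜] {m n : ℕ}
variable {M : Type v} [TopologicalSpace M] [ChartedSpace (EuclideanSpace ℝ (Fin m)) M]
variable {O : SuperSheaf.{u, v, w} 𝒜 M} {U : Opens M}
variable {aug : P →ₐ[ℝ] ℝ} (hP : IsSmall 𝒜 aug)
variable {X : EvenVectorField O}

open SuperWeil

/-! ### Flow curves -/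

variable (n X) in
/-- A curve of points solving the flow equation. -/
structure IsFlowCurve (S : Set ℝ) (β : ℝ → M)
    (k : ℝ → ∀ V : Opens M, O.obj V → Coeff 𝒜 n) : Prop where
  isPoint : ∀ t ∈ S, IsPoint n (β t) (k t)
  cont : ContinuousOn β S
  deriv : ∀ t ∈ S, ∀ (V : Opens M) (f : O.obj V), β t ∈ V →
    HasDerivAt (fun τ => k τ V f) (k t V (X.app V f)) t

variable {C : SuperChart m n O} {S : Set ℝ} {β β' : ℝ → M}
  {k k' : ℝ → ∀ V : Opens M, O.obj V → Coeff 𝒜 n}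

theorem SuperChart.ptOf_congr {y : M} (hy : y ∈ C.U) {k k' : ∀ V : Opens M, O.obj V → Coeff 𝒜 n}
    (h : ∀ (V : Opens M) (f : O.obj V), y ∈ V → k V f = k' V f) : C.ptOf hP k = C.ptOf hP k' := by
  have h1 : (fun i => k _ (C.evenSec i)) = fun i => k' _ (C.evenSec i) :=
    funext fun i => h _ _ (SuperChart.mem_dom_even i hy)
  have h2 : (fun j => k _ (C.oddSec j)) = fun j => k' _ (C.oddSec j) :=
    funext fun j => h _ _ (SuperChart.mem_dom_odd j hy)
  rw [SuperChart.ptOf, SuperChart.ptOf, h1, h2]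

theorem IsFlowCurve.mono (h : IsFlowCurve n X S β k) {T : Set ℝ} (hT : T ⊆ S) :
    IsFlowCurve n X T β k :=
  ⟨fun t ht => h.isPoint t (hT ht), h.cont.mono hT, fun t ht => h.deriv t (hT ht)⟩

/-- The flow equation gives the derivatives of the coordinates as values on X of the coordinate
sections. `IsPoint.eq_nilEval` expresses these values through the coordinates themselves, so the
equation is an autonomous ordinary one. -/
theorem IsFlowCurve.hasDerivAt_ptOf (h : IsFlowCurve n X S β k) {t : ℝ} (ht : t ∈ S)
    (hU : β t ∈ C.U) :
    HasDerivAt (fun τ => C.ptOf hP (k τ)) (flowField hP X C (C.ptOf hP (k t))) t := by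
  have h1 := C.hasDerivAt_ptOf hP (k := k) (k' := fun V f => k t V (X.app V f))
    (fun i => h.deriv t ht _ (C.evenSec i) (SuperChart.mem_dom_even i hU))
    (fun j => h.deriv t ht _ (C.oddSec j) (SuperChart.mem_dom_odd j hU))
  have h2 : C.ptOf hP (fun V f => k t V (X.app V f)) = flowField hP X C (C.ptOf hP (k t)) :=
    C.ptOf_congr hP hU fun V f hV => (h.isPoint t ht).eq_nilEval hP hU hV _
  rwa [h2] at h1

/-- The coincidence set is open by uniqueness for the ordinary equation in a superchart, and closed
in S by continuity since M is Hausdorff; S is connected. -/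
theorem IsFlowCurve.eqOn [T2Space M] [IsManifold (𝓡 m) ∞ M] (hO : IsSupermanifold m n O)
    (hP : IsSmall 𝒜 aug)
    (h : IsFlowCurve n X S β k) (h' : IsFlowCurve n X S β' k') (hS : IsOpen S)
    (hS' : S.OrdConnected) {t₀ : ℝ} (ht₀ : t₀ ∈ S) (hβ : β t₀ = β' t₀)
    (hk : ∀ (V : Opens M) (f : O.obj V), β t₀ ∈ V → k t₀ V f = k' t₀ V f) :
    ∀ t ∈ S, β t = β' t ∧ ∀ (V : Opens M) (f : O.obj V), β t ∈ V → k t V f = k' t V f := by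
  let u : Set ℝ := {t | t ∈ S ∧ β t = β' t ∧
    ∀ (V : Opens M) (f : O.obj V), β t ∈ V → k t V f = k' t V f}
  have hca : ∀ t ∈ S, ContinuousAt β t := fun t ht => h.cont.continuousAt (hS.mem_nhds ht)
  have hca' : ∀ t ∈ S, ContinuousAt β' t := fun t ht => h'.cont.continuousAt (hS.mem_nhds ht)
  suffices hsub : S ⊆ u from fun t ht => (hsub ht).2
  refine hS'.isPreconnected.subset_of_closure_inter_subset ?_ ⟨t₀, ht₀, ht₀, hβ, hk⟩ ?_
  · rw [isOpen_iff_mem_nhds]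
    rintro t ⟨ht, hβt, hkt⟩
    obtain ⟨C, hC⟩ := exists_superChart hO (β t)
    have hC' : β' t ∈ C.U := hβt ▸ hC
    have hp : C.ptOf hP (k t) = C.ptOf hP (k' t) := C.ptOf_congr hP hC hkt
    have hbase := (h.isPoint t ht).base_ptOf hP hC
    have hG : ContDiffAt ℝ ∞ (flowField hP X C) (C.ptOf hP (k t)) :=
      (smoothNear_flowField hP X (by rw [hbase]; exact C.map_mem hC)).contDiffAt
    obtain ⟨K, s, hs, hK⟩ := (hG.of_le (m := 1) (by simp)).exists_lipschitzOnWith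
    have e1 : ∀ᶠ τ in 𝓝 t, τ ∈ S := hS.mem_nhds ht
    have e2 : ∀ᶠ τ in 𝓝 t, β τ ∈ C.U := (hca t ht).eventually (C.U.isOpen.mem_nhds hC)
    have e3 : ∀ᶠ τ in 𝓝 t, β' τ ∈ C.U := (hca' t ht).eventually (C.U.isOpen.mem_nhds hC')
    have e4 : ∀ᶠ τ in 𝓝 t, C.ptOf hP (k τ) ∈ s :=
      (h.hasDerivAt_ptOf hP ht hC).continuousAt.eventually hs
    have e5 : ∀ᶠ τ in 𝓝 t, C.ptOf hP (k' τ) ∈ s :=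
      (h'.hasDerivAt_ptOf hP ht hC').continuousAt.eventually
        (show s ∈ 𝓝 (C.ptOf hP (k' t)) from hp ▸ hs)
    have hode := ODE_solution_unique_of_eventually (v := fun _ => flowField hP X C)
      (s := fun _ => s) (f := fun τ => C.ptOf hP (k τ)) (g := fun τ => C.ptOf hP (k' τ)) (t₀ := t)
      (Eventually.of_forall fun _ => hK)
      (by filter_upwards [e1, e2, e4] with τ h1 h2 h4 using ⟨h.hasDerivAt_ptOf hP h1 h2, h4⟩)
      (by filter_upwards [e1, e3, e5] with τ h1 h2 h4 using ⟨h'.hasDerivAt_ptOf hP h1 h2, h4⟩) hp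
    filter_upwards [e1, e2, e3, hode] with τ h1 h2 h3 h4
    have b1 := (h.isPoint τ h1).base_ptOf hP h2
    have b2 := (h'.isPoint τ h1).base_ptOf hP h3
    have hb : β τ = β' τ := by
      rw [← C.left_inv h2, ← C.left_inv h3, ← b1, ← b2, h4]
    refine ⟨h1, hb, fun V f hV => ?_⟩
    rw [(h.isPoint τ h1).eq_nilEval hP h2 hV f, (h'.isPoint τ h1).eq_nilEval hP h3 (hb ▸ hV) f, h4]
  -- At a limit time the bodies agree because M is Hausdorff, and the values agree as limits along
  -- times at which the two curves coincide.
  · rintro t ⟨htc, ht⟩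
    have hfr := mem_closure_iff_frequently.1 htc
    have hb : β t = β' t := tendsto_nhds_unique_of_frequently_eq (hca t ht) (hca' t ht)
      (hfr.mono fun τ hτ => hτ.2.1)
    refine ⟨ht, hb, fun V f hV => ?_⟩
    refine tendsto_nhds_unique_of_frequently_eq (h.deriv t ht V f hV).continuousAt
      (h'.deriv t ht V f (hb ▸ hV)).continuousAt ?_
    exact (hfr.and_eventually ((hca t ht).eventually (V.isOpen.mem_nhds hV))).mono
      fun τ hτ => hτ.1.2.2 V f hτ.2

/-! ### The body of an even vector field -/

theorem _root_.PSuper.SuperWeil.hasDerivAt_base {A : Type u} [NormedRing A] [NormedAlgebra ℝ A]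
    [FiniteDimensional ℝ A] {S : SuperWeil A n} {p : ℝ → S.Pt m} {p' : S.Pt m} {t : ℝ}
    (hp : HasDerivAt p p' t) : HasDerivAt (fun τ => (p τ).base) p'.base t := by
  let L : S.Pt m →ₗ[ℝ] EuclideanSpace ℝ (Fin m) :=
    { toFun := Pt.base
      map_add' := fun p q => PiLp.ext fun i => map_add S.body (p.1 i : A) (q.1 i)
      map_smul' := fun c p => PiLp.ext fun i => map_smul S.body c (p.1 i : A) }
  exact (LinearMap.toContinuousLinearMap L).hasFDerivAt.comp_hasDerivAt t hp

variable (X C) in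
/-- The coordinate expression of the body of an even super vector field. -/
def bodyVec (e : EuclideanSpace ℝ (Fin m)) : EuclideanSpace ℝ (Fin m) :=
  (flowField hP X C ((coeffWeil hP n).realPt e)).base

/-- The body of a Taylor evaluation depends only on the base, so nilpotent coordinates do not
influence the motion of the base. -/
theorem base_flowField {p : (coeffWeil hP n).Pt m} (hp : p.base ∈ C.chart.target) :
    (flowField hP X C p).base = bodyVec hP X C p.base := by
  have key : ∀ (q : (coeffWeil hP n).Pt m) (_ : q.base ∈ C.chart.target) (i : Fin m),
      (flowField hP X C q).base i = coeffBodyHom hP n (C.loc (X.app _ (C.evenSec i)) q.base) := by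
    intro q hq i
    have hy := C.symm_mem hq
    have h1 : nilEval q (C.loc (X.app _ (C.evenSec i))) ∈ coeffGr 𝒜 n 0 :=
      (isPoint_nilEval hP hq).mem _ (SuperChart.mem_dom_even i hy) 0 _ (X.app_mem _ 0 _ (by
        have := SuperChart.sec_mem (C := C) (i := 0) (F := coordFun (Coeff 𝒜 n) i) le_rfl
          fun x _ => (coeffWeil hP n).algebraMap_mem _
        rwa [O.res_refl] at this))
    have h2 := congrArg (fun x => coeffBodyHom hP n (Subtype.val x))
      (evenProj_of_mem (S := coeffWeil hP n) h1)
    exact h2.trans (body_nilEval q _)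
  ext i
  rw [bodyVec, key p hp, key _ (by rwa [base_realPt]), base_realPt]

/-- A vector field acts on bodies of sections by its coordinate expression. -/
theorem fderiv_body_loc {e : EuclideanSpace ℝ (Fin m)} (he : e ∈ C.chart.target) {V : Opens M}
    (hV : C.chart.symm e ∈ V) (f : O.obj V) :
    fderiv ℝ (fun e' => coeffBodyHom hP n (C.loc f e')) e (bodyVec hP X C e) =
      coeffBodyHom hP n (C.loc (X.app V f) e) := by
  set p₀ := (coeffWeil hP n).realPt e with hp₀
  -- A straight test line suffices, since `hasDerivAt_nilEval` needs the coordinate equation only at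
  -- time 0.
  let p : ℝ → (coeffWeil hP n).Pt m := fun τ => p₀ + τ • flowField hP X C p₀
  have h0 : p 0 = p₀ := by simp [p]
  have hb0 : p₀.base = e := base_realPt _ _
  have hp : HasDerivAt p (flowField hP X C (p 0)) 0 := by
    have h := ((hasDerivAt_id (0 : ℝ)).smul_const (flowField hP X C p₀)).const_add p₀
    rw [one_smul] at h
    rw [h0]
    exact h
  have h1 := hasDerivAt_nilEval hP X hp (by rwa [h0, hb0]) (by rwa [h0, hb0]) f
  rw [h0, hp₀, nilEval_realPt] at h1
  let B := LinearMap.toContinuousLinearMap (coeffBodyHom hP n).toLinearMap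
  have h2 := B.hasFDerivAt.comp_hasDerivAt (0 : ℝ) h1
  have h3 : HasDerivAt (fun τ => (p τ).base) (bodyVec hP X C e) 0 := by
    have h4 := hasDerivAt_base hp
    rwa [h0] at h4
  have h5 : DifferentiableAt ℝ (fun e' => coeffBodyHom hP n (C.loc f e')) e :=
    ((C.smoothNear_loc he hV f).clm_comp B).contDiffAt.differentiableAt (by simp)
  have h6 : HasFDerivAt (fun e' => coeffBodyHom hP n (C.loc f e'))
      (fderiv ℝ (fun e' => coeffBodyHom hP n (C.loc f e')) e) (p 0).base := by
    rw [h0, hb0]; exact h5.hasFDerivAt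
  have h7 := h6.comp_hasDerivAt (0 : ℝ) h3
  refine h7.unique (h2.congr_of_eventuallyEq (Eventually.of_forall fun τ => ?_))
  exact (body_nilEval (p τ) (C.loc f)).symm

theorem SuperChart.mdifferentiable (C : SuperChart m n O) :
    C.chart.MDifferentiable (𝓡 m) (𝓡 m) :=
  ⟨(contMDiffOn_of_mem_maximalAtlas C.mem_atlas).mdifferentiableOn (by simp),
    (contMDiffOn_symm_of_mem_maximalAtlas C.mem_atlas).mdifferentiableOn (by simp)⟩

/-- `IsPoint.body_eq`, applied to the points defined by φ, makes the body independent of the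
trivialization. -/
theorem body_eventuallyEq (φ : Trivialization m n O U) {x : M} (hφ : x ∈ U) (hx : x ∈ C.U)
    {W : Opens M} (hW : x ∈ W) (f : O.obj W) :
    (fun y => coeffBody 𝒜 aug n (coord φ f y)) =ᶠ[𝓝 x]
      (fun e => coeffBodyHom hP n (C.loc f e)) ∘ C.chart := by
  filter_upwards [(U ⊓ (C.U ⊓ W)).isOpen.mem_nhds ⟨hφ, hx, hW⟩] with y hy
  have := (isPoint_coord (O := O) φ hy.1).body_eq hP hy.2.1 hy.2.2 f
  rw [Function.comp_apply, C.loc_chart f hy.2.1]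
  exact this

theorem mfderiv_body (φ : Trivialization m n O U) {x : M} (hφ : x ∈ U) (hx : x ∈ C.U)
    {W : Opens M} (hW : x ∈ W) (f : O.obj W) (u : TangentSpace (𝓡 m) x) :
    mfderiv (𝓡 m) 𝓘(ℝ, ℝ) (fun y => coeffBody 𝒜 aug n (coord φ f y)) x u =
      fderiv ℝ (fun e => coeffBodyHom hP n (C.loc f e)) (C.chart x)
        (mfderiv (𝓡 m) (𝓡 m) C.chart x u) := by
  let B := LinearMap.toContinuousLinearMap (coeffBodyHom hP n).toLinearMap
  have h5 : DifferentiableAt ℝ (fun e' => coeffBodyHom hP n (C.loc f e')) (C.chart x) :=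
    ((C.smoothNear_loc (C.map_mem hx) (by rwa [C.left_inv hx]) f).clm_comp
      B).contDiffAt.differentiableAt (by simp)
  have h6 : HasMFDerivAt (𝓡 m) 𝓘(ℝ, ℝ) (fun y => coeffBody 𝒜 aug n (coord φ f y)) x _ :=
    (h5.hasFDerivAt.hasMFDerivAt.comp x (C.mdifferentiable.mdifferentiableAt
      (C.mem_source hx)).hasMFDerivAt).congr_of_eventuallyEq (body_eventuallyEq hP φ hφ hx hW f)
  rw [h6.mfderiv]
  rfl

variable (aug X) in
/-- `v` acts on bodies of sections as `X` does. -/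
def ActsAsBody (v : (x : M) → TangentSpace (𝓡 m) x) : Prop :=
  ∀ (U : Opens M) (φ : Trivialization m n O U) (W : Opens M) (f : O.obj W) (x : M),
    x ∈ U → x ∈ W →
      mfderiv (𝓡 m) 𝓘(ℝ, ℝ) (fun y => coeffBody 𝒜 aug n (coord φ f y)) x (v x) =
        coeffBody 𝒜 aug n (coord φ (X.app W f) x)

/-- The even coordinate sections have the coordinate functions as bodies, and testing against them
determines every component of v. -/
theorem ActsAsBody.mfderiv_chart {v : (x : M) → TangentSpace (𝓡 m) x}
    (hv : ActsAsBody (n := n) aug X v) {x : M} (hx : x ∈ C.U) :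
    mfderiv (𝓡 m) (𝓡 m) C.chart x (v x) = bodyVec hP X C (C.chart x) := by
  refine PiLp.ext fun i => ?_
  have hd := SuperChart.mem_dom_even (C := C) i hx
  have h1 := hv C.U C.triv _ (C.evenSec i) x hx hd
  rw [mfderiv_body hP C.triv hx hx hd] at h1
  have he := C.map_mem hx
  have h2 := fderiv_body_loc hP (X := X) he (by rwa [C.left_inv hx]) (C.evenSec i)
  rw [C.loc_chart _ hx] at h2
  have h3 := h1.trans h2.symm
  have h4 : (fun e => coeffBodyHom hP n (C.loc (C.evenSec i) e)) =ᶠ[𝓝 (C.chart x)]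
      EuclideanSpace.proj (𝕜 := ℝ) i := by
    filter_upwards [C.loc_sec_eventuallyEq he (smoothNear_coordFun i _)] with e h
    change coeffBodyHom hP n (C.loc (C.sec _) e) = _
    rw [h, coordFun, AlgHom.commutes]; rfl
  rw [h4.fderiv_eq, ContinuousLinearMap.fderiv] at h3
  exact h3

variable [IsManifold (𝓡 m) ∞ M]

/-- Smoothness follows from the action on bodies alone: near x₀ the field is the pullback by the
chart of the smooth field `bodyVec`. -/
theorem ActsAsBody.contMDiff (hO : IsSupermanifold m n O) (hP : IsSmall 𝒜 aug)
    {v : (x : M) → TangentSpace (𝓡 m) x} (hv : ActsAsBody (n := n) aug X v) :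
    ContMDiff (𝓡 m) (𝓡 m).tangent ∞ (fun x => (⟨x, v x⟩ : TangentBundle (𝓡 m) M)) := by
  intro x₀
  obtain ⟨C, hC⟩ := exists_superChart hO x₀
  have : IsManifold (𝓡 m) 1 M := .of_le (n := ∞) (by simp)
  have hsm : SmoothNear (bodyVec hP X C) (C.chart x₀) := by
    have h1 : SmoothNear (flowField hP X C) ((coeffWeil hP n).realPt (C.chart x₀)) :=
      smoothNear_flowField hP X (by rw [base_realPt]; exact C.map_mem hC)
    have h2 := SmoothNear.comp (g := (coeffWeil hP n).realPt) h1 (.of_contDiff contDiff_realPt _)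
    filter_upwards [h2] with e he using contDiff_base.contDiffAt.comp e he
  have h3 : ContMDiffAt (𝓡 m) (𝓡 m).tangent ∞ (fun e : EuclideanSpace ℝ (Fin m) =>
      (⟨e, bodyVec hP X C e⟩ : TangentBundle (𝓡 m) (EuclideanSpace ℝ (Fin m)))) (C.chart x₀) :=
    contMDiffAt_vectorSpace_iff_contDiffAt.2 hsm.contDiffAt
  have hinv : ∀ x ∈ C.U, (mfderiv (𝓡 m) (𝓡 m) C.chart x).IsInvertible := fun x hx =>
    ⟨C.mdifferentiable.mfderiv (C.mem_source hx), rfl⟩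
  have h4 := h3.mpullback_vectorField_preimage (C.contMDiffAt_chart hC) (hinv x₀ hC) (by simp)
  refine h4.congr_of_eventuallyEq ?_
  filter_upwards [C.U.isOpen.mem_nhds hC] with x hx
  have e : v x = (mfderiv (𝓡 m) (𝓡 m) C.chart x).inverse (bodyVec hP X C (C.chart x)) :=
    ((ContinuousLinearMap.IsInvertible.inverse_apply_eq (hinv x hx)).2
      (hv.mfderiv_chart hP hx).symm).symm
  exact congrArg (fun u => (⟨x, u⟩ : TangentBundle (𝓡 m) M)) e

/-- A superchart is chosen separately at each point. No compatibility of the choices has to be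
checked, since each gives the right action on bodies, and smoothness is a consequence of that
action. -/
theorem exists_actsAsBody (hO : IsSupermanifold m n O) (hP : IsSmall 𝒜 aug)
    (X : EvenVectorField O) :
    ∃ v : (x : M) → TangentSpace (𝓡 m) x, ActsAsBody (n := n) aug X v := by
  choose C hC using exists_superChart hO
  refine ⟨fun x => mfderiv (𝓡 m) (𝓡 m) (C x).chart.symm ((C x).chart x)
    (bodyVec hP X (C x) ((C x).chart x)), fun U φ W f x hφ hW => ?_⟩
  have hx := hC x
  refine (mfderiv_body hP φ hφ hx hW f _).trans ?_
  have e : mfderiv (𝓡 m) (𝓡 m) (C x).chart x (mfderiv (𝓡 m) (𝓡 m) (C x).chart.symm ((C x).chart x)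
      (bodyVec hP X (C x) ((C x).chart x))) = bodyVec hP X (C x) ((C x).chart x) :=
    ((C x).mdifferentiable.mfderiv ((C x).mem_source hx)).apply_symm_apply _
  refine (congrArg _ e).trans ((fderiv_body_loc hP ((C x).map_mem hx)
    (by rwa [(C x).left_inv hx]) f).trans ?_)
  rw [(C x).loc_chart _ hx]
  exact ((isPoint_coord (O := O) φ hφ).body_eq hP hx hW (X.app W f)).symm

/-- Taking bases in the coordinate equation leaves the ordinary equation for `bodyVec`, the chart
expression of v. -/
theorem IsFlowCurve.isMIntegralCurveOn (hO : IsSupermanifold m n O) (hP : IsSmall 𝒜 aug)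
    {v : (x : M) → TangentSpace (𝓡 m) x} (hv : ActsAsBody (n := n) aug X v)
    (h : IsFlowCurve n X S β k) (hS : IsOpen S) : IsMIntegralCurveOn (I := 𝓡 m) β v S := by
  intro t ht
  refine HasMFDerivAt.hasMFDerivWithinAt ?_
  obtain ⟨C, hC⟩ := exists_superChart hO (β t)
  have hnear : ∀ᶠ τ in 𝓝 t, τ ∈ S ∧ β τ ∈ C.U :=
    (hS.mem_nhds ht |> fun h => (h : ∀ᶠ τ in 𝓝 t, τ ∈ S)).and
      ((h.cont.continuousAt (hS.mem_nhds ht)).eventually (C.U.isOpen.mem_nhds hC))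
  have hbase := (h.isPoint t ht).base_ptOf hP hC
  have h1 := hasDerivAt_base (h.hasDerivAt_ptOf hP ht hC)
  rw [base_flowField hP (by rw [hbase]; exact C.map_mem hC), hbase] at h1
  have hb : ∀ᶠ τ in 𝓝 t, (C.ptOf hP (k τ)).base = C.chart (β τ) := by
    filter_upwards [hnear] with τ hτ using (h.isPoint τ hτ.1).base_ptOf hP hτ.2
  have h2 : HasDerivAt (fun τ => C.chart (β τ)) (bodyVec hP X C (C.chart (β t))) t :=
    h1.congr_of_eventuallyEq (hb.mono fun _ h => h.symm)
  have h3 : HasMFDerivAt 𝓘(ℝ, ℝ) (𝓡 m) (fun τ => C.chart.symm (C.chart (β τ))) t _ :=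
    HasMFDerivAt.comp t (C.mdifferentiable.mdifferentiableAt_symm (C.map_mem hC)).hasMFDerivAt
      h2.hasFDerivAt.hasMFDerivAt
  have h4 := h3.congr_of_eventuallyEq (f₁ := β)
    (hnear.mono fun τ hτ => (C.left_inv hτ.2).symm)
  have h5 := hv.mfderiv_chart hP hC
  have h6 : v (β t) = mfderiv (𝓡 m) (𝓡 m) C.chart.symm (C.chart (β t))
      (bodyVec hP X C (C.chart (β t))) := by
    rw [← h5]
    exact ((C.mdifferentiable.mfderiv (C.mem_source hC)).symm_apply_apply _).symm
  have h7 : ∀ s : ℝ, s • v (β t) = mfderiv (𝓡 m) (𝓡 m) C.chart.symm (C.chart (β t))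
      (s • bodyVec hP X C (C.chart (β t))) := fun s => by
    rw [h6]; exact (map_smul _ s _).symm
  have h8 : (1 : ℝ →L[ℝ] ℝ).smulRight (v (β t)) = (mfderiv (𝓡 m) (𝓡 m) C.chart.symm
      (C.chart (β t))).comp (ContinuousLinearMap.toSpanSingleton ℝ
        (bodyVec hP X C (C.chart (β t)))) := DFunLike.ext _ _ h7
  rw [h8]
  exact h4

end FlowCurves

open Filter Topology

section FlowFamilies

variable {P : Type u} [Ring P] [Algebra ℝ P] [FiniteDimensional ℝ P]
  {𝒜 : ZMod 2 → Submodule ℝ P} [GradedAlgebra 𝒜] {m n : ℕ}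
variable {M : Type v} [TopologicalSpace M] [ChartedSpace (EuclideanSpace ℝ (Fin m)) M]
variable {O : SuperSheaf.{u, v, w} 𝒜 M} {U : Opens M}
variable {aug : P →ₐ[ℝ] ℝ} (hP : IsSmall 𝒜 aug)
variable (X : EvenVectorField O)

open SuperWeil

/-! ### Local flows -/

/-- A local flow in the superchart `C` for times `|t| < ε` starting at coordinates in `N`. -/
structure IsLocalFlow (C : SuperChart m n O) (ε : ℝ) (N : Set (EuclideanSpace ℝ (Fin m)))
    (Ψ : ℝ × EuclideanSpace ℝ (Fin m) → (coeffWeil hP n).Pt m) : Prop where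
  isOpen : IsOpen N
  smooth : ∀ t ∈ Set.Ioo (-ε) ε, ∀ e ∈ N, SmoothNear Ψ (t, e)
  deriv : ∀ t ∈ Set.Ioo (-ε) ε, ∀ e ∈ N,
    HasDerivAt (fun τ => Ψ (τ, e)) (flowField hP X C (Ψ (t, e))) t
  base_mem : ∀ t ∈ Set.Ioo (-ε) ε, ∀ e ∈ N, (Ψ (t, e)).base ∈ C.chart.target
  zero : ∀ e ∈ N, Ψ (0, e) = (coeffWeil hP n).realPt e

/-- The smooth flow of `flowField` is restricted to real initial points. These carry the odd
coordinates ξ, so the restricted family still encodes the pullbacks in all odd directions. -/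
theorem exists_isLocalFlow (C : SuperChart m n O) {y : M} (hy : y ∈ C.U) :
    ∃ ε > 0, ∃ N, C.chart y ∈ N ∧ ∃ Ψ, IsLocalFlow hP X C ε N Ψ := by
  set S := coeffWeil hP n
  have hb : (S.realPt (C.chart y)).base ∈ C.chart.target := by
    rw [base_realPt]; exact C.map_mem hy
  obtain ⟨Φ, hΦ⟩ := exists_smooth_flow (smoothNear_flowField hP X hb)
  let g : ℝ × EuclideanSpace ℝ (Fin m) → ℝ × S.Pt m := fun q => (q.1, S.realPt q.2)
  have hg : ContDiff ℝ ∞ g := contDiff_fst.prodMk (contDiff_realPt.comp contDiff_snd)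
  have hev := (hg.continuous.tendsto ((0 : ℝ), C.chart y)).eventually hΦ
  have hsm : SmoothNear (fun q => Φ (g q)) ((0 : ℝ), C.chart y) := by
    filter_upwards [hev] with q hq using hq.1.comp q hg.contDiffAt
  have h0 : Φ (g (0, C.chart y)) = S.realPt (C.chart y) := hΦ.self_of_nhds.2.2
  have hbase : ∀ᶠ q in 𝓝 ((0 : ℝ), C.chart y), (Φ (g q)).base ∈ C.chart.target := by
    have hc : ContinuousAt (fun q => (Φ (g q)).base) ((0 : ℝ), C.chart y) :=
      contDiff_base.continuous.continuousAt.comp hsm.contDiffAt.continuousAt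
    exact hc.eventually (C.chart.open_target.mem_nhds (by
      change (Φ (g (0, C.chart y))).base ∈ _
      rw [h0]; exact hb))
  have hall := (hsm.eventually_nhds.and hbase).and hev
  rw [nhds_prod_eq] at hall
  obtain ⟨pa, hpa, pb, hpb, hab⟩ := eventually_prod_iff.1 hall
  obtain ⟨ε, hε, hball⟩ := Metric.eventually_nhds_iff.1 hpa
  obtain ⟨N, hN, hNo, hyN⟩ := eventually_nhds_iff.1 hpb
  have hpa' : ∀ t ∈ Set.Ioo (-ε) ε, pa t := fun t ht => hball (by
    rw [Real.dist_eq, sub_zero]; exact abs_lt.2 ht)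
  refine ⟨ε, hε, N, hyN, fun q => Φ (g q), hNo, fun t ht e he => ?_,
    fun t ht e he => ?_, fun t ht e he => ?_, fun e he => ?_⟩
  · exact (hab (hpa' t ht) (hN e he)).1.1
  · exact (hab (hpa' t ht) (hN e he)).2.2.1
  · exact (hab (hpa' t ht) (hN e he)).1.2
  · exact (hab (hpa' 0 ⟨by linarith, hε⟩) (hN e he)).2.2.2

variable {X} {C : SuperChart m n O} {ε : ℝ} {N : Set (EuclideanSpace ℝ (Fin m))}
  {Ψ : ℝ × EuclideanSpace ℝ (Fin m) → (coeffWeil hP n).Pt m}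

namespace IsLocalFlow

variable {hP}

/-- The pullback of a section along a local flow, in coordinates. -/
def pull (C : SuperChart m n O) (Ψ : ℝ × EuclideanSpace ℝ (Fin m) → (coeffWeil hP n).Pt m)
    (V : Opens M) (f : O.obj V) (q : ℝ × EuclideanSpace ℝ (Fin m)) : Coeff 𝒜 n :=
  nilEval (Ψ q) (C.loc f)

/-- The body of a local flow. -/
def bodyMap (C : SuperChart m n O) (Ψ : ℝ × EuclideanSpace ℝ (Fin m) → (coeffWeil hP n).Pt m)
    (q : ℝ × EuclideanSpace ℝ (Fin m)) : M := C.chart.symm (Ψ q).base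

variable (h : IsLocalFlow hP X C ε N Ψ) {t : ℝ} (ht : t ∈ Set.Ioo (-ε) ε)
  {e : EuclideanSpace ℝ (Fin m)} (he : e ∈ N)

include h ht he

theorem continuousAt_bodyMap : ContinuousAt (bodyMap C Ψ) (t, e) :=
  (C.chart.continuousAt_symm (h.base_mem t ht e he)).comp_of_eq
    (contDiff_base.continuous.continuousAt.comp (h.smooth t ht e he).contDiffAt.continuousAt) rfl

theorem eventually_mem {V : Opens M} (hV : bodyMap C Ψ (t, e) ∈ V) :
    ∀ᶠ q in 𝓝 (t, e), q.1 ∈ Set.Ioo (-ε) ε ∧ q.2 ∈ N ∧ bodyMap C Ψ q ∈ V :=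
  (continuous_fst.continuousAt.eventually (Ioo_mem_nhds ht.1 ht.2)).and
    ((continuous_snd.continuousAt.eventually (h.isOpen.mem_nhds he)).and
      ((h.continuousAt_bodyMap ht he).eventually (V.isOpen.mem_nhds hV)))

theorem smoothNear_pull {V : Opens M} (hV : bodyMap C Ψ (t, e) ∈ V) (f : O.obj V) :
    SmoothNear (pull C Ψ V f) (t, e) :=
  SmoothNear.comp (g := Ψ)
    (nilEval_smoothNear_const (C.smoothNear_loc (h.base_mem t ht e he) hV f)) (h.smooth t ht e he)

theorem hasDerivAt_pull {V : Opens M} (hV : bodyMap C Ψ (t, e) ∈ V) (f : O.obj V) :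
    ∀ᶠ q in 𝓝 (t, e), HasDerivAt (fun τ => pull C Ψ V f (τ, q.2)) (pull C Ψ V (X.app V f) q)
      q.1 := by
  filter_upwards [h.eventually_mem ht he hV] with q hq
  exact hasDerivAt_nilEval hP X (h.deriv q.1 hq.1 q.2 hq.2.1) (h.base_mem q.1 hq.1 q.2 hq.2.1)
    hq.2.2 f

omit he in
-- Taylor evaluation in the initial position e extends the flow from real initial points to
-- arbitrary ones. The homomorphism identities hold at real points near the base of k, and
-- evaluation preserves them.
theorem isPoint_pull {x : M} {k : ∀ V : Opens M, O.obj V → Coeff 𝒜 n} (hk : IsPoint n x k)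
    (hx : x ∈ C.U) (hxN : C.chart x ∈ N) :
    IsPoint n (bodyMap C Ψ (t, C.chart x))
      (fun V (f : O.obj V) => nilEval (C.ptOf hP k) fun e => pull C Ψ V f (t, e)) := by
  have hb := hk.base_ptOf hP hx
  have hline : Tendsto (fun e => (t, e)) (𝓝 (C.ptOf hP k).base) (𝓝 (t, C.chart x)) := by
    rw [hb]; exact (Continuous.prodMk_right t).tendsto' _ _ rfl
  have hsm : ∀ {V : Opens M} (_ : bodyMap C Ψ (t, C.chart x) ∈ V) (f : O.obj V),
      SmoothNear (fun e => pull C Ψ V f (t, e)) (C.ptOf hP k).base := fun hV f => by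
    rw [hb]
    exact SmoothNear.comp (g := fun e => (t, e)) (h.smoothNear_pull ht hxN hV f)
      (.of_contDiff (contDiff_const.prodMk contDiff_id) _)
  have hpt : ∀ {V : Opens M} (_ : bodyMap C Ψ (t, C.chart x) ∈ V),
      ∀ᶠ e in 𝓝 (C.ptOf hP k).base, bodyMap C Ψ (t, e) ∈ V ∧
        IsPoint n (bodyMap C Ψ (t, e)) fun W (f : O.obj W) => pull C Ψ W f (t, e) := fun hV => by
    filter_upwards [hline.eventually (h.eventually_mem ht hxN hV)] with e he
    exact ⟨he.2.2, isPoint_nilEval hP (h.base_mem t ht e he.2.1)⟩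
  refine ⟨fun V hV f g => ?_, fun V hV f g => ?_, fun V hV a => ?_, fun V hV i f hf => ?_,
    fun {V W} hVW f hV => ?_⟩
  · rw [← nilEval_add _ (hsm hV f) (hsm hV g)]
    refine nilEval_congr _ ?_
    filter_upwards [hpt hV] with e he using he.2.add V he.1 f g
  · rw [← nilEval_mul _ (hsm hV f) (hsm hV g)]
    refine nilEval_congr _ ?_
    filter_upwards [hpt hV] with e he using he.2.mul V he.1 f g
  · have hs : nilEval (C.ptOf hP k)
        (fun _ => GradedTensorProduct.includeLeft 𝒜 (extParity n) a) =
        GradedTensorProduct.includeLeft 𝒜 (extParity n) a :=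
      (isGermHom_nilEval (C.ptOf hP k)).scal _ ⟨a, rfl⟩
    refine Eq.trans ?_ hs
    refine nilEval_congr _ ?_
    filter_upwards [hpt hV] with e he using he.2.scalar V he.1 a
  · refine nilEval_mem (S := coeffWeil hP n) (C.ptOf hP k) i ?_
    filter_upwards [hpt hV] with e he using he.2.mem V he.1 i f hf
  · refine nilEval_congr _ ?_
    filter_upwards [hpt hV] with e he using he.2.res hVW f he.1

omit ht he in
-- Time differentiation commutes with evaluation in e. The existence time ε depends only on the body
-- of the initial point, which is why nilpotent directions cannot shorten the flow.
theorem isFlowCurve {x : M} {k : ∀ V : Opens M, O.obj V → Coeff 𝒜 n} (hk : IsPoint n x k)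
    (hx : x ∈ C.U) (hxN : C.chart x ∈ N) :
    IsFlowCurve n X (Set.Ioo (-ε) ε) (fun t => bodyMap C Ψ (t, C.chart x))
      (fun t V f => nilEval (C.ptOf hP k) fun e => pull C Ψ V f (t, e)) := by
  refine ⟨fun t ht => h.isPoint_pull ht hk hx hxN, fun t ht => ?_, fun t ht V f hV => ?_⟩
  · refine ContinuousAt.continuousWithinAt ?_
    exact (h.continuousAt_bodyMap ht hxN).comp_of_eq
      (Continuous.prodMk_left (C.chart x)).continuousAt rfl
  · have hb := hk.base_ptOf hP hx
    exact nilEval_hasDerivAt (F := pull C Ψ V f) (F' := pull C Ψ V (X.app V f))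
      (by rw [hb]; exact h.smoothNear_pull ht hxN hV f)
      (by rw [hb]; exact h.hasDerivAt_pull ht hxN hV f)

omit ht he in
-- At time 0 the pullback is the coordinate expression of the section itself, so evaluation at the
-- coordinates of k returns k.
theorem initial {x : M} {k : ∀ V : Opens M, O.obj V → Coeff 𝒜 n} (hk : IsPoint n x k)
    (hx : x ∈ C.U) (hxN : C.chart x ∈ N) :
    bodyMap C Ψ (0, C.chart x) = x ∧ ∀ (V : Opens M) (f : O.obj V), x ∈ V →
      nilEval (C.ptOf hP k) (fun e => pull C Ψ V f (0, e)) = k V f := by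
  constructor
  · rw [bodyMap, h.zero _ hxN, base_realPt, C.left_inv hx]
  · intro V f hV
    rw [hk.eq_nilEval hP hx hV f]
    refine nilEval_congr _ ?_
    rw [hk.base_ptOf hP hx]
    filter_upwards [h.isOpen.mem_nhds hxN] with e he
    rw [pull, h.zero e he, nilEval_realPt]

end IsLocalFlow

/-! ### Smooth families of flow curves -/

variable (X) in
/-- A family of flow curves depending smoothly on an initial position in `N`. -/
structure IsFlowFamily (C : SuperChart m n O) (S : Set ℝ) (N : Set M) (β : ℝ → M → M)
    (k : ℝ → M → ∀ V : Opens M, O.obj V → Coeff 𝒜 n) : Prop where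
  isOpen_time : IsOpen S
  isOpen_space : IsOpen N
  subset : N ⊆ C.U
  isFlowCurve : ∀ x ∈ N, IsFlowCurve n X S (fun t => β t x) (fun t => k t x)
  cont : ∀ t ∈ S, ∀ x ∈ N, ContinuousAt (fun q : ℝ × M => β q.1 q.2) (t, x)
  smooth : ∀ t ∈ S, ∀ x ∈ N, ∀ (V : Opens M) (f : O.obj V), β t x ∈ V →
    SmoothNear (fun q : ℝ × EuclideanSpace ℝ (Fin m) => k q.1 (C.chart.symm q.2) V f)
      (t, C.chart x)

theorem IsFlowCurve.shift {S : Set ℝ} {β : ℝ → M}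
    {k : ℝ → ∀ V : Opens M, O.obj V → Coeff 𝒜 n} (h : IsFlowCurve n X S β k) (t₁ : ℝ) :
    IsFlowCurve n X ((fun t => t - t₁) ⁻¹' S) (fun t => β (t - t₁)) (fun t => k (t - t₁)) :=
  ⟨fun t ht => h.isPoint _ ht, h.cont.comp (by fun_prop) fun _ ht => ht,
    fun t ht V f hV => (h.deriv _ ht V f hV).comp_sub_const t t₁⟩

/-- The local flow is restarted at time t₁ from a smooth family of points k x over b x. If k is an
earlier flow at time t₁, this is composition of flows; if k is the evaluation at x, it is the local
flow itself. Smoothness comes from evaluating jointly in function and point. -/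
theorem IsLocalFlow.isFlowFamily {hP : IsSmall 𝒜 aug}
    {Ψ : ℝ × EuclideanSpace ℝ (Fin m) → (coeffWeil hP n).Pt m}
    (h : IsLocalFlow hP X C ε N Ψ) {C' : SuperChart m n O} {N' : Set M} (hN' : IsOpen N')
    (hN'U : N' ⊆ C'.U) {b : M → M} {k : M → ∀ V : Opens M, O.obj V → Coeff 𝒜 n}
    (hk : ∀ x ∈ N', IsPoint n (b x) (k x)) (hb : ∀ x ∈ N', ContinuousAt b x)
    (hbU : ∀ x ∈ N', b x ∈ C.U) (hbN : ∀ x ∈ N', C.chart (b x) ∈ N)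
    (hsm : ∀ x ∈ N', ∀ (V : Opens M) (f : O.obj V), b x ∈ V →
      SmoothNear (fun e => k (C'.chart.symm e) V f) (C'.chart x)) (t₁ : ℝ) :
    IsFlowFamily X C' ((fun t => t - t₁) ⁻¹' Set.Ioo (-ε) ε) N'
      (fun t x => bodyMap C Ψ (t - t₁, C.chart (b x)))
      (fun t x V f => nilEval (C.ptOf hP (k x)) fun e => pull C Ψ V f (t - t₁, e)) where
  isOpen_time := isOpen_Ioo.preimage (by fun_prop)
  isOpen_space := hN'
  subset := hN'U
  isFlowCurve x hx := (h.isFlowCurve (hk x hx) (hbU x hx) (hbN x hx)).shift t₁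
  cont t ht x hx := by
    refine (h.continuousAt_bodyMap ht (hbN x hx)).comp_of_eq (f := fun q : ℝ × M =>
      (q.1 - t₁, C.chart (b q.2))) ?_ rfl
    refine ContinuousAt.prodMk (by fun_prop) ?_
    exact ContinuousAt.comp_of_eq (C.contMDiffAt_chart (hbU x hx)).continuousAt
      ((hb x hx).comp_of_eq continuousAt_snd rfl) rfl
  smooth t ht x hx V f hV := by
    have hx' := hN'U hx
    have hb := (hk x hx).base_ptOf hP (hbU x hx)
    have h1 := nilEval_smoothNear (q₀ := t - t₁) (p₀ := C.ptOf hP (k x))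
      (F := pull C Ψ V f) (by rw [hb]; exact h.smoothNear_pull ht (hbN x hx) hV f)
    have h2 : SmoothNear (fun e => C.ptOf hP (k (C'.chart.symm e))) (C'.chart x) :=
      C.smoothNear_ptOf hP (fun i => hsm x hx _ _ (SuperChart.mem_dom_even i (hbU x hx)))
        (fun j => hsm x hx _ _ (SuperChart.mem_dom_odd j (hbU x hx)))
    have h3 : SmoothNear (fun q : ℝ × EuclideanSpace ℝ (Fin m) =>
        (q.1 - t₁, C.ptOf hP (k (C'.chart.symm q.2)))) (t, C'.chart x) := by
      filter_upwards [(continuous_snd.tendsto (t, C'.chart x)).eventually h2] with q hq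
      have hτ : ContDiffAt ℝ ∞ (fun q : ℝ × EuclideanSpace ℝ (Fin m) => q.1 - t₁) q :=
        contDiffAt_fst.sub contDiffAt_const
      have hσ : ContDiffAt ℝ ∞ (fun q : ℝ × EuclideanSpace ℝ (Fin m) =>
          C.ptOf hP (k (C'.chart.symm q.2))) q :=
        ContDiffAt.comp (g := fun e => C.ptOf hP (k (C'.chart.symm e))) q hq contDiffAt_snd
      exact hτ.prodMk hσ
    have h4 : SmoothNear (fun q : ℝ × (coeffWeil hP n).Pt m =>
        nilEval q.2 fun e => pull C Ψ V f (q.1, e))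
        (t - t₁, C.ptOf hP (k (C'.chart.symm (C'.chart x)))) := by
      rw [C'.left_inv hx']
      exact h1
    exact SmoothNear.comp (g := fun q : ℝ × EuclideanSpace ℝ (Fin m) =>
      ((q.1 - t₁, C.ptOf hP (k (C'.chart.symm q.2))) : ℝ × (coeffWeil hP n).Pt m)) h4 h3

namespace IsFlowFamily

variable {S S' : Set ℝ} {N : Set M} {β β' : ℝ → M → M}
  {k k' : ℝ → M → ∀ V : Opens M, O.obj V → Coeff 𝒜 n}

theorem mono (h : IsFlowFamily X C S N β k) {N' : Set M} (hN' : IsOpen N') (hsub : N' ⊆ N) :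
    IsFlowFamily X C S N' β k :=
  ⟨h.isOpen_time, hN', hsub.trans h.subset, fun x hx => h.isFlowCurve x (hsub hx),
    fun t ht x hx => h.cont t ht x (hsub hx), fun t ht x hx => h.smooth t ht x (hsub hx)⟩

theorem eventually_mem (h : IsFlowFamily X C S N β k) {t : ℝ} (ht : t ∈ S) {x : M} (hx : x ∈ N)
    {V : Opens M} (hV : β t x ∈ V) : ∀ᶠ q in 𝓝 (t, x), q.1 ∈ S ∧ q.2 ∈ N ∧ β q.1 q.2 ∈ V :=
  (continuous_fst.continuousAt.eventually (h.isOpen_time.mem_nhds ht)).and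
    ((continuous_snd.continuousAt.eventually (h.isOpen_space.mem_nhds hx)).and
      ((h.cont t ht x hx).eventually (V.isOpen.mem_nhds hV)))

/-- All conditions concern (t, x) in the open box and V around β t x, so the family may be altered
freely elsewhere. -/
theorem congr (h : IsFlowFamily X C S N β k)
    (hβ : ∀ t ∈ S, ∀ x ∈ N, β' t x = β t x)
    (hk : ∀ t ∈ S, ∀ x ∈ N, ∀ (V : Opens M) (f : O.obj V), β t x ∈ V → k' t x V f = k t x V f) :
    IsFlowFamily X C S N β' k' := by
  have hline : ∀ (t : ℝ) (x : M), Tendsto (fun τ : ℝ => (τ, x)) (𝓝 t) (𝓝 (t, x)) := fun t x =>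
    (Continuous.prodMk_left x).tendsto' _ _ rfl
  refine ⟨h.isOpen_time, h.isOpen_space, h.subset, fun x hx => ⟨fun t ht => ?_, ?_,
    fun t ht V f hV => ?_⟩, fun t ht x hx => ?_, fun t ht x hx V f hV => ?_⟩
  · have hp := (h.isFlowCurve x hx).isPoint t ht
    rw [hβ t ht x hx]
    have e := fun V (f : O.obj V) hV => hk t ht x hx V f hV
    refine ⟨fun V hV f g => ?_, fun V hV f g => ?_, fun V hV a => ?_, fun V hV i f hf => ?_,
      fun {V W} hVW f hV => ?_⟩
    · rw [e V _ hV, e V _ hV, e V _ hV]; exact hp.add V hV f g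
    · rw [e V _ hV, e V _ hV, e V _ hV]; exact hp.mul V hV f g
    · rw [e V _ hV]; exact hp.scalar V hV a
    · rw [e V _ hV]; exact hp.mem V hV i f hf
    · rw [e V _ hV, e W _ (hVW hV)]; exact hp.res hVW f hV
  · exact (h.isFlowCurve x hx).cont.congr fun t ht => hβ t ht x hx
  · rw [hβ t ht x hx] at hV
    rw [hk t ht x hx _ _ hV]
    refine ((h.isFlowCurve x hx).deriv t ht V f hV).congr_of_eventuallyEq ?_
    filter_upwards [(hline t x).eventually (h.eventually_mem ht hx hV)] with τ hτ
    exact hk τ hτ.1 x hx V f hτ.2.2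
  · refine (h.cont t ht x hx).congr ?_
    filter_upwards [h.eventually_mem ht hx (V := ⊤) trivial] with q hq
    exact (hβ q.1 hq.1 q.2 hq.2.1).symm
  · rw [hβ t ht x hx] at hV
    refine (h.smooth t ht x hx V f hV).congr ?_
    have hxU := h.subset hx
    have hc : ContinuousAt (fun q : ℝ × EuclideanSpace ℝ (Fin m) => (q.1, C.chart.symm q.2))
        (t, C.chart x) := continuousAt_fst.prodMk
      ((C.chart.continuousAt_symm (C.map_mem hxU)).comp_of_eq continuousAt_snd rfl)
    have hev := h.eventually_mem ht hx hV
    rw [← C.left_inv hxU] at hev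
    filter_upwards [hc.eventually hev] with q hq
    exact hk q.1 hq.1 _ hq.2.1 V f hq.2.2

theorem union (h : IsFlowFamily X C S N β k) (h' : IsFlowFamily X C S' N β k) :
    IsFlowFamily X C (S ∪ S') N β k := by
  refine ⟨h.isOpen_time.union h'.isOpen_time, h.isOpen_space, h.subset, fun x hx =>
    ⟨?_, ?_, ?_⟩, ?_, ?_⟩
  · rintro t (ht | ht)
    · exact (h.isFlowCurve x hx).isPoint t ht
    · exact (h'.isFlowCurve x hx).isPoint t ht
  · rintro t (ht | ht)
    · exact ((h.isFlowCurve x hx).cont.continuousAt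
        (h.isOpen_time.mem_nhds ht)).continuousWithinAt
    · exact ((h'.isFlowCurve x hx).cont.continuousAt
        (h'.isOpen_time.mem_nhds ht)).continuousWithinAt
  · rintro t (ht | ht)
    · exact (h.isFlowCurve x hx).deriv t ht
    · exact (h'.isFlowCurve x hx).deriv t ht
  · rintro t (ht | ht)
    · exact h.cont t ht
    · exact h'.cont t ht
  · rintro t (ht | ht)
    · exact h.smooth t ht
    · exact h'.smooth t ht

open Classical in
/-- Two families of flow curves which agree at one time can be joined. -/
theorem join [T2Space M] [IsManifold (𝓡 m) ∞ M] (hO : IsSupermanifold m n O)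
    (hP : IsSmall 𝒜 aug) (h : IsFlowFamily X C S N β k) (h' : IsFlowFamily X C S' N β' k')
    (hS : S.OrdConnected) (hS' : S'.OrdConnected) {t₁ : ℝ} (ht₁ : t₁ ∈ S) (ht₁' : t₁ ∈ S')
    (hβ : ∀ x ∈ N, β t₁ x = β' t₁ x)
    (hk : ∀ x ∈ N, ∀ (V : Opens M) (f : O.obj V), β t₁ x ∈ V → k t₁ x V f = k' t₁ x V f) :
    IsFlowFamily X C (S ∪ S') N (fun t x => if t ∈ S then β t x else β' t x)
      (fun t x => if t ∈ S then k t x else k' t x) := by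
  -- Both are flow curves that agree at t₁, so uniqueness on the interval S ∩ S' makes them agree on
  -- the whole overlap.
  have key : ∀ x ∈ N, ∀ t ∈ S ∩ S', β t x = β' t x ∧
      ∀ (V : Opens M) (f : O.obj V), β t x ∈ V → k t x V f = k' t x V f := fun x hx =>
    ((h.isFlowCurve x hx).mono Set.inter_subset_left).eqOn hO hP
      ((h'.isFlowCurve x hx).mono Set.inter_subset_right)
      (h.isOpen_time.inter h'.isOpen_time) (hS.inter hS') ⟨ht₁, ht₁'⟩ (hβ x hx) (hk x hx)
  refine (h.congr (fun t ht x _ => if_pos ht) fun t ht x _ V f _ => by rw [if_pos ht]).union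
    (h'.congr (fun t ht x hx => ?_) fun t ht x hx V f hV => ?_)
  · split_ifs with hts
    · exact (key x hx t ⟨hts, ht⟩).1
    · rfl
  · split_ifs with hts
    · exact (key x hx t ⟨hts, ht⟩).2 V f ((key x hx t ⟨hts, ht⟩).1 ▸ hV)
    · rfl

end IsFlowFamily

end FlowFamilies

open Filter Topology

/-! ### Maximal integral curves -/

section IntegralCurves

variable {m : ℕ} {M : Type v} [TopologicalSpace M] [T2Space M]
  [ChartedSpace (EuclideanSpace ℝ (Fin m)) M] [IsManifold (𝓡 m) 1 M]
  {v : (x : M) → TangentSpace (𝓡 m) x}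

/-- Uniqueness is known on an `Ioo` containing both times; openness and order-connectedness of J
provide one containing 0 and t. -/
theorem integralCurve_eqOn
    (hv : ContMDiff (𝓡 m) (𝓡 m).tangent 1 (fun x => (⟨x, v x⟩ : TangentBundle (𝓡 m) M)))
    {J : Set ℝ} (hJ : IsOpen J) (hJ' : J.OrdConnected) (h0 : 0 ∈ J) {γ γ' : ℝ → M}
    (hγ : IsMIntegralCurveOn (I := 𝓡 m) γ v J) (hγ' : IsMIntegralCurveOn (I := 𝓡 m) γ' v J)
    (h : γ 0 = γ' 0) : Set.EqOn γ γ' J := by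
  intro t ht
  have hmin : min 0 t ∈ J := by rcases min_choice 0 t with e | e <;> rw [e] <;> assumption
  have hmax : max 0 t ∈ J := by rcases max_choice 0 t with e | e <;> rw [e] <;> assumption
  obtain ⟨a, a', ha, haJ⟩ := mem_nhds_iff_exists_Ioo_subset.1 (hJ.mem_nhds hmin)
  obtain ⟨b', b, hb, hbJ⟩ := mem_nhds_iff_exists_Ioo_subset.1 (hJ.mem_nhds hmax)
  obtain ⟨c, hc⟩ := exists_between ha.1
  obtain ⟨d, hd⟩ := exists_between hb.2
  have hsub : Set.Ioo c d ⊆ J := Set.Ioo_subset_Icc_self.trans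
    (hJ'.out (haJ ⟨hc.1, hc.2.trans ha.2⟩) (hbJ ⟨hb.1.trans hd.1, hd.2⟩))
  exact isMIntegralCurveOn_Ioo_eqOn_of_contMDiff_boundaryless (t₀ := 0)
    ⟨hc.2.trans_le (min_le_left _ _), (le_max_left _ _).trans_lt hd.1⟩ hv
    (hγ.mono hsub) (hγ'.mono hsub) h
    ⟨hc.2.trans_le (min_le_right _ _), (le_max_right _ _).trans_lt hd.1⟩

/-- Integral curves agree on overlaps and glue, so the union of all admissible intervals is
admissible. -/
theorem isGreatest_integralIntervals
    (hv : ContMDiff (𝓡 m) (𝓡 m).tangent 1 (fun x => (⟨x, v x⟩ : TangentBundle (𝓡 m) M)))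
    (x : M) : IsGreatest (integralIntervals v x) (⋃₀ integralIntervals v x) := by
  have h0 : (0 : ℝ) ∈ ⋃₀ integralIntervals v x := by
    obtain ⟨γ, h0, hγ⟩ := exists_isMIntegralCurveAt_of_contMDiffAt_boundaryless 0 (hv x)
    obtain ⟨ε, hε, hγ⟩ := isMIntegralCurveAt_iff'.1 hγ
    rw [Real.ball_eq_Ioo] at hγ
    exact ⟨_, ⟨isOpen_Ioo, Set.ordConnected_Ioo, ⟨by linarith, by linarith⟩, γ, hγ, h0⟩,
      ⟨by linarith, by linarith⟩⟩
  refine ⟨⟨isOpen_sUnion fun J hJ => hJ.1, ?_, h0, ?_⟩, fun J hJ => Set.subset_sUnion_of_mem hJ⟩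
  · exact (isPreconnected_sUnion 0 _ (fun J hJ => hJ.2.2.1)
      fun J hJ => hJ.2.1.isPreconnected).ordConnected
  · have hex : ∀ t : ℝ, ∃ J : Set ℝ, ∃ γ : ℝ → M, t ∈ ⋃₀ integralIntervals v x →
        t ∈ J ∧ IsOpen J ∧ J.OrdConnected ∧ 0 ∈ J ∧
          IsMIntegralCurveOn (I := 𝓡 m) γ v J ∧ γ 0 = x := fun t => by
      by_cases ht : t ∈ ⋃₀ integralIntervals v x
      · obtain ⟨J, ⟨h1, h2, h3, γ, h4, h5⟩, htJ⟩ := ht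
        exact ⟨J, γ, fun _ => ⟨htJ, h1, h2, h3, h4, h5⟩⟩
      · exact ⟨∅, fun _ => x, fun h => absurd h ht⟩
    choose J γ hJ using hex
    have key : ∀ t ∈ ⋃₀ integralIntervals v x, ∀ τ ∈ J t, γ τ τ = γ t τ := fun t ht τ hτ => by
      obtain ⟨_, h2, h3, h4, h5, h6⟩ := hJ t ht
      obtain ⟨g1, g2, g3, g4, g5, g6⟩ := hJ τ ⟨J t, ⟨h2, h3, h4, γ t, h5, h6⟩, hτ⟩
      exact integralCurve_eqOn hv (g2.inter h2) (g3.inter h3) ⟨g4, h4⟩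
        (g5.mono Set.inter_subset_left) (h5.mono Set.inter_subset_right) (g6.trans h6.symm)
        ⟨g1, hτ⟩
    -- The diagonal glues the chosen curves; near t it agrees with the single integral curve γ t by
    -- `key`.
    refine ⟨fun t => γ t t, fun t ht => ?_, (hJ 0 h0).2.2.2.2.2⟩
    obtain ⟨h1, h2, h3, h4, h5, h6⟩ := hJ t ht
    have hd := (h5 t h1).hasMFDerivAt (h2.mem_nhds h1)
    refine HasMFDerivAt.hasMFDerivWithinAt (hd.congr_of_eventuallyEq ?_)
    filter_upwards [h2.mem_nhds h1] with τ hτ using key t ht τ hτ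

end IntegralCurves

/-! ### Flow boxes -/

section FlowBoxes

variable {P : Type u} [Ring P] [Algebra ℝ P] [FiniteDimensional ℝ P]
  {𝒜 : ZMod 2 → Submodule ℝ P} [GradedAlgebra 𝒜] {m n : ℕ}
variable {M : Type v} [TopologicalSpace M] [ChartedSpace (EuclideanSpace ℝ (Fin m)) M]
variable {O : SuperSheaf.{u, v, w} 𝒜 M} {U : Opens M}
variable {aug : P →ₐ[ℝ] ℝ} {hP : IsSmall 𝒜 aug}
variable {X : EvenVectorField O}

open SuperWeil

variable (X) in
/-- A family of flow curves starting at the identity. -/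
structure IsFlowBox (C : SuperChart m n O) (S : Set ℝ) (N : Set M) (β : ℝ → M → M)
    (k : ℝ → M → ∀ V : Opens M, O.obj V → Coeff 𝒜 n) : Prop
    extends IsFlowFamily X C S N β k where
  ordConnected : S.OrdConnected
  zero_mem : 0 ∈ S
  body_zero : ∀ x ∈ N, β 0 x = x
  zero : ∀ x ∈ N, ∀ (V : Opens M) (f : O.obj V), x ∈ V → k 0 x V f = coord C.triv f x

variable {C C₁ : SuperChart m n O} {S : Set ℝ} {N : Set M} {β : ℝ → M → M}
  {k : ℝ → M → ∀ V : Opens M, O.obj V → Coeff 𝒜 n} {ε : ℝ}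
  {N₁ : Set (EuclideanSpace ℝ (Fin m))}
  {Ψ : ℝ × EuclideanSpace ℝ (Fin m) → (coeffWeil hP n).Pt m}

theorem ordConnected_shift (t₁ : ℝ) : ((fun t : ℝ => t - t₁) ⁻¹' Set.Ioo (-ε) ε).OrdConnected :=
  Set.ordConnected_Ioo.preimage_mono fun _ _ h => sub_le_sub_right h _

theorem mem_shift {t t₁ : ℝ} : t ∈ (fun t : ℝ => t - t₁) ⁻¹' Set.Ioo (-ε) ε ↔ |t - t₁| < ε :=
  abs_lt.symm

/-- The local flow is started from the identity, that is, from the points given by evaluation in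
`C.triv`. -/
theorem IsLocalFlow.exists_isFlowBox (h : IsLocalFlow hP X C ε N₁ Ψ) (hε : 0 < ε) {x₀ : M}
    (hx₀ : x₀ ∈ C.U) (hx₀N : C.chart x₀ ∈ N₁) :
    ∃ S N β k, IsFlowBox (n := n) X C S N β k ∧ x₀ ∈ N := by
  have hNo : IsOpen {x | x ∈ C.U ∧ C.chart x ∈ N₁} := by
    rw [isOpen_iff_mem_nhds]
    rintro x ⟨hx, hxN⟩
    exact inter_mem (C.U.isOpen.mem_nhds hx)
      ((C.contMDiffAt_chart hx).continuousAt (h.isOpen.mem_nhds hxN))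
  have hpt : ∀ x ∈ C.U, IsPoint n x (fun V (f : O.obj V) => coord C.triv f x) :=
    fun x hx => isPoint_coord C.triv hx
  have hF := h.isFlowFamily (C' := C) hNo (fun x hx => hx.1) (b := id)
    (k := fun x V f => coord C.triv f x) (fun x hx => hpt x hx.1) (fun x _ => continuousAt_id)
    (fun x hx => hx.1) (fun x hx => hx.2) (fun x hx V f hV => by
      refine C.smoothNear_loc (C.map_mem hx.1) ?_ f
      rwa [C.left_inv hx.1]) 0
  have h0 : |(0 : ℝ) - 0| < ε := by simpa using hε
  refine ⟨_, _, _, _, ⟨hF, ordConnected_shift 0, mem_shift.2 h0, fun x hx => ?_,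
    fun x hx V f hV => ?_⟩, hx₀, hx₀N⟩
  · rw [sub_zero]
    exact (h.initial (hpt x hx.1) hx.1 hx.2).1
  · simp only [sub_zero]
    exact (h.initial (hpt x hx.1) hx.1 hx.2).2 V f hV

namespace IsFlowBox

theorem continuousAt_body (h : IsFlowBox X C S N β k) {t : ℝ} (ht : t ∈ S) {x : M} (hx : x ∈ N) :
    ContinuousAt (β t) x :=
  ContinuousAt.comp_of_eq (f := fun x => (t, x)) (h.cont t ht x hx)
    (Continuous.prodMk_right t).continuousAt rfl

/-- The box is followed up to time t₁ and then composed with a local flow near β t₁ x₀. Only the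
spatial neighbourhood shrinks, to those x whose position at t₁ lies in the domain of the local flow;
the time interval gains all of (t₁ - ε, t₁ + ε). -/
theorem extend [T2Space M] [IsManifold (𝓡 m) ∞ M] (hO : IsSupermanifold m n O)
    (h : IsFlowBox X C S N β k) (L : IsLocalFlow hP X C₁ ε N₁ Ψ) (hε : 0 < ε) {t₁ : ℝ}
    (ht₁ : t₁ ∈ S) {x₀ : M} (hx₀ : x₀ ∈ N) (hU : β t₁ x₀ ∈ C₁.U)
    (hN : C₁.chart (β t₁ x₀) ∈ N₁) :
    ∃ N' β' k', IsFlowBox (n := n) X C (S ∪ (fun t => t - t₁) ⁻¹' Set.Ioo (-ε) ε) N' β' k' ∧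
      x₀ ∈ N' := by
  let N' : Set M := {x | x ∈ N ∧ β t₁ x ∈ C₁.U ∧ C₁.chart (β t₁ x) ∈ N₁}
  have hNo : IsOpen N' := by
    rw [isOpen_iff_mem_nhds]
    rintro x ⟨hx, hxU, hxN⟩
    have hc := h.continuousAt_body ht₁ hx
    refine inter_mem (h.isOpen_space.mem_nhds hx) (inter_mem (hc (C₁.U.isOpen.mem_nhds hxU)) ?_)
    exact (ContinuousAt.comp (C₁.contMDiffAt_chart hxU).continuousAt hc)
      (L.isOpen.mem_nhds hxN)
  have hsub : N' ⊆ N := fun x hx => hx.1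
  have hm := h.toIsFlowFamily.mono hNo hsub
  have hL := L.isFlowFamily (C' := C) hNo (hsub.trans h.subset) (b := β t₁) (k := k t₁)
    (fun x hx => (h.isFlowCurve x hx.1).isPoint t₁ ht₁) (fun x hx => h.continuousAt_body ht₁ hx.1)
    (fun x hx => hx.2.1) (fun x hx => hx.2.2) (fun x hx V f hV =>
      SmoothNear.comp (g := fun e => (t₁, e)) (h.smooth t₁ ht₁ x hx.1 V f hV)
        (.of_contDiff (contDiff_const.prodMk contDiff_id) _)) t₁
  have h0 : |t₁ - t₁| < ε := by simpa using hε
  have hinit := fun x (hx : x ∈ N') =>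
    L.initial ((h.isFlowCurve x hx.1).isPoint t₁ ht₁) hx.2.1 hx.2.2
  have hj := hm.join hO hP hL h.ordConnected (ordConnected_shift t₁) ht₁ (mem_shift.2 h0)
    (fun x hx => by simp only [sub_self]; exact (hinit x hx).1.symm)
    (fun x hx V f hV => by simp only [sub_self]; exact ((hinit x hx).2 V f hV).symm)
  refine ⟨N', _, _, ⟨hj, ?_, Or.inl h.zero_mem, fun x hx => ?_, fun x hx V f hV => ?_⟩,
    hx₀, hU, hN⟩
  · exact (h.ordConnected.isPreconnected.union t₁ ht₁ (mem_shift.2 h0)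
      (ordConnected_shift t₁).isPreconnected).ordConnected
  · rw [if_pos h.zero_mem]
    exact h.body_zero x hx.1
  · rw [if_pos h.zero_mem]
    exact h.zero x hx.1 V f hV

theorem isMIntegralCurveOn [T2Space M] [IsManifold (𝓡 m) ∞ M] (hO : IsSupermanifold m n O)
    (hP : IsSmall 𝒜 aug) {v : (x : M) → TangentSpace (𝓡 m) x}
    (hv : ActsAsBody (n := n) aug X v) (h : IsFlowBox X C S N β k) {x : M} (hx : x ∈ N) :
    IsMIntegralCurveOn (I := 𝓡 m) (fun t => β t x) v S :=
  (h.isFlowCurve x hx).isMIntegralCurveOn hO hP hv h.isOpen_time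

theorem mem_integralIntervals [T2Space M] [IsManifold (𝓡 m) ∞ M] (hO : IsSupermanifold m n O)
    (hP : IsSmall 𝒜 aug) {v : (x : M) → TangentSpace (𝓡 m) x}
    (hv : ActsAsBody (n := n) aug X v) (h : IsFlowBox X C S N β k) {x : M} (hx : x ∈ N) :
    S ∈ integralIntervals v x :=
  ⟨h.isOpen_time, h.ordConnected, h.zero_mem, _, h.isMIntegralCurveOn hO hP hv hx,
    h.body_zero x hx⟩

end IsFlowBox

/-- The times in I reached by boxes around x₀ form a nonempty set, open and closed in I. For
closedness, a local flow near γ(t) accepts every starting point over its domain, whatever its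
nilpotent part, so a box reaching a nearby time extends to t. -/
theorem exists_isFlowBox [T2Space M] [IsManifold (𝓡 m) ∞ M] (hO : IsSupermanifold m n O)
    (hP : IsSmall 𝒜 aug) {v : (x : M) → TangentSpace (𝓡 m) x}
    (hv : ActsAsBody (n := n) aug X v) {x₀ : M} (hx₀ : x₀ ∈ C.U) {I : Set ℝ}
    (hI : I ∈ integralIntervals v x₀) {t : ℝ} (ht : t ∈ I) :
    ∃ S N β k, IsFlowBox (n := n) X C S N β k ∧ t ∈ S ∧ x₀ ∈ N := by
  obtain ⟨hIo, hIc, hI0, γ, hγ, hγ0⟩ := hI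
  have : IsManifold (𝓡 m) 1 M := .of_le (n := ∞) (by simp)
  have hv1 := (hv.contMDiff hO hP).of_le (m := 1) (by simp)
  let u : Set ℝ := {t | ∃ S N β k, IsFlowBox (n := n) X C S N β k ∧ t ∈ S ∧ x₀ ∈ N}
  suffices hsub : I ⊆ u from hsub ht
  refine hIc.isPreconnected.subset_of_closure_inter_subset ?_ ?_ ?_
  · rw [isOpen_iff_mem_nhds]
    rintro t ⟨S, N, β, k, h, ht, hx⟩
    exact mem_of_superset (h.isOpen_time.mem_nhds ht) fun τ hτ => ⟨S, N, β, k, h, hτ, hx⟩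
  · obtain ⟨ε, hε, N₁, hN₁, Ψ, L⟩ := exists_isLocalFlow hP X C hx₀
    obtain ⟨S, N, β, k, h, hx⟩ := L.exists_isFlowBox hε hx₀ hN₁
    exact ⟨0, hI0, S, N, β, k, h, h.zero_mem, hx⟩
  · rintro t ⟨htu, htI⟩
    obtain ⟨C₁, hC₁⟩ := exists_superChart hO (γ t)
    obtain ⟨ε, hε, N₁, hN₁, Ψ, L⟩ := exists_isLocalFlow hP X C₁ hC₁
    have hγc : ContinuousAt γ t :=
      hγ.continuousOn.continuousAt (hIo.mem_nhds htI)
    have hnear : ∀ᶠ τ in 𝓝 t, (τ ∈ I ∧ |t - τ| < ε) ∧ γ τ ∈ C₁.U ∧ C₁.chart (γ τ) ∈ N₁ := by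
      refine ((hIo.mem_nhds htI |> fun h => (h : ∀ᶠ τ in 𝓝 t, τ ∈ I)).and ?_).and
        ((hγc.eventually (C₁.U.isOpen.mem_nhds hC₁)).and ?_)
      · have : ContinuousAt (fun τ => |t - τ|) t := by fun_prop
        exact this.eventually (gt_mem_nhds (by simpa using hε))
      · exact (ContinuousAt.comp (C₁.contMDiffAt_chart hC₁).continuousAt hγc).eventually
          (L.isOpen.mem_nhds hN₁)
    obtain ⟨t₁, ⟨S, N, β, k, h, ht₁, hx⟩, ⟨ht₁I, htt₁⟩, hU, hN⟩ :=
      (mem_closure_iff_frequently.1 htu).and_eventually hnear |>.exists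
    -- The body of the box is an integral curve of v, so it follows γ and at t₁ lies in the domain
    -- of the local flow.
    have hβ : β t₁ x₀ = γ t₁ := integralCurve_eqOn hv1 (h.isOpen_time.inter hIo)
      (h.ordConnected.inter hIc) ⟨h.zero_mem, hI0⟩
      ((h.isMIntegralCurveOn hO hP hv hx).mono Set.inter_subset_left)
      (hγ.mono Set.inter_subset_right) ((h.body_zero x₀ hx).trans hγ0.symm) ⟨ht₁, ht₁I⟩
    obtain ⟨N', β', k', h', hx'⟩ := h.extend hO L hε ht₁ hx (hβ ▸ hU) (hβ ▸ hN)
    exact ⟨_, N', β', k', h', Or.inr (mem_shift.2 htt₁), hx'⟩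

end FlowBoxes

open Filter Topology

section GlobalFlow

variable {P : Type u} [Ring P] [Algebra ℝ P] [FiniteDimensional ℝ P]
  {𝒜 : ZMod 2 → Submodule ℝ P} [GradedAlgebra 𝒜] {m n : ℕ}
variable {M : Type v} [TopologicalSpace M] [ChartedSpace (EuclideanSpace ℝ (Fin m)) M]
variable {O : SuperSheaf.{u, v, w} 𝒜 M} {U : Opens M}
variable {aug : P →ₐ[ℝ] ℝ} (hP : IsSmall 𝒜 aug)
variable {X : EvenVectorField O} {C : SuperChart m n O} {S S' : Set ℝ} {N N' : Set M}
  {β β' : ℝ → M → M} {k k' : ℝ → M → ∀ V : Opens M, O.obj V → Coeff 𝒜 n}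

open SuperWeil

/-! ### Flow families in other trivializations -/

theorem IsFlowFamily.eventually_symm_mem (h : IsFlowFamily X C S N β k) {t : ℝ} (ht : t ∈ S)
    {x : M} (hx : x ∈ N) {V : Opens M} (hV : β t x ∈ V) :
    ∀ᶠ q : ℝ × EuclideanSpace ℝ (Fin m) in 𝓝 (t, C.chart x),
      q.1 ∈ S ∧ C.chart.symm q.2 ∈ N ∧ β q.1 (C.chart.symm q.2) ∈ V := by
  have hxU := h.subset hx
  have hc : ContinuousAt (fun q : ℝ × EuclideanSpace ℝ (Fin m) => (q.1, C.chart.symm q.2))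
      (t, C.chart x) := continuousAt_fst.prodMk
    ((C.chart.continuousAt_symm (C.map_mem hxU)).comp_of_eq continuousAt_snd rfl)
  have hev := h.eventually_mem ht hx hV
  rw [← C.left_inv hxU] at hev
  exact hc.eventually hev

/-- Taylor evaluation in the initial position preserves homomorphisms and the flow equation. For a
box this replaces the initial point given by `C.triv` by an arbitrary point κ over x, for instance
one from another trivialization. -/
theorem IsFlowFamily.isFlowCurve_nilEval (h : IsFlowFamily X C S N β k) {x : M} (hx : x ∈ N)
    {κ : ∀ V : Opens M, O.obj V → Coeff 𝒜 n} (hκ : IsPoint n x κ) :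
    IsFlowCurve n X S (fun t => β t x)
      (fun t V f => nilEval (C.ptOf hP κ) fun e => k t (C.chart.symm e) V f) := by
  have hxU := h.subset hx
  have hb := hκ.base_ptOf hP hxU
  have hline : ∀ t : ℝ, Tendsto (fun e => (t, e)) (𝓝 (C.ptOf hP κ).base)
      (𝓝 (t, C.chart x)) := fun t => by
    rw [hb]; exact (Continuous.prodMk_right t).tendsto' _ _ rfl
  refine ⟨fun t ht => ?_, (h.isFlowCurve x hx).cont, fun t ht V f hV => ?_⟩
  · have hsm : ∀ {V : Opens M} (_ : β t x ∈ V) (f : O.obj V),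
        SmoothNear (fun e => k t (C.chart.symm e) V f) (C.ptOf hP κ).base := fun hV f => by
      rw [hb]
      exact SmoothNear.comp (g := fun e => (t, e)) (h.smooth t ht x hx _ f hV)
        (.of_contDiff (contDiff_const.prodMk contDiff_id) _)
    have hpt : ∀ {V : Opens M} (_ : β t x ∈ V), ∀ᶠ e in 𝓝 (C.ptOf hP κ).base,
        β t (C.chart.symm e) ∈ V ∧
          IsPoint n (β t (C.chart.symm e)) (k t (C.chart.symm e)) := fun hV => by
      filter_upwards [(hline t).eventually (h.eventually_symm_mem ht hx hV)] with e he
      exact ⟨he.2.2, (h.isFlowCurve _ he.2.1).isPoint t ht⟩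
    refine ⟨fun V hV f g => ?_, fun V hV f g => ?_, fun V hV a => ?_, fun V hV i f hf => ?_,
      fun {V W} hVW f hV => ?_⟩
    · rw [← nilEval_add _ (hsm hV f) (hsm hV g)]
      refine nilEval_congr _ ?_
      filter_upwards [hpt hV] with e he using he.2.add V he.1 f g
    · rw [← nilEval_mul _ (hsm hV f) (hsm hV g)]
      refine nilEval_congr _ ?_
      filter_upwards [hpt hV] with e he using he.2.mul V he.1 f g
    · have hs : nilEval (C.ptOf hP κ)
          (fun _ => GradedTensorProduct.includeLeft 𝒜 (extParity n) a) =
          GradedTensorProduct.includeLeft 𝒜 (extParity n) a :=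
        (isGermHom_nilEval (C.ptOf hP κ)).scal _ ⟨a, rfl⟩
      refine Eq.trans ?_ hs
      refine nilEval_congr _ ?_
      filter_upwards [hpt hV] with e he using he.2.scalar V he.1 a
    · refine nilEval_mem (S := coeffWeil hP n) (C.ptOf hP κ) i ?_
      filter_upwards [hpt hV] with e he using he.2.mem V he.1 i f hf
    · refine nilEval_congr _ ?_
      filter_upwards [hpt hV] with e he using he.2.res hVW f he.1
  · refine nilEval_hasDerivAt
      (F := fun q : ℝ × EuclideanSpace ℝ (Fin m) => k q.1 (C.chart.symm q.2) V f)
      (F' := fun q : ℝ × EuclideanSpace ℝ (Fin m) => k q.1 (C.chart.symm q.2) V (X.app V f))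
      (by rw [hb]; exact h.smooth t ht x hx V f hV) ?_
    rw [hb]
    filter_upwards [h.eventually_symm_mem ht hx hV] with q hq
    exact (h.isFlowCurve _ hq.2.1).deriv q.1 hq.1 V f hq.2.2

theorem IsFlowBox.congr (h : IsFlowBox X C S N β k)
    (hβ : ∀ t ∈ S, ∀ x ∈ N, β' t x = β t x)
    (hk : ∀ t ∈ S, ∀ x ∈ N, ∀ (V : Opens M) (f : O.obj V), β t x ∈ V → k' t x V f = k t x V f) :
    IsFlowBox X C S N β' k' :=
  ⟨h.toIsFlowFamily.congr hβ hk, h.ordConnected, h.zero_mem,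
    fun x hx => (hβ 0 h.zero_mem x hx).trans (h.body_zero x hx), fun x hx V f hV =>
    (hk 0 h.zero_mem x hx V f ((h.body_zero x hx).symm ▸ hV)).trans (h.zero x hx V f hV)⟩

variable [T2Space M] [IsManifold (𝓡 m) ∞ M] (hO : IsSupermanifold m n O)

include hO

/-- Transformation rule between supercharts: both sides are flow curves starting at the point given
by `C'.triv`, hence equal by uniqueness. -/
theorem IsFlowBox.nilEval_eq {C' : SuperChart m n O} (h : IsFlowBox X C S N β k)
    (h' : IsFlowBox X C' S' N' β' k') {t : ℝ} (ht : t ∈ S) (ht' : t ∈ S') {x : M} (hx : x ∈ N)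
    (hx' : x ∈ N') : β t x = β' t x ∧ ∀ (V : Opens M) (f : O.obj V), β t x ∈ V →
      (nilEval (C.ptOf hP fun V (f : O.obj V) => coord C'.triv f x)
        fun e => k t (C.chart.symm e) V f) = k' t x V f := by
  have hκ := isPoint_coord (n := n) C'.triv (h'.subset hx')
  have hb := hκ.base_ptOf hP (h.subset hx)
  have e0 := h.body_zero x hx
  have hc := h.toIsFlowFamily.isFlowCurve_nilEval hP hx hκ
  refine (hc.mono Set.inter_subset_left).eqOn hO hP
    ((h'.isFlowCurve x hx').mono Set.inter_subset_right)
    (h.isOpen_time.inter h'.isOpen_time) (h.ordConnected.inter h'.ordConnected)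
    ⟨h.zero_mem, h'.zero_mem⟩ (e0.trans (h'.body_zero x hx').symm) (fun V f hV => ?_) t ⟨ht, ht'⟩
  have hV' : x ∈ V := e0 ▸ hV
  rw [h'.zero x hx' V f hV', hκ.eq_nilEval hP (h.subset hx) hV' f]
  refine nilEval_congr _ ?_
  have hxU := h.subset hx
  have hs : C.chart.symm (C.chart x) ∈ N := by rwa [C.left_inv hxU]
  have hVs : C.chart.symm (C.chart x) ∈ V := by rwa [C.left_inv hxU]
  rw [hb]
  filter_upwards [(C.chart.continuousAt_symm (C.map_mem hxU)).eventually
    (h.isOpen_space.mem_nhds hs), (C.eventually_symm_mem (C.map_mem hxU) hVs)] with e he he'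
  exact h.zero _ he V f he'.2

include hP in
theorem IsFlowBox.eq (h : IsFlowBox X C S N β k) (h' : IsFlowBox X C S' N' β' k') {t : ℝ}
    (ht : t ∈ S) (ht' : t ∈ S') {x : M} (hx : x ∈ N) (hx' : x ∈ N') : β t x = β' t x ∧
      ∀ (V : Opens M) (f : O.obj V), β t x ∈ V → k t x V f = k' t x V f :=
  ((h.isFlowCurve x hx).mono Set.inter_subset_left).eqOn hO hP
    ((h'.isFlowCurve x hx').mono Set.inter_subset_right)
    (h.isOpen_time.inter h'.isOpen_time) (h.ordConnected.inter h'.ordConnected)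
    ⟨h.zero_mem, h'.zero_mem⟩ ((h.body_zero x hx).trans (h'.body_zero x hx').symm)
    (fun V f hV => by
      have hV' : x ∈ V := h.body_zero x hx ▸ hV
      rw [h.zero x hx V f hV', h'.zero x hx' V f hV']) t ⟨ht, ht'⟩

omit hO [T2Space M] [IsManifold (𝓡 m) ∞ M] in
variable (X) in
/-- A flow on `Ω` in terms of its coordinate expressions in all supercharts. -/
def IsGlobalFlow (Ω : Opens (ℝ × M)) (β : ℝ → M → M)
    (k : SuperChart m n O → ℝ → M → ∀ V : Opens M, O.obj V → Coeff 𝒜 n) : Prop :=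
  ∀ (C : SuperChart m n O) (t : ℝ) (x : M), (t, x) ∈ Ω → x ∈ C.U →
    ∃ S N, IsFlowBox X C S N β (k C) ∧ t ∈ S ∧ x ∈ N

include hP in
-- Ω is open because a flow box at (t, x) forces its times into the maximal intervals of all nearby
-- positions. The bodies are the maximal integral curves. The values come from a box chosen
-- separately at each (t, x), and uniqueness makes the choices coherent.
theorem exists_isGlobalFlow {v : (x : M) → TangentSpace (𝓡 m) x}
    (hv : ActsAsBody (n := n) aug X v) : ∃ Ω : Opens (ℝ × M),
      (∀ t x, (t, x) ∈ Ω ↔ t ∈ ⋃₀ integralIntervals v x) ∧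
      ∃ (β : ℝ → M → M)
        (k : SuperChart m n O → ℝ → M → ∀ V : Opens M, O.obj V → Coeff 𝒜 n),
        IsGlobalFlow X Ω β k := by
  have : IsManifold (𝓡 m) 1 M := .of_le (n := ∞) (by simp)
  have hv1 := (hv.contMDiff hO hP).of_le (m := 1) (by simp)
  have hI := isGreatest_integralIntervals hv1
  let Ω : Opens (ℝ × M) := ⟨{p | p.1 ∈ ⋃₀ integralIntervals v p.2}, by
    rw [isOpen_iff_mem_nhds]
    rintro ⟨t, x⟩ ht
    obtain ⟨C, hC⟩ := exists_superChart hO x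
    obtain ⟨S, N, β, k, h, htS, hxN⟩ := exists_isFlowBox hO hP hv hC (hI x).1 ht
    refine mem_of_superset (prod_mem_nhds (h.isOpen_time.mem_nhds htS)
      (h.isOpen_space.mem_nhds hxN)) fun q hq => ?_
    exact ⟨S, h.mem_integralIntervals hO hP hv hq.2, hq.1⟩⟩
  refine ⟨Ω, fun t x => Iff.rfl, ?_⟩
  choose γ hγ hγ0 using fun x => (hI x).1.2.2.2
  have hex : ∀ (C : SuperChart m n O) (t : ℝ) (x : M), ∃ S N β k, (t, x) ∈ Ω → x ∈ C.U →
      IsFlowBox (n := n) X C S N β k ∧ t ∈ S ∧ x ∈ N := fun C t x => by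
    by_cases ht : (t, x) ∈ Ω
    · by_cases hx : x ∈ C.U
      · obtain ⟨S, N, β, k, h⟩ := exists_isFlowBox hO hP hv hx (hI x).1 ht
        exact ⟨S, N, β, k, fun _ _ => h⟩
      · exact ⟨∅, ∅, fun _ x => x, fun _ _ _ _ => 0, fun _ h => absurd h hx⟩
    · exact ⟨∅, ∅, fun _ x => x, fun _ _ _ _ => 0, fun h => absurd h ht⟩
  choose S N β k h using hex
  have hβ : ∀ C t x, (t, x) ∈ Ω → x ∈ C.U → ∀ τ ∈ S C t x, ∀ y ∈ N C t x,
      γ y τ = β C t x τ y ∧ (τ, y) ∈ Ω := fun C t x ht hx τ hτ y hy => by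
    have hb := (h C t x ht hx).1
    have hS := hb.mem_integralIntervals hO hP hv hy
    exact ⟨integralCurve_eqOn hv1 hb.isOpen_time hb.ordConnected hb.zero_mem
      ((hγ y).mono (Set.subset_sUnion_of_mem hS)) (hb.isMIntegralCurveOn hO hP hv hy)
      ((hγ0 y).trans (hb.body_zero y hy).symm) hτ, S C t x, hS, hτ⟩
  -- The value at (t, x) is read off from the box chosen for (t, x). That box represents the
  -- resulting family on its whole domain, since the boxes chosen for its other points agree with it
  -- at those points.
  refine ⟨fun t x => γ x t, fun C t x => k C t x t x, fun C t x ht hx =>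
    ⟨S C t x, N C t x, ?_, (h C t x ht hx).2⟩⟩
  have hb := (h C t x ht hx).1
  refine hb.congr (fun τ hτ y hy => (hβ C t x ht hx τ hτ y hy).1) fun τ hτ y hy V f hV => ?_
  have hyΩ := (hβ C t x ht hx τ hτ y hy).2
  obtain ⟨h1, h2, h3⟩ := h C τ y hyΩ (hb.subset hy)
  exact ((hb.eq hP hO h1 hτ h2 hy h3).2 V f hV).symm

end GlobalFlow

open Filter Topology

/-! ### Gluing the coordinate data of the flow to sections. -/

section GlobalFlow

variable {P : Type u} [Ring P] [Algebra ℝ P] [FiniteDimensional ℝ P]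
  {𝒜 : ZMod 2 → Submodule ℝ P} [GradedAlgebra 𝒜] {m n : ℕ}
variable {M : Type v} [TopologicalSpace M] [ChartedSpace (EuclideanSpace ℝ (Fin m)) M]
variable {O : SuperSheaf.{u, v, w} 𝒜 M} {U : Opens M}
variable {aug : P →ₐ[ℝ] ℝ} (hP : IsSmall 𝒜 aug)
variable {X : EvenVectorField O} {C : SuperChart m n O} {S S' : Set ℝ} {N N' : Set M}
  {β : ℝ → M → M} {k : ℝ → M → ∀ V : Opens M, O.obj V → Coeff 𝒜 n}

open SuperWeil

/-! ### Sections determined by their coordinates -/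

theorem mem_gr_of_coord {W : Opens M} {s : O.obj W} {i : ZMod 2}
    (h : ∀ x ∈ W, ∃ (U : Opens M) (φ : Trivialization m n O U), x ∈ U ∧
      ∀ y ∈ W, y ∈ U → coord φ s y ∈ coeffGr 𝒜 n i) : s ∈ O.gr W i := by
  have hex : ∃ j, IsCompl (O.gr W i) (O.gr W j) ∧ IsCompl (coeffGr 𝒜 n i) (coeffGr 𝒜 n j) := by
    rcases zmod_two_cases i with rfl | rfl
    · exact ⟨1, O.isCompl W, coeffGr_isCompl 𝒜 n⟩
    · exact ⟨0, (O.isCompl W).symm, (coeffGr_isCompl 𝒜 n).symm⟩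
  obtain ⟨j, hj, hj'⟩ := hex
  obtain ⟨a, ha, b, hb, rfl⟩ :=
    Submodule.mem_sup.1 (hj.sup_eq_top ▸ Submodule.mem_top : s ∈ O.gr W i ⊔ O.gr W j)
  have e : a + b = a := section_ext fun x hx => by
    obtain ⟨U, φ, hU, hφ⟩ := h x hx
    refine ⟨U, φ, hU, fun y hy hyU => ?_⟩
    have h1 := hφ y hy hyU
    rw [coord_add φ a b hy] at h1 ⊢
    have h2 := (Submodule.add_mem_iff_right _ (coord_gr φ i ha y)).1 h1
    rw [Submodule.disjoint_def.1 hj'.disjoint _ h2 (coord_gr φ j hb y), add_zero]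
  rwa [e]

theorem SuperChart.smoothNear_coord_symm (C : SuperChart m n O) (φ : Trivialization m n O U)
    {x : M} (hx : x ∈ C.U) (hxU : x ∈ U) {V : Opens M} (hV : x ∈ V) (f : O.obj V) :
    SmoothNear (fun e => coord φ f (C.chart.symm e)) (C.chart x) := by
  have h0 : C.chart.symm (C.chart x) ∈ U ⊓ V := by rw [C.left_inv hx]; exact ⟨hxU, hV⟩
  filter_upwards [C.eventually_symm_mem (C.map_mem hx) h0] with e he
  have h1 : ContMDiffAt (𝓡 m) 𝓘(ℝ, Coeff 𝒜 n) ∞ (coord φ f) (C.chart.symm e) :=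
    (contMDiffOn_coord φ f).contMDiffAt ((U ⊓ V).isOpen.mem_nhds he.2)
  exact (h1.comp e (C.contMDiffAt_symm he.1)).contDiffAt

/-- Change of trivialization: by `IsPoint.eq_nilEval` the coordinates in φ are Taylor evaluations of
those in C, so a section known in supercharts is known in every trivialization. -/
theorem coord_eq_nilEval (φ : Trivialization m n O U) {x : M} (hx : x ∈ C.U) (hxU : x ∈ U)
    {W : Opens M} (hW : x ∈ W) {s : O.obj W} {F : M → Coeff 𝒜 n}
    (hF : ∀ y ∈ W, y ∈ C.U → coord C.triv s y = F y) :
    coord φ s x = nilEval (C.ptOf hP fun V (f : O.obj V) => coord φ f x)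
      fun e => F (C.chart.symm e) := by
  have hκ := isPoint_coord (n := n) φ hxU
  have h0 : C.chart.symm (C.chart x) ∈ W := by rwa [C.left_inv hx]
  rw [hκ.eq_nilEval hP hx hW s]
  refine nilEval_congr _ ?_
  rw [hκ.base_ptOf hP hx]
  filter_upwards [C.eventually_symm_mem (C.map_mem hx) h0] with e he
  exact hF _ he.2 (C.symm_mem he.1)

/-- Needed because `timeSections` demands smooth coefficients in every trivialization φ. The flow
data and the point defined by φ vary smoothly together, and so does the evaluation. -/
theorem IsFlowFamily.smoothNear_nilEval (h : IsFlowFamily X C S N β k)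
    (φ : Trivialization m n O U) {t : ℝ} (ht : t ∈ S) {x : M} (hx : x ∈ N) (hxU : x ∈ U)
    {V : Opens M} (hV : β t x ∈ V) (f : O.obj V) :
    SmoothNear (fun q : ℝ × EuclideanSpace ℝ (Fin m) =>
      nilEval (C.ptOf hP fun V (f : O.obj V) => coord φ f (C.chart.symm q.2))
        fun e => k q.1 (C.chart.symm e) V f) (t, C.chart x) := by
  have hxC := h.subset hx
  have hκ := isPoint_coord (n := n) φ hxU
  have h1 := nilEval_smoothNear (q₀ := t)
    (p₀ := C.ptOf hP fun V (f : O.obj V) => coord φ f x)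
    (F := fun q : ℝ × EuclideanSpace ℝ (Fin m) => k q.1 (C.chart.symm q.2) V f)
    (by rw [hκ.base_ptOf hP hxC]; exact h.smooth t ht x hx V f hV)
  have h2 : SmoothNear (fun e => C.ptOf hP fun V (f : O.obj V) => coord φ f (C.chart.symm e))
      (C.chart x) :=
    C.smoothNear_ptOf hP
      (fun i => C.smoothNear_coord_symm φ hxC hxU (SuperChart.mem_dom_even i hxC) _)
      (fun j => C.smoothNear_coord_symm φ hxC hxU (SuperChart.mem_dom_odd j hxC) _)
  have h3 : SmoothNear (fun q : ℝ × EuclideanSpace ℝ (Fin m) =>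
      (q.1, C.ptOf hP fun V (f : O.obj V) => coord φ f (C.chart.symm q.2))) (t, C.chart x) := by
    filter_upwards [(continuous_snd.tendsto (t, C.chart x)).eventually h2] with q hq
    have hσ : ContDiffAt ℝ ∞ (fun q : ℝ × EuclideanSpace ℝ (Fin m) =>
        C.ptOf hP fun V (f : O.obj V) => coord φ f (C.chart.symm q.2)) q :=
      ContDiffAt.comp (g := fun e => C.ptOf hP fun V (f : O.obj V) =>
        coord φ f (C.chart.symm e)) q hq contDiffAt_snd
    exact contDiffAt_fst.prodMk hσ
  have h4 : SmoothNear (fun q : ℝ × (coeffWeil hP n).Pt m =>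
      nilEval q.2 fun e => k q.1 (C.chart.symm e) V f)
      (t, C.ptOf hP fun V (f : O.obj V) => coord φ f (C.chart.symm (C.chart x))) := by
    rw [C.left_inv hxC]
    exact h1
  exact SmoothNear.comp (g := fun q : ℝ × EuclideanSpace ℝ (Fin m) =>
    ((q.1, C.ptOf hP fun V (f : O.obj V) => coord φ f (C.chart.symm q.2)) :
      ℝ × (coeffWeil hP n).Pt m)) h4 h3

variable [T2Space M] [IsManifold (𝓡 m) ∞ M] (hO : IsSupermanifold m n O)

include hO

omit [T2Space M] in
theorem section_ext_superChart {W : Opens M} {f g : O.obj W}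
    (h : ∀ (C : SuperChart m n O), ∀ x ∈ W, x ∈ C.U → coord C.triv f x = coord C.triv g x) :
    f = g :=
  section_ext fun x _ =>
    let ⟨C, hC⟩ := exists_superChart hO x
    ⟨C.U, C.triv, hC, fun y hy hyU => h C y hy hyU⟩

/-! ### The supermorphism defined by a global flow. -/

namespace IsGlobalFlow

variable {Ω : Opens (ℝ × M)} {K : SuperChart m n O → ℝ → M → ∀ V : Opens M, O.obj V → Coeff 𝒜 n}
  (h : IsGlobalFlow X Ω β K)

/-- The body of a global flow. -/
def body : C(Ω, M) where
  toFun p := β p.1.1 p.1.2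
  continuous_toFun := continuous_iff_continuousAt.2 fun p => by
    obtain ⟨C, hC⟩ := exists_superChart hO p.1.2
    obtain ⟨S, N, hb, ht, hx⟩ := h C p.1.1 p.1.2 p.2 hC
    exact ContinuousAt.comp_of_eq (hb.cont _ ht _ hx) continuous_subtype_val.continuousAt rfl

/-- The domain over which the pullback of a section over `V` is defined. -/
def dom (V : Opens M) : Opens (ℝ × M) := imageOpen Ω (Opens.comap (h.body hO) V)

omit [T2Space M] in
theorem mem_dom {V : Opens M} {t : ℝ} {x : M} :
    (t, x) ∈ h.dom hO V ↔ (t, x) ∈ Ω ∧ β t x ∈ V := by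
  constructor
  · rintro ⟨p, hp, e⟩
    have hp' : β p.1.1 p.1.2 ∈ V := hp
    rw [e] at hp'
    exact ⟨e ▸ p.2, hp'⟩
  · rintro ⟨h1, h2⟩
    exact ⟨⟨(t, x), h1⟩, h2, rfl⟩

omit [T2Space M] in
theorem mem_slice_dom {V : Opens M} {t : ℝ} {x : M} :
    x ∈ slice (h.dom hO V) t ↔ (t, x) ∈ Ω ∧ β t x ∈ V := h.mem_dom hO

include hP h in
-- The expression in one superchart forces the expression in any other, by change of trivialization
-- and `IsFlowBox.nilEval_eq`. This is the compatibility needed for gluing.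
theorem coord_eq {W : Opens M} {s : O.obj W} {V : Opens M} {f : O.obj V} {t : ℝ}
    {C C' : SuperChart m n O} {x : M} (hW : x ∈ W) (hx : x ∈ C.U) (hx' : x ∈ C'.U)
    (htx : (t, x) ∈ Ω) (hV : β t x ∈ V)
    (hs : ∀ y ∈ W, y ∈ C.U → coord C.triv s y = K C t y V f) :
    coord C'.triv s x = K C' t x V f := by
  obtain ⟨S, N, hb, ht, hxN⟩ := h C t x htx hx
  obtain ⟨S', N', hb', ht', hxN'⟩ := h C' t x htx hx'
  rw [coord_eq_nilEval hP C'.triv hx hx' hW hs]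
  exact (hb.nilEval_eq hP hO hb' ht ht' hxN hxN').2 V f hV

include hP in
-- At fixed t the section is glued from its pieces over superchart domains; `coord_eq` gives
-- agreement on overlaps.
theorem exists_pull (V : Opens M) (f : O.obj V) (t : ℝ) : ∃ s : O.obj (slice (h.dom hO V) t),
    ∀ (C : SuperChart m n O), ∀ x ∈ slice (h.dom hO V) t, x ∈ C.U →
      coord C.triv s x = K C t x V f := by
  choose C hC using exists_superChart (n := n) hO
  let D := slice (h.dom hO V) t
  let F : M → EuclideanSpace ℝ (Fin m) → Coeff 𝒜 n := fun y e => K (C y) t ((C y).chart.symm e) V f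
  have hle : ∀ y, (C y).U ⊓ D ≤ (C y).dom (F y) := fun y x hx => by
    obtain ⟨htx, hV⟩ := (h.mem_slice_dom hO).1 hx.2
    obtain ⟨S, N, hb, ht, hxN⟩ := h (C y) t x htx hx.1
    refine (SuperChart.mem_dom hx.1).2 ?_
    exact SmoothNear.comp (g := fun e => (t, e)) (hb.smooth t ht x hxN V f hV)
      (.of_contDiff (contDiff_const.prodMk contDiff_id) _)
  let s : ∀ y, O.obj ((C y).U ⊓ D) := fun y => O.res (hle y) ((C y).sec (F y))
  have hs : ∀ y, ∀ x ∈ (C y).U ⊓ D, coord (C y).triv (s y) x = K (C y) t x V f :=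
    fun y x hx => by
      rw [coord_res _ _ _ hx, SuperChart.coord_sec _ (hle y hx)]
      simp only [F]
      rw [(C y).left_inv hx.1]
  have hs' : ∀ y (C' : SuperChart m n O), ∀ x ∈ (C y).U ⊓ D, x ∈ C'.U →
      coord C'.triv (s y) x = K C' t x V f := fun y C' x hx hx' => by
    obtain ⟨htx, hV⟩ := (h.mem_slice_dom hO).1 hx.2
    exact h.coord_eq hP hO hx hx.1 hx' htx hV fun z hz _ => hs y z hz
  obtain ⟨g, hg, -⟩ := O.glue D (fun y => (C y).U ⊓ D) (fun y => inf_le_right)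
    (fun x hx => Opens.mem_iSup.2 ⟨x, hC x, hx⟩) s fun i j => by
      refine eq_of_coord (C i).triv (inf_le_left.trans inf_le_left) fun x hx => ?_
      rw [coord_res _ _ _ hx, coord_res _ _ _ hx, hs i x hx.1, hs' j (C i) x hx.2 hx.1.1]
  refine ⟨g, fun C' x hx hx' => ?_⟩
  have hx0 : x ∈ (C x).U ⊓ D := ⟨hC x, hx⟩
  rw [← coord_res C'.triv (inf_le_right : (C x).U ⊓ D ≤ D) g hx0]
  exact (congrArg (fun z => coord C'.triv z x) (hg x)).trans (hs' x C' x hx0 hx')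

/-- The pullback of a section at time `t`. -/
def pull (V : Opens M) (f : O.obj V) (t : ℝ) : O.obj (slice (h.dom hO V) t) :=
  (h.exists_pull hP hO V f t).choose

theorem coord_pull {V : Opens M} (f : O.obj V) {t : ℝ} (C : SuperChart m n O) {x : M}
    (hx : x ∈ slice (h.dom hO V) t) (hxU : x ∈ C.U) :
    coord C.triv (h.pull hP hO V f t) x = K C t x V f :=
  (h.exists_pull hP hO V f t).choose_spec C x hx hxU

theorem coord_pull_eq_nilEval (φ : Trivialization m n O U) {V : Opens M} (f : O.obj V) {t : ℝ}
    {x : M} (hx : x ∈ slice (h.dom hO V) t) (hxU : x ∈ U) (hxC : x ∈ C.U) :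
    coord φ (h.pull hP hO V f t) x = nilEval (C.ptOf hP fun V (f : O.obj V) => coord φ f x)
      fun e => K C t (C.chart.symm e) V f :=
  coord_eq_nilEval hP φ hxC hxU hx (F := fun y => K C t y V f)
    fun _ hy hyU => h.coord_pull hP hO f C hy hyU

/-- Smoothness in (t, x) is local, and near each point the coefficient is a Taylor evaluation of a
flow box at a smoothly varying point. -/
theorem pull_mem_timeSections (V : Opens M) (f : O.obj V) :
    h.pull hP hO V f ∈ timeSections m n O (h.dom hO V) := by
  intro U φ
  rw [contMDiffOn_iff_linear (f := fun p : ℝ × M => coord φ (h.pull hP hO V f p.1) p.2)]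
  rintro ⟨t, x⟩ ⟨hp, hxU⟩
  obtain ⟨htx, hV⟩ := (h.mem_dom hO).1 hp
  obtain ⟨C, hC⟩ := exists_superChart hO x
  obtain ⟨S, N, hb, ht, hxN⟩ := h C t x htx hC
  have h1 := (hb.smoothNear_nilEval hP φ ht hxN hxU hV f).contDiffAt.contMDiffAt
  have h2 : ContMDiffAt (𝓘(ℝ, ℝ).prod (𝓡 m)) 𝓘(ℝ, ℝ × EuclideanSpace ℝ (Fin m)) ∞
      (fun p : ℝ × M => (p.1, C.chart p.2)) (t, x) :=
    contMDiffAt_fst.prodMk_space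
      ((C.contMDiffAt_chart hC).comp_of_eq (f := Prod.snd) contMDiffAt_snd rfl)
  have h3 := ContMDiffAt.comp (t, x) h1 h2
  refine (h3.congr_of_eventuallyEq ?_).contMDiffWithinAt
  have hopen : IsOpen {p : ℝ × M | p ∈ h.dom hO V ∧ p.2 ∈ U ⊓ C.U} :=
    (h.dom hO V).isOpen.inter ((U ⊓ C.U).isOpen.preimage continuous_snd)
  filter_upwards [hopen.mem_nhds ⟨hp, hxU, hC⟩] with p hp
  rw [h.coord_pull_eq_nilEval hP hO φ f hp.1 hp.2.1 hp.2.2]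
  simp only [Function.comp_apply]
  rw [C.left_inv hp.2.2]

/-- In an arbitrary φ the coefficients are a flow box evaluated at the point of φ, which is again a
flow curve. -/
theorem hasDerivAt_coord_pull (φ : Trivialization m n O U) {V : Opens M} (f : O.obj V) {t : ℝ}
    {x : M} (hx : (t, x) ∈ h.dom hO V) (hxU : x ∈ U) :
    HasDerivAt (fun τ => coord φ (h.pull hP hO V f τ) x)
      (coord φ (h.pull hP hO V (X.app V f) t) x) t := by
  obtain ⟨htx, hV⟩ := (h.mem_dom hO).1 hx
  obtain ⟨C, hC⟩ := exists_superChart hO x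
  obtain ⟨S, N, hb, ht, hxN⟩ := h C t x htx hC
  have h1 := (hb.toIsFlowFamily.isFlowCurve_nilEval hP hxN
    (isPoint_coord (n := n) φ hxU)).deriv t ht V f hV
  rw [h.coord_pull_eq_nilEval hP hO φ _ hx hxU hC]
  refine h1.congr_of_eventuallyEq ?_
  have hc : Continuous fun τ : ℝ => (τ, x) := by fun_prop
  filter_upwards [hc.continuousAt.eventually ((h.dom hO V).isOpen.mem_nhds hx)] with τ hτ
  exact h.coord_pull_eq_nilEval hP hO φ f hτ hxU hC

omit hO in
include h in
omit [T2Space M] [IsManifold (𝓡 m) ∞ M] in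
theorem isPoint {t : ℝ} {x : M} (htx : (t, x) ∈ Ω) (hx : x ∈ C.U) :
    IsPoint n (β t x) (K C t x) := by
  obtain ⟨S, N, hb, ht, hxN⟩ := h C t x htx hx
  exact (hb.isFlowCurve x hxN).isPoint t ht

theorem pull_add {V : Opens M} (f g : O.obj V) (t : ℝ) :
    h.pull hP hO V (f + g) t = h.pull hP hO V f t + h.pull hP hO V g t :=
  section_ext_superChart hO fun C x hx hxU => by
    obtain ⟨htx, hV⟩ := (h.mem_slice_dom hO).1 hx
    rw [coord_add _ _ _ hx, h.coord_pull hP hO _ C hx hxU, h.coord_pull hP hO _ C hx hxU,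
      h.coord_pull hP hO _ C hx hxU, (h.isPoint htx hxU).add V hV]

theorem pull_mul {V : Opens M} (f g : O.obj V) (t : ℝ) :
    h.pull hP hO V (f * g) t = h.pull hP hO V f t * h.pull hP hO V g t :=
  section_ext_superChart hO fun C x hx hxU => by
    obtain ⟨htx, hV⟩ := (h.mem_slice_dom hO).1 hx
    rw [coord_mul _ _ _ hx, h.coord_pull hP hO _ C hx hxU, h.coord_pull hP hO _ C hx hxU,
      h.coord_pull hP hO _ C hx hxU, (h.isPoint htx hxU).mul V hV]

theorem pull_scalar (V : Opens M) (a : P) (t : ℝ) :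
    h.pull hP hO V (O.scalar V a) t = O.scalar _ a :=
  section_ext_superChart hO fun C x hx hxU => by
    obtain ⟨htx, hV⟩ := (h.mem_slice_dom hO).1 hx
    rw [coord_scalar _ _ hxU hx, h.coord_pull hP hO _ C hx hxU,
      (h.isPoint htx hxU).scalar V hV]

theorem pull_algebraMap (V : Opens M) (r : ℝ) (t : ℝ) :
    h.pull hP hO V (algebraMap ℝ _ r) t = algebraMap ℝ _ r := by
  rw [← AlgHom.commutes (O.scalar V), h.pull_scalar, AlgHom.commutes]

theorem pull_mem {V : Opens M} {i : ZMod 2} {f : O.obj V} (hf : f ∈ O.gr V i) (t : ℝ) :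
    h.pull hP hO V f t ∈ O.gr _ i :=
  mem_gr_of_coord fun x _ => by
    obtain ⟨C, hC⟩ := exists_superChart (n := n) hO x
    refine ⟨C.U, C.triv, hC, fun y hy hyU => ?_⟩
    obtain ⟨hty, hV⟩ := (h.mem_slice_dom hO).1 hy
    rw [h.coord_pull hP hO _ C hy hyU]
    exact (h.isPoint hty hyU).mem V hV i f hf

theorem pull_res {V W : Opens M} (hVW : V ≤ W) (f : O.obj W) (t : ℝ)
    (hle : slice (h.dom hO V) t ≤ slice (h.dom hO W) t) :
    h.pull hP hO V (O.res hVW f) t = O.res hle (h.pull hP hO W f t) :=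
  section_ext_superChart hO fun C x hx hxU => by
    obtain ⟨htx, hV⟩ := (h.mem_slice_dom hO).1 hx
    rw [coord_res _ _ _ hx, h.coord_pull hP hO _ C hx hxU, h.coord_pull hP hO _ C (hle hx) hxU,
      (h.isPoint htx hxU).res hVW f hV]

/-- The supermorphism given by a global flow. -/
def hom : Hom ((timeProduct m n O).restrict Ω) O where
  body := h.body hO
  pullback V :=
    { toFun := fun f => (⟨h.pull hP hO V f, h.pull_mem_timeSections hP hO V f⟩ :
        timeSections m n O (h.dom hO V))
      map_one' := Subtype.ext (funext fun t => by
        have := h.pull_algebraMap hP hO V 1 t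
        rwa [map_one, map_one] at this)
      map_mul' := fun f g => Subtype.ext (funext fun t => h.pull_mul hP hO f g t)
      map_zero' := Subtype.ext (funext fun t => by
        have := h.pull_algebraMap hP hO V 0 t
        rwa [map_zero, map_zero] at this)
      map_add' := fun f g => Subtype.ext (funext fun t => h.pull_add hP hO f g t)
      commutes' := fun r => Subtype.ext (funext fun t => h.pull_algebraMap hP hO V r t) }
  pullback_mem V i f hf t := h.pull_mem hP hO hf t
  pullback_scalar V a := Subtype.ext (funext fun t => h.pull_scalar hP hO V a t)
  pullback_res {V W} hVW f := Subtype.ext (funext fun t => h.pull_res hP hO hVW f t _)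

theorem isFlow_hom (hΩ : ∀ x, ((0 : ℝ), x) ∈ Ω) : IsFlow X Ω (h.hom hP hO) where
  deriv V f U φ := by
    have key : ∀ (t : ℝ) (x : M), (t, x) ∈ h.dom hO V → x ∈ U → ∀ l : Coeff 𝒜 n →ₗ[ℝ] ℝ,
        HasDerivAt (fun τ => l (coord φ (h.pull hP hO V f τ) x))
          (l (coord φ (h.pull hP hO V (X.app V f) t) x)) t := fun t x hx hxU =>
      hasDerivAt_iff_linear.2 (h.hasDerivAt_coord_pull hP hO φ f hx hxU)
    exact fun l t x hx hxU => key t x hx hxU l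
  body_zero x hx := by
    obtain ⟨C, hC⟩ := exists_superChart hO x
    obtain ⟨S, N, hb, ht, hxN⟩ := h C 0 x hx hC
    exact hb.body_zero x hxN
  pullback_zero V hle f := section_ext_superChart hO fun C x hx hxU => by
    rw [coord_res _ _ _ hx]
    refine (h.coord_pull hP hO f C (hle hx) hxU).trans ?_
    obtain ⟨S, N, hb, ht, hxN⟩ := h C 0 x (hΩ x) hxU
    exact hb.zero x hxN V f hx

end IsGlobalFlow

end GlobalFlow

open Filter Topology

section Uniqueness

variable {P : Type u} [Ring P] [Algebra ℝ P] [FiniteDimensional ℝ P]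
  {𝒜 : ZMod 2 → Submodule ℝ P} [GradedAlgebra 𝒜] {m n : ℕ}
variable {M : Type v} [TopologicalSpace M] [ChartedSpace (EuclideanSpace ℝ (Fin m)) M]
variable {O : SuperSheaf.{u, v, w} 𝒜 M} {U : Opens M}
variable {aug : P →ₐ[ℝ] ℝ}
variable {X : EvenVectorField O} {Ω : Opens (ℝ × M)}
  {J J' : Hom ((timeProduct m n O).restrict Ω) O}

/-! ### Flows as families of flow curves -/

open Classical in
/-- The curve `t ↦ J(t, x)` in the body. -/
def bodyCurve (J : Hom ((timeProduct m n O).restrict Ω) O) (x : M) (t : ℝ) : M :=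
  if h : (t, x) ∈ Ω then J.body ⟨(t, x), h⟩ else x

theorem bodyCurve_of_mem {t : ℝ} {x : M} (h : (t, x) ∈ Ω) :
    bodyCurve J x t = J.body ⟨(t, x), h⟩ := dif_pos h

theorem mem_imageOpen_comap {t : ℝ} {x : M} (h : (t, x) ∈ Ω) {V : Opens M}
    (hV : bodyCurve J x t ∈ V) : (t, x) ∈ imageOpen Ω (Opens.comap J.body V) :=
  ⟨⟨(t, x), h⟩, by rwa [bodyCurve_of_mem h] at hV, rfl⟩

theorem continuousOn_bodyCurve (x : M) : ContinuousOn (bodyCurve J x) {t | (t, x) ∈ Ω} := by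
  rw [continuousOn_iff_continuous_domRestrict]
  have h1 : Set.domRestrict {t | (t, x) ∈ Ω} (bodyCurve J x) =
      fun t : {t | (t, x) ∈ Ω} => J.body ⟨(t.1, x), t.2⟩ :=
    funext fun t => bodyCurve_of_mem t.2
  rw [h1]
  exact J.body.continuous.comp (by fun_prop)

/-- Evaluating J^* at x in a trivialization gives points over the body curve, so every flow, however
obtained, is subject to the uniqueness of flow curves. -/
theorem IsFlow.isFlowCurve (hJ : IsFlow X Ω J) (φ : Trivialization m n O U) {x : M}
    (hx : x ∈ U) : IsFlowCurve n X {t | (t, x) ∈ Ω} (bodyCurve J x)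
      (fun t V f => coord φ ((J.pullback V f).1 t) x) := by
  refine ⟨fun t ht => ⟨fun V hV f g => ?_, fun V hV f g => ?_, fun V hV a => ?_,
    fun V hV i f hf => ?_, fun {V W} hVW f hV => ?_⟩, continuousOn_bodyCurve x,
    fun t ht V f hV => ?_⟩
  · have hm : x ∈ slice (imageOpen Ω (Opens.comap J.body V)) t := mem_imageOpen_comap ht hV
    rw [map_add]
    exact coord_add φ _ _ hm
  · have hm : x ∈ slice (imageOpen Ω (Opens.comap J.body V)) t := mem_imageOpen_comap ht hV
    rw [map_mul]
    exact coord_mul φ _ _ hm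
  · have hm : x ∈ slice (imageOpen Ω (Opens.comap J.body V)) t := mem_imageOpen_comap ht hV
    rw [J.pullback_scalar]
    exact coord_scalar φ a hx hm
  · exact coord_gr φ i (J.pullback_mem V i f hf t) x
  · have hm : x ∈ slice (imageOpen Ω (Opens.comap J.body V)) t := mem_imageOpen_comap ht hV
    rw [J.pullback_res]
    exact coord_res φ _ _ hm
  · exact hasDerivAt_iff_linear.1 fun l =>
      hJ.deriv V f U φ l t x (mem_imageOpen_comap ht hV) hx

theorem IsFlow.bodyCurve_zero (hJ : IsFlow X Ω J) {x : M} (h0 : ((0 : ℝ), x) ∈ Ω) :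
    bodyCurve J x 0 = x := by
  rw [bodyCurve_of_mem h0, hJ.body_zero]

theorem IsFlow.coord_pullback_zero (hJ : IsFlow X Ω J) (hΩ : ∀ x, ((0 : ℝ), x) ∈ Ω)
    (φ : Trivialization m n O U) {V : Opens M} (f : O.obj V) {x : M} (hV : x ∈ V) :
    coord φ ((J.pullback V f).1 0) x = coord φ f x := by
  have hle : V ≤ slice (imageOpen Ω (Opens.comap J.body V)) 0 := fun y hy =>
    mem_imageOpen_comap (hΩ y) (by rwa [hJ.bodyCurve_zero (hΩ y)])
  have h1 := congrArg (fun s => coord φ s x) (hJ.pullback_zero V hle f)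
  rw [← h1]
  exact (coord_res φ hle _ hV).symm

theorem isOpen_times (Ω : Opens (ℝ × M)) (x : M) : IsOpen {t : ℝ | (t, x) ∈ Ω} :=
  Ω.isOpen.preimage (by fun_prop : Continuous fun t : ℝ => (t, x))

variable [T2Space M] [IsManifold (𝓡 m) ∞ M]

/-- Over each x both flows are flow curves with the same start, so first their bodies and then their
coefficients agree, and coefficients determine sections. -/
theorem IsFlow.unique (hO : IsSupermanifold m n O) (hP : IsSmall 𝒜 aug)
    (hΩ : IsIntervalBundle Ω) (hJ : IsFlow X Ω J) (hJ' : IsFlow X Ω J') : J = J' := by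
  have h0 : ∀ x, ((0 : ℝ), x) ∈ Ω := fun x => (hΩ x).1
  have key : ∀ (C : SuperChart m n O) (x : M), x ∈ C.U → ∀ t, (t, x) ∈ Ω →
      bodyCurve J x t = bodyCurve J' x t ∧ ∀ (V : Opens M) (f : O.obj V), bodyCurve J x t ∈ V →
        coord C.triv ((J.pullback V f).1 t) x = coord C.triv ((J'.pullback V f).1 t) x :=
    fun C x hx => (hJ.isFlowCurve C.triv hx).eqOn hO hP (hJ'.isFlowCurve C.triv hx)
      (isOpen_times Ω x) (hΩ x).2 (h0 x)
      ((hJ.bodyCurve_zero (h0 x)).trans (hJ'.bodyCurve_zero (h0 x)).symm) fun V f hV => by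
        rw [hJ.bodyCurve_zero (h0 x)] at hV
        exact (hJ.coord_pullback_zero h0 C.triv f hV).trans
          (hJ'.coord_pullback_zero h0 C.triv f hV).symm
  have hbody : J.body = J'.body := ContinuousMap.ext fun p => by
    obtain ⟨C, hC⟩ := exists_superChart (n := n) hO p.1.2
    have h1 := (key C p.1.2 hC p.1.1 p.2).1
    rwa [bodyCurve_of_mem p.2, bodyCurve_of_mem p.2] at h1
  have hpull : ∀ (C : SuperChart m n O) (x : M), x ∈ C.U → ∀ (t : ℝ) (V : Opens M)
      (f : O.obj V), (t, x) ∈ imageOpen Ω (Opens.comap J.body V) →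
        coord C.triv ((J.pullback V f).1 t) x = coord C.triv ((J'.pullback V f).1 t) x := by
    rintro C x hx t V f ⟨⟨q, hq⟩, hqV, rfl⟩
    exact (key C x hx t hq).2 V f (by rw [bodyCurve_of_mem hq]; exact hqV)
  -- The pullbacks take values over preimages under the body maps, so their types match only after
  -- the bodies are identified.
  obtain ⟨b, p, _, _, _⟩ := J
  obtain ⟨b', p', _, _, _⟩ := J'
  obtain rfl : b = b' := hbody
  obtain rfl : p = p' := funext fun V => AlgHom.ext fun f => Subtype.ext (funext fun t =>
    section_ext_superChart hO fun C x hx hxU => hpull C x hxU t V f hx)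
  rfl

omit [T2Space M] in
-- The body curves of a flow are integral curves of X^#, which bounds every flow domain by the
-- maximal one.
theorem IsFlow.mem_integralIntervals (hO : IsSupermanifold m n O) (hP : IsSmall 𝒜 aug)
    (hΩ : IsIntervalBundle Ω) (hJ : IsFlow X Ω J) {v : (x : M) → TangentSpace (𝓡 m) x}
    (hv : ActsAsBody (n := n) aug X v) (x : M) : {t | (t, x) ∈ Ω} ∈ integralIntervals v x := by
  obtain ⟨C, hC⟩ := exists_superChart hO x
  exact ⟨isOpen_times Ω x, (hΩ x).2, (hΩ x).1, bodyCurve J x,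
    (hJ.isFlowCurve C.triv hC).isMIntegralCurveOn hO hP hv (isOpen_times Ω x),
    hJ.bodyCurve_zero (hΩ x).1⟩

omit [T2Space M] in
-- The chart differential is injective, and `ActsAsBody.mfderiv_chart` prescribes its value on v x.
theorem ActsAsBody.unique (hO : IsSupermanifold m n O) (hP : IsSmall 𝒜 aug)
    {v v' : (x : M) → TangentSpace (𝓡 m) x} (hv : ActsAsBody (n := n) aug X v)
    (hv' : ActsAsBody (n := n) aug X v') : v = v' := by
  funext x
  obtain ⟨C, hC⟩ := exists_superChart (n := n) hO x
  exact C.mdifferentiable.mfderiv_injective (C.mem_source hC)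
    ((hv.mfderiv_chart hP hC).trans (hv'.mfderiv_chart hP hC).symm)

end Uniqueness

end PSuper

end

/-! ### The global flow theorem. -/

theorem theorem3p4 {P : Type u} [Ring P] [Algebra ℝ P] [FiniteDimensional ℝ P]
    (𝒜 : ZMod 2 → Submodule ℝ P) [GradedAlgebra 𝒜] (aug : P →ₐ[ℝ] ℝ)
    (hP : PSuper.IsSmall 𝒜 aug) (m n : ℕ)
    {M : Type v} [TopologicalSpace M] [T2Space M]
    [ChartedSpace (EuclideanSpace ℝ (Fin m)) M] [IsManifold (𝓡 m) ∞ M]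
    (O : PSuper.SuperSheaf.{u, v, w} 𝒜 M) (hO : PSuper.IsSupermanifold m n O)
    (X : PSuper.EvenVectorField O) :
    (∀ Ω ∈ PSuper.flowBundles m n X,
      ∃! J : PSuper.Hom ((PSuper.timeProduct m n O).restrict Ω) O, PSuper.IsFlow X Ω J) ∧
    (∃! v : (x : M) → TangentSpace (𝓡 m) x, PSuper.IsBodyField m n aug X v) ∧
    (∀ v : (x : M) → TangentSpace (𝓡 m) x, PSuper.IsBodyField m n aug X v →
      ∃ I : M → Set ℝ, (∀ x, IsGreatest (PSuper.integralIntervals v x) (I x)) ∧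
        ∃ ΩX : TopologicalSpace.Opens (ℝ × M),
          (∀ (t : ℝ) (x : M), (t, x) ∈ ΩX ↔ t ∈ I x) ∧
          IsGreatest (PSuper.flowBundles m n X) ΩX) := by
  refine ⟨fun Ω hΩ => ?_, ?_, fun v hv => ?_⟩
  · obtain ⟨hint, J, hJ⟩ := hΩ
    exact ⟨J, hJ, fun J' hJ' => hJ'.unique hO hP hint hJ⟩
  · obtain ⟨v, hv⟩ := PSuper.exists_actsAsBody hO hP X
    exact ⟨v, ⟨hv.contMDiff hO hP, hv⟩, fun v' hv' =>
      PSuper.ActsAsBody.unique hO hP hv'.apply_body hv⟩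
  · have hact : PSuper.ActsAsBody (n := n) aug X v := hv.apply_body
    have : IsManifold (𝓡 m) 1 M := .of_le (n := ∞) (by simp)
    have hI := PSuper.isGreatest_integralIntervals (hv.smooth.of_le (m := 1) (by simp))
    obtain ⟨Ω, hΩ, β, K, h⟩ := PSuper.exists_isGlobalFlow hP hO hact
    refine ⟨_, hI, Ω, hΩ, ⟨fun x => ⟨(hΩ 0 x).2 (hI x).1.2.2.1, ?_⟩, h.hom hP hO,
      h.isFlow_hom hP hO fun x => (hΩ 0 x).2 (hI x).1.2.2.1⟩, ?_⟩
    · have e : {t : ℝ | (t, x) ∈ Ω} = ⋃₀ PSuper.integralIntervals v x :=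
        Set.ext fun t => hΩ t x
      rw [e]
      exact (hI x).1.2.1
    -- Maximality: the times of any other flow over x form an admissible interval for X^#, hence lie
    -- in the union of all of them.
    · rintro Ω' ⟨hint, J, hJ⟩ ⟨t, x⟩ htx
      exact (hΩ t x).2 ⟨_, hJ.mem_integralIntervals hO hP hint hact x, htx⟩
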